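/- **Setting.** Let $n,m\ge 1$, let $b_1,b_1'\in L^\infty(\mathbb R^n)$ and $b_2,b_2'\in L^\infty(\mathbb R^m)$ be complex valued, and let $b=b_1\otimes b_2$ and $b'=b_1'\otimes b_2'$ be pseudo-accretive: there is a constant $C>0$ such that $\frac1{|R|}\left|\int_R b\right|>C$ for every rectangle $R=K\times V$ with $K\subset\mathbb R^n$, $V\subset\mathbb R^m$ cubes (sides parallel to the axes), and similarly for $b'$. Let $T$ be a bounded linear operator on $L^2(\mathbb R^n\times\mathbb R^m)$, let $M_b$ denote multiplication by $b$, and let $\langle u,v\rangle=\int uv$ (bilinear pairing). Let $f,g\in C_0^\infty(\mathbb R^n\times\mathbb R^m)$ be complex valued. **Random grids.** Let $\mathcal D_0^n$ be the family of the half-open standard dyadic cubes of $\mathbb R^n$, of side lengths $\ell(I)=2^{-p}$, $p\in\mathbb Z$. For $\omega^n=(\omega^n_i)_{i\in\mathbb Z}\in(\{0,1\}^n)^{\mathbb Z}$ put $I\dotplus\omega^n=I+\sum_{i:\,2^{-i}<\ell(I)}2^{-i}\omega^n_i$ and $\mathcal D^n=\mathcal D^n_{\omega^n}=\{I\dotplus\omega^n: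 I\in\mathcal D_0^n\}$; let $\mathcal D^n_p$ consist of its cubes of side length $2^{-p}$. The $\omega_i^n$ are independent and uniformly distributed in $\{0,1\}^n$. The grids $\mathcal D^m$ are defined in the same way from $\omega^m$, which is independent of $\omega^n$. Let $\mathbb E_{\omega^n},\mathbb E_{\omega^m}$ be the expectations. **Martingale differences.** For $I\in\mathcal D_p^n$, in the first variable, $\Delta_I^{b_1}f=\chi_I\,(E_{p+1}^{b_1}f-E_p^{b_1}f)$, where $E_p^{b_1}f=\sum_{K\in\mathcal D^n_p}\frac{\int_K f b_1}{\int_K b_1}\chi_K$; similarly for $\Delta_J^{b_2}$, $J\in\mathcal D^m$, in the second variable, and for $b_1',b_2'$. **Good cubes.** Fix $\delta>0$ and put $\gamma_n=\delta/(2n+2\delta)$. For $r\in\mathbb N$, a cube $I\in\mathcal D^n$ is *bad* if there is $\tilde I\in\mathcal D^n$ with $\ell(\tilde I)\ge 2^r\ell(I)$ and $d(I,\partial\tilde I)\le 2\,\ell(I)^{\gamma_n}\ell(\tilde I)^{1-\gamma_n}$, and *good* otherwise; similarly in $\mathbb R^m$. Let $\chi_{\rm good}(I)$ be $1$ if $I$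 is good and $0$ otherwise, and let $\mathrm{small}(I_1,I_2)$ be $I_1$ if $\ell(I_1)\le\ell(I_2)$ and $I_2$ otherwise. **Proposition 4.1.** For every $r$, the probability $\pi^n_{\rm good}=\mathbb P_{\omega^n}(I\dotplus\omega^n\text{ is good})$ does not depend on $I\in\mathcal D_0^n$, and similarly for $\pi^m_{\rm good}$; both are positive for all sufficiently large $r$. All the functions $b\,\Delta_{I_1}^{b_1}\Delta_{J_1}^{b_2}f$ and $\Delta_{I_2}^{b_1'}\Delta_{J_2}^{b_2'}g$ are in $L^2$. For every $r$ with $\pi^n_{\rm good}>0$ and $\pi^m_{\rm good}>0$, $$\langle M_{b'}TM_bf,g\rangle=\frac1{\pi^n_{\rm good}\,\pi^m_{\rm good}}\,\mathbb E_{\omega^n}\mathbb E_{\omega^m}\sum_{\substack{I_1,I_2\in\mathcal D^n\\ J_1,J_2\in\mathcal D^m}}\chi_{\rm good}(\mathrm{small}(I_1,I_2))\,\chi_{\rm good}(\mathrm{small}(J_1,J_2))\,\langle M_{b'}TM_b\Delta_{I_1}^{b_1}\Delta_{J_1}^{b_2}f,\ \Delta_{I_2}^{b_1'}\Delta_{J_2}^{b_2'}g\rangle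 .$$ The sum is taken first over the cubes of four fixed side lengths $2^{-p_1},2^{-p_2},2^{-q_1},2^{-q_2}$ of $I_1,I_2,J_1,J_2$, and then over $(p_1,p_2,q_1,q_2)\in\mathbb Z^4$. For all $\omega^n,\omega^m$ the inner sums have only finitely many nonzero terms and the outer sum converges absolutely; as a function of $(\omega^n,\omega^m)$ the sum is integrable. -/

import Mathlib

open MeasureTheory
open scoped ENNReal

noncomputable section

namespace BiParam

/-- `ℝⁿ` with its Euclidean norm and Lebesgue measure. -/
abbrev E (n : ℕ) : Type := EuclideanSpace ℝ (Fin n)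

/-! ### Cubes, random dyadic grids, good cubes -/

/-- The half-open cube with lower left corner `a` and side length `s`. -/
def cube {n : ℕ} (a : E n) (s : ℝ) : Set (E n) :=
  {x | ∀ j, a j ≤ x j ∧ x j < a j + s}

/-- The parameters `ω = (ω_i)_{i ∈ ℤ}`, `ω_i ∈ {0,1}ⁿ`, of a dyadic grid. -/
abbrev GridParam (n : ℕ) : Type := ℤ → Fin n → Fin 2

/-- The natural probability measure on `({0,1}ⁿ)^ℤ`: the `ω_i` are independent and
uniformly distributed in `{0,1}ⁿ`. -/
def gridMeasure (n : ℕ) : Measure (GridParam n) :=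
  Measure.infinitePi fun _ : ℤ => (PMF.uniformOfFintype (Fin n → Fin 2)).toMeasure

/-- Labels of dyadic cubes: `I = (p, k)` is the label of the standard dyadic cube
`2^{-p} ([0,1)ⁿ + k)`, and, for each `ω`, of the corresponding cube of the shifted grid. -/
abbrev CubeLabel (n : ℕ) : Type := ℤ × (Fin n → ℤ)

/-- The side length `ℓ(I) = 2^{-p}`. -/
def side {n : ℕ} (I : CubeLabel n) : ℝ := (2 : ℝ) ^ (-I.1)

/-- The standard dyadic cube `2^{-p} ([0,1)ⁿ + k)`. -/
def stdCube {n : ℕ} (I : CubeLabel n) : Set (E n) :=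
  cube (WithLp.toLp 2 fun j => side I * (I.2 j : ℝ)) (side I)

/-- The vector `∑_{i : 2^{-i} < 2^{-p}} 2^{-i} ω_i`. -/
def gridShift {n : ℕ} (ω : GridParam n) (p : ℤ) : E n :=
  WithLp.toLp 2 fun j => ∑' i : {i : ℤ // p < i}, (2 : ℝ) ^ (-(i : ℤ)) * ((ω i j).val : ℝ)

/-- The shifted cube `I ∔ ω = I + ∑_{i : 2^{-i} < ℓ(I)} 2^{-i} ω_i`. The grid `𝒟_ω` is the
family of all the sets `gridCube ω I`. -/
def gridCube {n : ℕ} (ω : GridParam n) (I : CubeLabel n) : Set (E n) :=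
  {x | x - gridShift ω I.1 ∈ stdCube I}

/-- The distance of two nonempty sets. -/
def setDist {n : ℕ} (A B : Set (E n)) : ℝ :=
  sInf {t | ∃ x ∈ A, ∃ y ∈ B, t = dist x y}

/-- `γ_n = δ / (2n + 2δ)`. -/
def gammaExp (n : ℕ) (δ : ℝ) : ℝ := δ / (2 * (n : ℝ) + 2 * δ)

/-- `I ∔ ω` is bad: some cube `L ∔ ω` of the same grid has `ℓ(L) ≥ 2^r ℓ(I)` and
`d(I ∔ ω, ∂(L ∔ ω)) ≤ 2 ℓ(I)^γ ℓ(L)^{1-γ}`. -/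
def IsBad {n : ℕ} (δ : ℝ) (r : ℕ) (ω : GridParam n) (I : CubeLabel n) : Prop :=
  ∃ L : CubeLabel n, (2 : ℝ) ^ r * side I ≤ side L ∧
    setDist (gridCube ω I) (frontier (gridCube ω L)) ≤
      2 * side I ^ gammaExp n δ * side L ^ (1 - gammaExp n δ)

/-- `I ∔ ω` is good, i.e. not bad. -/
def IsGood {n : ℕ} (δ : ℝ) (r : ℕ) (ω : GridParam n) (I : CubeLabel n) : Prop :=
  ¬ IsBad δ r ω I

/-- The probability that `I ∔ ω` is good. -/
def goodProb {n : ℕ} (δ : ℝ) (r : ℕ) (I : CubeLabel n) : ℝ :=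
  (gridMeasure n).real {ω | IsGood δ r ω I}

/-- `π_good`: the probability that `I ∔ ω` is good, for the unit cube `I = [0,1)ⁿ`. -/
def piGood (n : ℕ) (δ : ℝ) (r : ℕ) : ℝ := goodProb δ r ((0, 0) : CubeLabel n)

open Classical in
/-- `χ_good(I ∔ ω)`. -/
def chiGood {n : ℕ} (δ : ℝ) (r : ℕ) (ω : GridParam n) (I : CubeLabel n) : ℂ :=
  if IsGood δ r ω I then 1 else 0

/-- The smaller of two cubes; the first one if the side lengths are equal. -/
def small {n : ℕ} (I₁ I₂ : CubeLabel n) : CubeLabel n :=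
  if I₂.1 ≤ I₁.1 then I₁ else I₂

/-! ### Pseudo-accretive functions and adapted martingale differences -/

/-- The tensor product `b₁ ⊗ b₂`. -/
def tensor {n m : ℕ} (b₁ : E n → ℂ) (b₂ : E m → ℂ) : E n × E m → ℂ :=
  fun x => b₁ x.1 * b₂ x.2

/-- Pseudo-accretive functions on `ℝⁿ × ℝᵐ`: bounded, with averages over rectangles
`R = K × V` (`K`, `V` cubes) bounded away from `0`. -/
def IsPseudoAccretive {n m : ℕ} (b : E n × E m → ℂ) : Prop :=
  MemLp b ∞ volume ∧ ∃ C : ℝ, 0 < C ∧ ∀ (a : E n) (s : ℝ) (a' : E m) (s' : ℝ),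
    0 < s → 0 < s' →
      C < ‖∫ x in cube a s ×ˢ cube a' s', b x‖ / (volume (cube a s ×ˢ cube a' s')).toReal

/-- The adapted expectation `E_p^b h = ∑_{I ∈ 𝒟_p} (∫_I h b / ∫_I b) χ_I` of a function of one
variable. At each point exactly one term of the sum can be nonzero. -/
def expect {n : ℕ} (b : E n → ℂ) (ω : GridParam n) (p : ℤ) (h : E n → ℂ) : E n → ℂ :=
  fun x => ∑' k : Fin n → ℤ, (gridCube ω (p, k)).indicator
    (fun _ => (∫ y in gridCube ω (p, k), h y * b y) / ∫ y in gridCube ω (p, k), b y) x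

/-- `Δ_I^b h = χ_I (E_{p+1}^b h - E_p^b h)` for `I ∈ 𝒟_p`, for a function of one variable. -/
def delta {n : ℕ} (b : E n → ℂ) (ω : GridParam n) (I : CubeLabel n) (h : E n → ℂ) : E n → ℂ :=
  (gridCube ω I).indicator fun x => expect b ω (I.1 + 1) h x - expect b ω I.1 h x

/-- `Δ_I^{b₁}` acting in the first variable. -/
def delta₁ {n m : ℕ} (b₁ : E n → ℂ) (ω : GridParam n) (I : CubeLabel n)
    (f : E n × E m → ℂ) : E n × E m → ℂ :=
  fun x => delta b₁ ω I (fun y => f (y, x.2)) x.1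

/-- `Δ_J^{b₂}` acting in the second variable. -/
def delta₂ {n m : ℕ} (b₂ : E m → ℂ) (ω : GridParam m) (J : CubeLabel m)
    (f : E n × E m → ℂ) : E n × E m → ℂ :=
  fun x => delta b₂ ω J (fun y => f (x.1, y)) x.2

/-- `Δ_I^{b₁} Δ_J^{b₂} f`. -/
def doubleDelta {n m : ℕ} (b₁ : E n → ℂ) (b₂ : E m → ℂ) (ω : GridParam n) (ω' : GridParam m)
    (I : CubeLabel n) (J : CubeLabel m) (f : E n × E m → ℂ) : E n × E m → ℂ :=
  delta₁ b₁ ω I (delta₂ b₂ ω' J f)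

/-! ### The bilinear form and the sum over cubes -/

/-- `L²(ℝⁿ × ℝᵐ)`, complex valued. -/
abbrev L2 (n m : ℕ) : Type := Lp ℂ 2 (volume : Measure (E n × E m))

open Classical in
/-- The class in `L²` of a square integrable function (`0` for other functions). -/
def toL2 {n m : ℕ} (f : E n × E m → ℂ) : L2 n m :=
  if h : MemLp f 2 volume then h.toLp f else 0

/-- The bilinear form `⟨M_{b'} T M_b f, g⟩ = ∫ b' T(b f) g` (no complex conjugate). -/
def form {n m : ℕ} (T : L2 n m →L[ℂ] L2 n m) (b b' f g : E n × E m → ℂ) : ℂ :=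
  ∫ x, b' x * (T (toL2 fun y => b y * f y) : E n × E m → ℂ) x * g x

/-- Four scales `(p₁, p₂, q₁, q₂)`, for `I₁`, `I₂`, `J₁`, `J₂`. -/
abbrev Scales : Type := ℤ × ℤ × ℤ × ℤ

/-- Four positions, for `I₁`, `I₂`, `J₁`, `J₂`. -/
abbrev Positions (n m : ℕ) : Type :=
  (Fin n → ℤ) × (Fin n → ℤ) × (Fin m → ℤ) × (Fin m → ℤ)

/-- The summand
`χ_good(small(I₁,I₂)) χ_good(small(J₁,J₂)) ⟨M_{b'} T M_b Δ_{I₁} Δ_{J₁} f, Δ_{I₂} Δ_{J₂} g⟩`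
for `I₁ = (p₁,k₁)`, `I₂ = (p₂,k₂)`, `J₁ = (q₁,l₁)`, `J₂ = (q₂,l₂)`, where
`P = (p₁,p₂,q₁,q₂)` and `Q = (k₁,k₂,l₁,l₂)`, `b = b₁ ⊗ b₂`, `b' = b₁' ⊗ b₂'`. -/
def summand {n m : ℕ} (δ : ℝ) (r : ℕ) (T : L2 n m →L[ℂ] L2 n m)
    (b₁ b₁' : E n → ℂ) (b₂ b₂' : E m → ℂ) (f g : E n × E m → ℂ)
    (ω : GridParam n) (ω' : GridParam m) (P : Scales) (Q : Positions n m) : ℂ :=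
  let I₁ : CubeLabel n := (P.1, Q.1)
  let I₂ : CubeLabel n := (P.2.1, Q.2.1)
  let J₁ : CubeLabel m := (P.2.2.1, Q.2.2.1)
  let J₂ : CubeLabel m := (P.2.2.2, Q.2.2.2)
  chiGood δ r ω (small I₁ I₂) * chiGood δ r ω' (small J₁ J₂) *
    form T (tensor b₁ b₂) (tensor b₁' b₂')
      (doubleDelta b₁ b₂ ω ω' I₁ J₁ f) (doubleDelta b₁' b₂' ω ω' I₂ J₂ g)

/-- The sum of the summands over all cubes of the given four scales. -/
def scaleSum {n m : ℕ} (δ : ℝ) (r : ℕ) (T : L2 n m →L[ℂ] L2 n m)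
    (b₁ b₁' : E n → ℂ) (b₂ b₂' : E m → ℂ) (f g : E n × E m → ℂ)
    (ω : GridParam n) (ω' : GridParam m) (P : Scales) : ℂ :=
  ∑' Q : Positions n m, summand δ r T b₁ b₁' b₂ b₂' f g ω ω' P Q

/-- The sum over all `I₁, I₂ ∈ 𝒟ⁿ`, `J₁, J₂ ∈ 𝒟ᵐ`: first over the cubes of four given scales,
then over the scales. -/
def goodSum {n m : ℕ} (δ : ℝ) (r : ℕ) (T : L2 n m →L[ℂ] L2 n m)
    (b₁ b₁' : E n → ℂ) (b₂ b₂' : E m → ℂ) (f g : E n × E m → ℂ)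
    (ω : GridParam n) (ω' : GridParam m) : ℂ :=
  ∑' P : Scales, scaleSum δ r T b₁ b₁' b₂ b₂' f g ω ω' P

end BiParam

end

/-! On a fixed pair of grids, expanding `f` and `g` in adapted martingale differences writes the
bilinear form as a sum over all cubes. The point is that discarding the terms whose smaller cubes
are bad multiplies the average of this sum by the probabilities of goodness. The reason is
independence: goodness of a cube of scale `p` is a question about its position inside coarser cubes,
hence about the digits `ω_i` with `i ≤ p` (`isBad_iff`), whereas the cube and its martingale
difference depend on the digits with `i > p` only (`mdiff_congr`).

A single term, however, also involves the larger cube, whose digits influence the goodness of the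
smaller one. Goodness of a cube can be averaged out in two situations: when the cube is the larger
one of the pair, or when the other function has been summed over all its cubes, since that sum does
not depend on the grid. In one parameter, consider the sum with the first cube good, plus the sum
with the second cube good, minus `π` times the sum of all terms. After averaging, the total is `π +
π - π = π` times the bilinear form. At each pair of scales, the goodness of the larger cube factors
out and cancels the third term, leaving the smaller cube good. This is
`hasSum_integral_goodPairSum`, stated for abstract decompositions `IsGridDecomp`. It is used twice:
in the first variable with the second grid frozen (`IsTame₂.isGridDecomp_doubleTerm`), then in the
second variable (`IsTame₂.isGridDecomp_singleTerm`).

All interchanges of sums and integrals rest on bounds uniform in the grids. The differences at scale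
`p` are of size `2^{-p}` for `p ≥ 0`, by smoothness, and of size `2^{np}` on a ball of radius
comparable to `2^{-p}` for `p < 0`, by compact support; their `L²` norms are therefore summable
(`norm_mdiff_le`, `summable_eLpNorm_profile`). Measurability in the grids comes from continuity
(`IsTame₂.continuous_doubleTerm`).

The probability of goodness is the same for all cubes because relative positions modulo `2^s` are
uniformly distributed. It is positive for large `r` by a union bound with a geometric tail
(`exists_piGood_pos`). -/

noncomputable section

namespace BiParam

/-! ### Geometry of the shifted grids -/

/-- The integers larger than `p`, enumerated. -/
def tailEquiv (p : ℤ) : ℕ ≃ {i : ℤ // p < i} where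
  toFun k := ⟨p + 1 + k, by omega⟩
  invFun i := (i.1 - p - 1).toNat
  left_inv k := by simp only; omega
  right_inv i := by
    ext
    have := i.2
    simp only
    omega

lemma gridShift_apply {n : ℕ} (ω : GridParam n) (p : ℤ) (j : Fin n) :
    gridShift ω p j = ∑' k : ℕ, (2 : ℝ) ^ (-(p + 1 + k)) * ((ω (p + 1 + k) j).val : ℝ) := by
  simp only [gridShift]
  exact ((tailEquiv p).tsum_eq
    (fun i : {i : ℤ // p < i} => (2 : ℝ) ^ (-(i : ℤ)) * ((ω i j).val : ℝ))).symm

lemma two_zpow_tail (p : ℤ) (k : ℕ) :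
    (2 : ℝ) ^ (-(p + 1 + k)) = 2 ^ (-p) / 2 / 2 ^ k := by
  rw [neg_add, neg_add, zpow_add₀ two_ne_zero, zpow_add₀ two_ne_zero, zpow_neg, zpow_neg 2 (k : ℤ)]
  norm_num
  ring

lemma fin_two_val_le (a : Fin 2) : (a.val : ℝ) ≤ 1 := by
  have := a.2
  exact_mod_cast (by omega : a.val ≤ 1)

lemma gridShift_term_le (p : ℤ) (a : Fin 2) (k : ℕ) :
    (2 : ℝ) ^ (-(p + 1 + k)) * (a.val : ℝ) ≤ 2 ^ (-p) / 2 / 2 ^ k := by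
  rw [two_zpow_tail]
  exact mul_le_of_le_one_right (by positivity) (fin_two_val_le _)

lemma gridShift_term_nonneg (p : ℤ) (a : Fin 2) (k : ℕ) :
    0 ≤ (2 : ℝ) ^ (-(p + 1 + k)) * (a.val : ℝ) := by positivity

lemma summable_gridShift {n : ℕ} (ω : GridParam n) (p : ℤ) (j : Fin n) :
    Summable fun k : ℕ => (2 : ℝ) ^ (-(p + 1 + k)) * ((ω (p + 1 + k) j).val : ℝ) :=
  Summable.of_nonneg_of_le (fun k => gridShift_term_nonneg p _ k)
    (fun k => gridShift_term_le p _ k) (summable_geometric_two' _)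

lemma gridShift_nonneg {n : ℕ} (ω : GridParam n) (p : ℤ) (j : Fin n) : 0 ≤ gridShift ω p j := by
  rw [gridShift_apply]
  exact tsum_nonneg fun k => gridShift_term_nonneg p _ k

lemma gridShift_le {n : ℕ} (ω : GridParam n) (p : ℤ) (j : Fin n) :
    gridShift ω p j ≤ 2 ^ (-p) := by
  rw [gridShift_apply, ← tsum_geometric_two' ((2 : ℝ) ^ (-p))]
  exact (summable_gridShift ω p j).tsum_le_tsum (fun k => gridShift_term_le p _ k)
    (summable_geometric_two' _)

lemma gridShift_pred {n : ℕ} (ω : GridParam n) (p : ℤ) (j : Fin n) :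
    gridShift ω (p - 1) j = gridShift ω p j + 2 ^ (-p) * ((ω p j).val : ℝ) := by
  rw [gridShift_apply, gridShift_apply, (summable_gridShift ω (p - 1) j).tsum_eq_zero_add, add_comm]
  congr 1
  · congr 1
    ext k
    have : p - 1 + 1 + ((k + 1 : ℕ) : ℤ) = p + 1 + k := by push_cast; ring
    rw [this]
  · have : p - 1 + 1 + ((0 : ℕ) : ℤ) = p := by push_cast; ring
    rw [this]

lemma gridShift_congr {n : ℕ} {ω ω' : GridParam n} {p : ℤ} (h : ∀ i, p < i → ω i = ω' i) :
    gridShift ω p = gridShift ω' p := by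
  ext j
  rw [gridShift_apply, gridShift_apply]
  congr 1
  ext k
  rw [h _ (by omega)]

/-- Each digit ranges over a discrete space and the series is dominated by a geometric one,
uniformly in `ω`. Measurability of the martingale terms in the grid is derived from this. -/
lemma continuous_gridShift {n : ℕ} (p : ℤ) : Continuous fun ω : GridParam n => gridShift ω p := by
  refine (PiLp.continuous_toLp 2 _).comp (continuous_pi fun j => ?_)
  have h : (fun ω : GridParam n =>
      ∑' i : {i : ℤ // p < i}, (2 : ℝ) ^ (-(i : ℤ)) * ((ω i j).val : ℝ)) =
      fun ω => ∑' k : ℕ, (2 : ℝ) ^ (-(p + 1 + k)) * ((ω (p + 1 + k) j).val : ℝ) := by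
    ext ω
    exact ((tailEquiv p).tsum_eq
      (fun i : {i : ℤ // p < i} => (2 : ℝ) ^ (-(i : ℤ)) * ((ω i j).val : ℝ))).symm
  change Continuous (fun ω : GridParam n =>
      ∑' i : {i : ℤ // p < i}, (2 : ℝ) ^ (-(i : ℤ)) * ((ω i j).val : ℝ))
  rw [h]
  refine continuous_tsum (u := fun k : ℕ => (2 : ℝ) ^ (-p) / 2 / 2 ^ k) (fun k => ?_)
    (summable_geometric_two' _) (fun k ω => ?_)
  · refine continuous_const.mul ?_
    exact (continuous_of_discreteTopology (f := fun a : Fin 2 => (a.val : ℝ))).comp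
      ((continuous_apply j).comp (continuous_apply _))
  · rw [Real.norm_of_nonneg (gridShift_term_nonneg p _ k)]
    exact gridShift_term_le p _ k

/-- The position of the grid at scale `p - s` relative to the grid at scale `p`, in units
of `2 ^ (-p)`. -/
def position {n : ℕ} (ω : GridParam n) (p : ℤ) (s : ℕ) : Fin n → ℤ :=
  fun j => ∑ i ∈ Finset.range s, 2 ^ i * ((ω (p - i) j).val : ℤ)

/-- The coarser shift exceeds the finer one by an integer multiple of the finer side length. That
integer vector involves only the digits of index `p - s + 1, …, p`. -/
lemma gridShift_sub {n : ℕ} (ω : GridParam n) (p : ℤ) (s : ℕ) (j : Fin n) :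
    gridShift ω (p - s) j = gridShift ω p j + 2 ^ (-p) * (position ω p s j : ℝ) := by
  induction s with
  | zero => simp [position]
  | succ s ih =>
    have h1 : p - ((s + 1 : ℕ) : ℤ) = p - s - 1 := by push_cast; ring
    have h2 : (2 : ℝ) ^ (-(p - s)) = 2 ^ (-p) * 2 ^ s := by
      rw [neg_sub, sub_eq_neg_add, zpow_add₀ two_ne_zero, zpow_natCast]
    rw [h1, gridShift_pred, ih, h2]
    simp only [position, Finset.sum_range_succ]
    push_cast
    ring

lemma gridCube_eq_cube {n : ℕ} (ω : GridParam n) (I : CubeLabel n) :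
    gridCube ω I =
      cube (WithLp.toLp 2 fun j => gridShift ω I.1 j + side I * (I.2 j : ℝ)) (side I) := by
  ext x
  simp only [gridCube, stdCube, cube, Set.mem_ofPred_eq, PiLp.sub_apply]
  refine forall_congr' fun j => ?_
  constructor
  · rintro ⟨h1, h2⟩
    constructor <;> linarith
  · rintro ⟨h1, h2⟩
    constructor <;> linarith

lemma side_pos {n : ℕ} (I : CubeLabel n) : 0 < side I := by unfold side; positivity

/-- The position of the cube of scale `p` that contains `x`. -/
def idx {n : ℕ} (ω : GridParam n) (p : ℤ) (x : E n) : Fin n → ℤ :=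
  fun j => ⌊2 ^ p * (x j - gridShift ω p j)⌋

/-- The cubes of one scale become the fibres of `idx`, so that they partition space without further
argument. -/
lemma mem_gridCube_iff {n : ℕ} {ω : GridParam n} {p : ℤ} {k : Fin n → ℤ} {x : E n} :
    x ∈ gridCube ω (p, k) ↔ idx ω p x = k := by
  have h0 : (0 : ℝ) < 2 ^ p := by positivity
  simp only [gridCube, stdCube, cube, Set.mem_ofPred_eq, PiLp.sub_apply, side, idx, funext_iff,
    Int.floor_eq_iff, zpow_neg]
  refine forall_congr' fun j => ?_
  rw [inv_mul_le_iff₀ h0, ← mul_add_one, lt_inv_mul_iff₀ h0]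

lemma mem_gridCube_idx {n : ℕ} (ω : GridParam n) (p : ℤ) (x : E n) :
    x ∈ gridCube ω (p, idx ω p x) := mem_gridCube_iff.2 rfl

/-- Cubes are dilated translates of each other. -/
lemma setDist_homothety {n : ℕ} (c : E n) {s : ℝ} (hs : 0 < s) (A B : Set (E n)) :
    setDist ((fun x => c + s • x) '' A) (frontier ((fun x => c + s • x) '' B)) =
      s * setDist A (frontier B) := by
  have hh : IsHomeomorph fun x : E n => c + s • x :=
    (Homeomorph.isHomeomorph ((Homeomorph.smulOfNeZero s hs.ne').trans (Homeomorph.addLeft c)))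
  rw [← hh.image_frontier]
  unfold setDist
  rw [← smul_eq_mul, ← Real.sInf_smul_of_nonneg hs.le]
  congr 1
  ext t
  simp only [Set.mem_ofPred_eq, Set.exists_mem_image, Set.mem_smul_set, dist_add_left, dist_smul₀,
    Real.norm_of_nonneg hs.le, smul_eq_mul]
  constructor
  · rintro ⟨x, hx, y, hy, rfl⟩
    exact ⟨_, ⟨x, hx, y, hy, rfl⟩, rfl⟩
  · rintro ⟨_, ⟨x, hx, y, hy, rfl⟩, rfl⟩
    exact ⟨x, hx, y, hy, rfl⟩

lemma image_cube {n : ℕ} (c a : E n) {s l : ℝ} (hs : 0 < s) :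
    (fun x => c + s • x) '' cube a l = cube (c + s • a) (s * l) := by
  ext x
  simp only [Set.mem_image, cube, Set.mem_ofPred_eq, PiLp.add_apply, PiLp.smul_apply, smul_eq_mul]
  constructor
  · rintro ⟨y, hy, rfl⟩ j
    simp only [PiLp.add_apply, PiLp.smul_apply, smul_eq_mul]
    have := hy j
    constructor <;> nlinarith
  · intro h
    refine ⟨s⁻¹ • (x - c), fun j => ?_, ?_⟩
    · simp only [PiLp.smul_apply, PiLp.sub_apply, smul_eq_mul]
      have := h j
      rw [le_inv_mul_iff₀ hs, inv_mul_lt_iff₀ hs]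
      constructor <;> linarith
    · rw [smul_inv_smul₀ hs.ne']; abel

/-- The condition of badness at relative scale `s`, in terms of the relative position `a`
of the two grids. -/
def badAt (n : ℕ) (δ : ℝ) (s : ℕ) : Set (Fin n → ℤ) :=
  {a | ∃ k : Fin n → ℤ, setDist (cube (0 : E n) 1)
    (frontier (cube (WithLp.toLp 2 fun j => (a j : ℝ) + 2 ^ s * (k j : ℝ)) (2 ^ s))) ≤
      2 * (2 ^ s) ^ (1 - gammaExp n δ)}

/-- A shift by multiples of `2 ^ s` only renumbers the large cubes, and the quantified position `k`
absorbs it. -/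
lemma badAt_periodic {n : ℕ} {δ : ℝ} {s : ℕ} {a a' : Fin n → ℤ}
    (h : ∀ j, a j ≡ a' j [ZMOD 2 ^ s]) (ha : a ∈ badAt n δ s) : a' ∈ badAt n δ s := by
  obtain ⟨k, hk⟩ := ha
  choose c hc using fun j => (Int.modEq_iff_dvd.1 (h j))
  refine ⟨fun j => k j - c j, ?_⟩
  convert hk using 6 with j
  have := congrArg (fun z : ℤ => (z : ℝ)) (hc j)
  push_cast at this ⊢
  linarith

lemma side_mul_le_iff {n : ℕ} {r : ℕ} {I L : CubeLabel n} :
    (2 : ℝ) ^ r * side I ≤ side L ↔ L.1 + r ≤ I.1 := by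
  unfold side
  rw [← zpow_natCast, ← zpow_add₀ two_ne_zero, zpow_le_zpow_iff_right₀ one_lt_two]
  omega

/-- The homothety carrying the unit cube to the given cube removes the digits of index above `p`.
Both sides of the inequality scale by `2 ^ (-p)`, because the exponents `γ` and `1 - γ` add up to
`1`. Only `position ω p s` remains, so badness is a function of the digits of index at most `p`. -/
lemma isBad_iff {n : ℕ} {δ : ℝ} {r : ℕ} {ω : GridParam n} {p : ℤ} {k : Fin n → ℤ} :
    IsBad δ r ω (p, k) ↔ ∃ s : ℕ, r ≤ s ∧ (fun j => position ω p s j - k j) ∈ badAt n δ s := by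
  have key : ∀ (s : ℕ) (l : Fin n → ℤ),
      setDist (gridCube ω (p, k)) (frontier (gridCube ω (p - s, l))) ≤
        2 * side ((p, k) : CubeLabel n) ^ gammaExp n δ *
          side ((p - s, l) : CubeLabel n) ^ (1 - gammaExp n δ) ↔
      setDist (cube (0 : E n) 1)
        (frontier (cube (WithLp.toLp 2 fun j => ((position ω p s j - k j : ℤ) : ℝ) +
          2 ^ s * (l j : ℝ)) (2 ^ s))) ≤ 2 * (2 ^ s) ^ (1 - gammaExp n δ) := by
    intro s l
    set c : E n := WithLp.toLp 2 fun j => gridShift ω p j + 2 ^ (-p) * (k j : ℝ) with hc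
    have hu : (0 : ℝ) < 2 ^ (-p) := by positivity
    have hps : (2 : ℝ) ^ (-(p - s)) = 2 ^ (-p) * 2 ^ s := by
      rw [neg_sub, sub_eq_neg_add, zpow_add₀ two_ne_zero, zpow_natCast]
    have h1 : gridCube ω (p, k) = (fun x => c + (2 : ℝ) ^ (-p) • x) '' cube 0 1 := by
      rw [image_cube _ _ hu, gridCube_eq_cube]
      simp [side, hc]
    have h2 : gridCube ω (p - s, l) = (fun x => c + (2 : ℝ) ^ (-p) • x) ''
        cube (WithLp.toLp 2 fun j => ((position ω p s j - k j : ℤ) : ℝ) +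
          2 ^ s * (l j : ℝ)) (2 ^ s) := by
      rw [image_cube _ _ hu, gridCube_eq_cube]
      simp only [side, hps]
      congr 1
      ext j
      simp only [hc, gridShift_sub, PiLp.add_apply, PiLp.smul_apply, smul_eq_mul]
      push_cast
      ring
    rw [h1, h2, setDist_homothety _ hu]
    simp only [side, hps]
    rw [Real.mul_rpow hu.le (by positivity)]
    have h3 : 2 * ((2 : ℝ) ^ (-p)) ^ gammaExp n δ *
        (((2 : ℝ) ^ (-p)) ^ (1 - gammaExp n δ) * (2 ^ s) ^ (1 - gammaExp n δ)) =
        2 ^ (-p) * (2 * (2 ^ s) ^ (1 - gammaExp n δ)) := by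
      have h4 : ((2 : ℝ) ^ (-p)) ^ gammaExp n δ * ((2 : ℝ) ^ (-p)) ^ (1 - gammaExp n δ) =
          2 ^ (-p) := by
        rw [← Real.rpow_add hu]; simp
      calc _ = 2 * (((2 : ℝ) ^ (-p)) ^ gammaExp n δ * ((2 : ℝ) ^ (-p)) ^ (1 - gammaExp n δ)) *
          (2 ^ s) ^ (1 - gammaExp n δ) := by ring
        _ = _ := by rw [h4]; ring
    rw [h3, mul_le_mul_iff_right₀ hu]
  unfold IsBad
  constructor
  · rintro ⟨⟨q, l⟩, hL, h⟩
    rw [side_mul_le_iff] at hL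
    simp only at hL
    obtain ⟨s, rfl⟩ : ∃ s : ℕ, q = p - s := ⟨(p - q).toNat, by omega⟩
    exact ⟨s, by omega, l, (key s l).1 h⟩
  · rintro ⟨s, hs, l, h⟩
    refine ⟨(p - s, l), ?_, (key s l).2 h⟩
    rw [side_mul_le_iff]
    simp only
    omega

/-! ### Equidistribution of the relative positions of the grids -/

instance (n : ℕ) : IsProbabilityMeasure (gridMeasure n) := by
  unfold gridMeasure; infer_instance

/-- Binary expansion modulo `2 ^ s`, peeling off the lowest bit. With `bits_unique`, blocks of `s`
bits correspond bijectively to residues. -/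
lemma exists_bits (s : ℕ) (a : ℤ) :
    ∃ c : ℕ → Fin 2, ∑ i ∈ Finset.range s, 2 ^ i * ((c i).val : ℤ) ≡ a [ZMOD 2 ^ s] := by
  induction s generalizing a with
  | zero => exact ⟨fun _ => 0, by simp [Int.modEq_one]⟩
  | succ s ih =>
    obtain ⟨c, hc⟩ := ih (a / 2)
    have h2 : (a % 2).toNat < 2 := by omega
    refine ⟨fun i => Nat.casesOn i ⟨_, h2⟩ c, ?_⟩
    rw [Finset.sum_range_succ']
    simp only [pow_succ' (2 : ℤ), mul_assoc, ← Finset.mul_sum, pow_zero, one_mul]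
    have h3 : (((a % 2).toNat : ℕ) : ℤ) = a % 2 := Int.toNat_of_nonneg (by omega)
    change _ + (((a % 2).toNat : ℕ) : ℤ) ≡ a [ZMOD _]
    rw [h3]
    calc _ ≡ 2 * (a / 2) + a % 2 [ZMOD 2 * 2 ^ s] := (hc.mul_left').add_right _
      _ = a := by omega

lemma bits_unique {s : ℕ} {c d : ℕ → Fin 2}
    (h : ∑ i ∈ Finset.range s, 2 ^ i * ((c i).val : ℤ) ≡
      ∑ i ∈ Finset.range s, 2 ^ i * ((d i).val : ℤ) [ZMOD 2 ^ s]) :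
    ∀ i < s, c i = d i := by
  induction s generalizing c d with
  | zero => simp
  | succ s ih =>
    rw [Finset.sum_range_succ', Finset.sum_range_succ'] at h
    simp only [pow_succ' (2 : ℤ), mul_assoc, ← Finset.mul_sum, pow_zero, one_mul] at h
    have h0 : c 0 = d 0 := by
      have h1 := h.of_mul_right (2 ^ s)
      unfold Int.ModEq at h1
      ext
      omega
    rw [h0] at h
    have h2 := (Int.ModEq.add_right_cancel' _ h)
    have h3 := Int.ModEq.mul_left_cancel' two_ne_zero h2
    intro i hi
    cases i with
    | zero => exact h0
    | succ i => exact ih h3 i (by omega)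

lemma measurable_position {n : ℕ} (p : ℤ) (s : ℕ) :
    Measurable fun ω : GridParam n => position ω p s := by
  refine measurable_pi_lambda _ fun j => ?_
  refine Finset.measurable_sum _ fun i _ => ?_
  refine Measurable.const_mul ?_ _
  exact (measurable_of_countable (fun a : Fin 2 => ((a.val : ℕ) : ℤ))).comp
    ((measurable_pi_apply j).comp (measurable_pi_apply (p - i)))

/-- By existence and uniqueness of binary expansions, the congruences prescribe exactly `s` of the
independent digits `ω_i`, each of which takes a given value with probability `2 ^ (-n)`. -/
lemma gridMeasure_position_modEq {n : ℕ} (p : ℤ) (s : ℕ) (a : Fin n → ℤ) :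
    (gridMeasure n).real {ω | ∀ j, position ω p s j ≡ a j [ZMOD 2 ^ s]} =
      (((2 : ℝ) ^ s) ^ n)⁻¹ := by
  choose c hc using fun j => exists_bits s (a j)
  have h1 : {ω : GridParam n | ∀ j, position ω p s j ≡ a j [ZMOD 2 ^ s]} =
      (((Finset.range s).image fun i : ℕ => p - (i : ℤ) : Finset ℤ) : Set ℤ).pi
        (fun i => {fun j => c j (p - i).toNat}) := by
    ext ω
    simp only [Set.mem_ofPred_eq, Set.mem_pi, Finset.coe_image, Set.forall_mem_image,
      Finset.coe_range, Set.mem_Iio, Set.mem_singleton_iff, sub_sub_cancel, Int.toNat_natCast]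
    constructor
    · intro h i hi
      ext j
      rw [bits_unique (c := fun i => ω (p - i) j) ((h j).trans (hc j).symm) i hi]
    · intro h j
      refine Int.ModEq.trans ?_ (hc j)
      unfold position
      rw [Finset.sum_congr rfl fun i hi => by rw [h (Finset.mem_range.1 hi)]]
  rw [h1, measureReal_def, gridMeasure,
    Measure.infinitePi_pi _ fun _ _ => measurableSet_singleton _]
  simp only [PMF.toMeasure_apply_singleton _ _ (measurableSet_singleton _),
    PMF.uniformOfFintype_apply, Fintype.card_pi, Fintype.card_fin, Finset.prod_const,
    Finset.card_univ]
  rw [Finset.card_image_of_injective _ (fun a b h => by simpa using h), Finset.card_range]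
  simp only [ENNReal.toReal_pow, ENNReal.toReal_inv, ENNReal.toReal_natCast]
  push_cast
  rw [inv_pow, ← pow_mul, ← pow_mul, mul_comm]

open Classical in
/-- The law of the relative position modulo `2 ^ s` is the uniform distribution. -/
lemma gridMeasure_position_mem {n : ℕ} (p : ℤ) (s : ℕ) (k : Fin n → ℤ) {C : Set (Fin n → ℤ)}
    (hC : ∀ a a' : Fin n → ℤ, (∀ j, a j ≡ a' j [ZMOD 2 ^ s]) → a ∈ C → a' ∈ C) :
    (gridMeasure n).real {ω | (fun j => position ω p s j - k j) ∈ C} =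
      (Finset.univ.filter fun a : Fin n → Fin (2 ^ s) => (fun j => ((a j : ℕ) : ℤ)) ∈ C).card *
        (((2 : ℝ) ^ s) ^ n)⁻¹ := by
  have hpos : (0 : ℤ) < 2 ^ s := by positivity
  -- The event is split according to the representative `a` of `position - k` in `[0, 2 ^ s)`; each
  -- piece has the same probability, whatever `p` and `k` are.
  have h1 : {ω : GridParam n | (fun j => position ω p s j - k j) ∈ C} =
      ⋃ a ∈ Finset.univ.filter fun a : Fin n → Fin (2 ^ s) => (fun j => ((a j : ℕ) : ℤ)) ∈ C,
        {ω | ∀ j, position ω p s j ≡ ((a j : ℕ) : ℤ) + k j [ZMOD 2 ^ s]} := by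
    ext ω
    simp only [Set.mem_ofPred_eq, Finset.mem_filter, Finset.mem_univ, true_and, Set.mem_iUnion,
      exists_prop]
    constructor
    · intro h
      have hlt : ∀ j, ((position ω p s j - k j) % 2 ^ s).toNat < 2 ^ s := fun j => by
        have h1 := Int.emod_lt_of_pos (position ω p s j - k j) hpos
        have h2 := Int.emod_nonneg (position ω p s j - k j) hpos.ne'
        zify
        rwa [Int.toNat_of_nonneg h2]
      have hval : ∀ j, ((((position ω p s j - k j) % 2 ^ s).toNat : ℕ) : ℤ) =
          (position ω p s j - k j) % 2 ^ s := fun j =>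
        Int.toNat_of_nonneg (Int.emod_nonneg _ hpos.ne')
      refine ⟨fun j => ⟨_, hlt j⟩, hC _ _ (fun j => ?_) h, fun j => ?_⟩
      · simp only [hval]
        exact (Int.mod_modEq _ _).symm
      · simp only [hval]
        have := (Int.mod_modEq (position ω p s j - k j) (2 ^ s)).add_right (k j)
        rw [sub_add_cancel] at this
        exact this.symm
    · rintro ⟨a, ha, h⟩
      refine hC _ _ (fun j => ?_) ha
      have := (h j).sub_right (k j)
      rw [add_sub_cancel_right] at this
      exact this.symm
  rw [h1, measureReal_biUnion_finset]
  · rw [Finset.sum_congr rfl fun a _ =>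
      gridMeasure_position_modEq p s (fun j => ((a j : ℕ) : ℤ) + k j)]
    simp
  · intro a _ a' _ haa'
    refine Set.disjoint_left.2 fun ω h h' => haa' ?_
    ext j
    have h2 := ((h j).symm.trans (h' j)).add_right_cancel' (k j)
    have h3 := (a j).2
    have h4 := (a' j).2
    unfold Int.ModEq at h2
    rw [Int.emod_eq_of_lt (by positivity) (by exact_mod_cast h3),
      Int.emod_eq_of_lt (by positivity) (by exact_mod_cast h4)] at h2
    exact_mod_cast h2
  · intro a _
    have : {ω : GridParam n | ∀ j, position ω p s j ≡ ((a j : ℕ) : ℤ) + k j [ZMOD 2 ^ s]} =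
        (fun ω => position ω p s) ⁻¹' {b | ∀ j, b j ≡ ((a j : ℕ) : ℤ) + k j [ZMOD 2 ^ s]} := rfl
    rw [this]
    exact measurable_position p s (Set.to_countable _).measurableSet

/-- The additional digits carry weights divisible by `2 ^ s`. Thus the conditions at all relative
scales up to `N` can be read off from the one position at `N`. -/
lemma position_modEq {n : ℕ} (ω : GridParam n) (p : ℤ) {s N : ℕ} (h : s ≤ N) (j : Fin n) :
    position ω p N j ≡ position ω p s j [ZMOD 2 ^ s] := by
  induction N, h using Nat.le_induction with
  | base => rfl
  | succ N hN ih =>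
    unfold position at ih ⊢
    rw [Finset.sum_range_succ]
    refine (Int.ModEq.add_right _ ih).trans ?_
    refine Int.modEq_iff_dvd.2 ?_
    rw [sub_add_cancel_left, dvd_neg]
    exact (pow_dvd_pow 2 hN).mul_right _

/-! ### The probability of being good -/

/-- Each set of the intersection is a condition on the single vector `position ω p N`, whose law
modulo `2 ^ N` is known. -/
lemma setOf_isGood {n : ℕ} (δ : ℝ) (r : ℕ) (p : ℤ) (k : Fin n → ℤ) :
    {ω | IsGood δ r ω (p, k)} =
      ⋂ N : ℕ, {ω | (fun j => position ω p N j - k j) ∈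
        {a | ∀ s, r ≤ s → s ≤ N → a ∉ badAt n δ s}} := by
  ext ω
  simp only [IsGood, isBad_iff, Set.mem_ofPred_eq, Set.mem_iInter, not_exists, not_and]
  constructor
  · intro h N s hrs hsN hmem
    exact h s hrs (badAt_periodic (fun j => (position_modEq ω p hsN j).sub_right _) hmem)
  · intro h s hrs hmem
    exact h s s hrs le_rfl hmem

lemma measurableSet_position {n : ℕ} (p : ℤ) (N : ℕ) (k : Fin n → ℤ) (C : Set (Fin n → ℤ)) :
    MeasurableSet {ω : GridParam n | (fun j => position ω p N j - k j) ∈ C} := by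
  have : {ω : GridParam n | (fun j => position ω p N j - k j) ∈ C} =
      (fun ω => position ω p N) ⁻¹' {b | (fun j => b j - k j) ∈ C} := rfl
  rw [this]
  exact measurable_position p N (Set.to_countable _).measurableSet

lemma measurableSet_isGood {n : ℕ} (δ : ℝ) (r : ℕ) (I : CubeLabel n) :
    MeasurableSet {ω | IsGood δ r ω I} := by
  obtain ⟨p, k⟩ := I
  rw [setOf_isGood]
  exact MeasurableSet.iInter fun N => measurableSet_position p N k _

-- The truncations to `s ≤ N` decrease to goodness. Each has a probability given by a count of
-- residues modulo `2 ^ N` in which the cube does not appear; hence the limits agree.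
open Filter Topology in
lemma goodProb_eq {n : ℕ} (δ : ℝ) (r : ℕ) (I : CubeLabel n) :
    goodProb δ r I = piGood n δ r := by
  have key : ∀ I : CubeLabel n, Tendsto (fun N : ℕ => (gridMeasure n).real
      {ω | (fun j => position ω I.1 N j - I.2 j) ∈
        {a | ∀ s, r ≤ s → s ≤ N → a ∉ badAt n δ s}}) atTop (𝓝 (goodProb δ r I)) := by
    rintro ⟨p, k⟩
    rw [goodProb, setOf_isGood]
    refine (ENNReal.tendsto_toReal (measure_ne_top _ _)).comp
      (tendsto_measure_iInter_atTop
        (fun N => (measurableSet_position p N k _).nullMeasurableSet) ?_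
        ⟨0, measure_ne_top _ _⟩)
    intro N M hNM ω hω s hrs hsN hmem
    exact hω s hrs (hsN.trans hNM) (badAt_periodic (fun j =>
      (((position_modEq ω p (hsN.trans hNM) j).trans (position_modEq ω p hsN j).symm)).symm.sub_right
        _) hmem)
  refine tendsto_nhds_unique (key I) ?_
  refine (key (0, 0)).congr fun N => ?_
  have hper : ∀ a a' : Fin n → ℤ, (∀ j, a j ≡ a' j [ZMOD 2 ^ N]) →
      a ∈ {a | ∀ s, r ≤ s → s ≤ N → a ∉ badAt n δ s} →
      a' ∈ {a | ∀ s, r ≤ s → s ≤ N → a ∉ badAt n δ s} := by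
    intro a a' h ha s hrs hsN hmem
    exact ha s hrs hsN (badAt_periodic
      (fun j => ((h j).of_dvd (pow_dvd_pow 2 hsN)).symm) hmem)
  rw [gridMeasure_position_mem _ _ _ hper, gridMeasure_position_mem _ _ _ hper]

/-! ### Good cubes exist -/

lemma frontier_cube_subset {n : ℕ} (a : E n) (s : ℝ) :
    frontier (cube a s) ⊆ {y | ∃ j, y j = a j ∨ y j = a j + s} := by
  have hc : ∀ j, Continuous fun x : E n => x j := fun j => by fun_prop
  intro y hy
  by_contra hcon
  simp only [Set.mem_ofPred_eq, not_exists, not_or] at hcon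
  refine hy.2 ?_
  have h1 : IsClosed {x : E n | ∀ j, a j ≤ x j ∧ x j ≤ a j + s} := by
    simp only [Set.ofPred_forall, Set.ofPred_and]
    exact isClosed_iInter fun j => (isClosed_le continuous_const (hc j)).inter
      (isClosed_le (hc j) continuous_const)
  have h2 : y ∈ {x : E n | ∀ j, a j ≤ x j ∧ x j ≤ a j + s} :=
    closure_minimal (fun x hx j => ⟨(hx j).1, (hx j).2.le⟩) h1 hy.1
  have h3 : IsOpen {x : E n | ∀ j, a j < x j ∧ x j < a j + s} := by
    simp only [Set.ofPred_forall, Set.ofPred_and]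
    exact isOpen_iInter_of_finite fun j => (isOpen_lt continuous_const (hc j)).inter
      (isOpen_lt (hc j) continuous_const)
  have h4 : {x : E n | ∀ j, a j < x j ∧ x j < a j + s} ⊆ cube a s :=
    fun x hx j => ⟨(hx j).1.le, (hx j).2⟩
  refine interior_maximal h4 h3 fun j => ?_
  exact ⟨lt_of_le_of_ne (h2 j).1 (Ne.symm (hcon j).1), lt_of_le_of_ne (h2 j).2 (hcon j).2⟩

lemma cube_nonempty {n : ℕ} (a : E n) {s : ℝ} (hs : 0 < s) : (cube a s).Nonempty :=
  ⟨a, fun j => ⟨le_rfl, by linarith⟩⟩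

/-- Since `sInf ∅ = 0`, an empty boundary would count as being at distance zero. This happens for `n
= 0`, where the cube is the whole space. -/
lemma frontier_cube_nonempty {n : ℕ} (hn : 0 < n) (a : E n) {s : ℝ} (hs : 0 < s) :
    (frontier (cube a s)).Nonempty := by
  rw [Set.nonempty_iff_ne_empty, Ne, frontier_eq_empty_iff, not_or]
  refine ⟨(cube_nonempty a hs).ne_empty, fun h => ?_⟩
  have h1 : (WithLp.toLp 2 fun j => a j - 1 : E n) ∈ cube a s := h ▸ Set.mem_univ _
  have := (h1 ⟨0, hn⟩).1
  simp only at this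
  linarith

/-- A boundary point has a coordinate on a face, and the faces in direction `j` lie at `a j + 2 ^ s
* z` with `z` an integer. If the unit cube is close to one of them, then `a j` is near `0` (case `z
≥ 0`) or near `2 ^ s` (case `z < 0`); `Fin.rev` measures the latter distance. -/
lemma exists_near_of_mem_badAt {n : ℕ} (hn : 0 < n) {δ : ℝ} {s : ℕ} {a : Fin n → Fin (2 ^ s)}
    (h : (fun j => ((a j : ℕ) : ℤ)) ∈ badAt n δ s) :
    ∃ j, ((a j : ℕ) : ℝ) < 2 * (2 ^ s) ^ (1 - gammaExp n δ) + 2 ∨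
      (((a j).rev : ℕ) : ℝ) < 2 * (2 ^ s) ^ (1 - gammaExp n δ) + 2 := by
  set D : ℝ := 2 * (2 ^ s) ^ (1 - gammaExp n δ) with hD
  obtain ⟨k, hk⟩ := h
  set b : E n := WithLp.toLp 2 fun j => (((a j : ℕ) : ℤ) : ℝ) + 2 ^ s * (k j : ℝ) with hb
  have hs : (0 : ℝ) < 2 ^ s := by positivity
  obtain ⟨y₀, hy₀⟩ := frontier_cube_nonempty hn b hs
  obtain ⟨x₀, hx₀⟩ := cube_nonempty (0 : E n) one_pos
  have hne : {t | ∃ x ∈ cube (0 : E n) 1, ∃ y ∈ frontier (cube b (2 ^ s)), t = dist x y}.Nonempty :=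
    ⟨_, x₀, hx₀, y₀, hy₀, rfl⟩
  -- The infimum need not be attained, so a distance below `D + 1` is used; the side of the unit
  -- cube accounts for the other `1` in `D + 2`.
  obtain ⟨t, ⟨x, hx, y, hy, rfl⟩, ht⟩ := exists_lt_of_csInf_lt hne
    (lt_of_le_of_lt hk (lt_add_one D))
  obtain ⟨j, hj⟩ := frontier_cube_subset b _ hy
  have hxy : |x j - y j| < D + 1 := by
    refine lt_of_le_of_lt ?_ ht
    rw [dist_eq_norm]
    exact PiLp.norm_apply_le (x - y) j
  rw [abs_lt] at hxy
  have hx' := hx j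
  simp only [PiLp.zero_apply, zero_add] at hx'
  obtain ⟨z, hz⟩ : ∃ z : ℤ, y j = ((a j : ℕ) : ℝ) + 2 ^ s * (z : ℝ) := by
    rcases hj with hj | hj
    · exact ⟨k j, by rw [hj]; simp [hb]⟩
    · exact ⟨k j + 1, by rw [hj]; simp only [hb]; push_cast; ring⟩
  refine ⟨j, ?_⟩
  rcases le_or_gt 0 z with h0 | h0
  · left
    have : (0 : ℝ) ≤ 2 ^ s * (z : ℝ) := mul_nonneg hs.le (by exact_mod_cast h0)
    linarith
  · right
    have h1 : (z : ℝ) ≤ -1 := by exact_mod_cast (by omega : z ≤ -1)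
    have h2 : (2 : ℝ) ^ s * (z : ℝ) ≤ 2 ^ s * (-1) := mul_le_mul_of_nonneg_left h1 hs.le
    have h3 : (((a j).rev : ℕ) : ℝ) + 1 + ((a j : ℕ) : ℝ) = 2 ^ s := by
      have h4 : ((a j).rev : ℕ) + 1 + (a j : ℕ) = 2 ^ s := by
        rw [Fin.val_rev]; have := (a j).2; omega
      exact_mod_cast h4
    linarith

lemma card_filter_fin_lt_le {N : ℕ} {x : ℝ} (hx : 0 ≤ x) :
    ((Finset.univ.filter fun t : Fin N => ((t : ℕ) : ℝ) < x).card : ℝ) ≤ x + 1 := by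
  have h1 : (Finset.univ.filter fun t : Fin N => ((t : ℕ) : ℝ) < x).card ≤ ⌈x⌉₊ := by
    rw [← Finset.card_range ⌈x⌉₊]
    refine Finset.card_le_card_of_injOn (fun t => (t : ℕ)) (fun t ht => ?_)
      (fun a _ b _ h => Fin.ext h)
    simp only [Finset.coe_filter, Finset.mem_univ, true_and, Set.mem_ofPred_eq] at ht
    simpa using Nat.lt_ceil.2 ht
  have h2 := (Nat.ceil_lt_add_one hx).le
  exact le_trans (by exact_mod_cast h1) h2

lemma gammaExp_pos {n : ℕ} {δ : ℝ} (hδ : 0 < δ) : 0 < gammaExp n δ := by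
  unfold gammaExp; positivity

lemma gammaExp_le_one {n : ℕ} {δ : ℝ} (hδ : 0 < δ) : gammaExp n δ ≤ 1 := by
  unfold gammaExp
  rw [div_le_one (by positivity)]
  have : (0 : ℝ) ≤ n := Nat.cast_nonneg n
  linarith

-- With `M = 2 ^ (s (1 - γ)) ≥ 1`, a coordinate has at most `2 (2 M + 3) ≤ 10 M` dangerous residues
-- among `2 ^ s`. The union over the `n` coordinates gives probability at most `10 n M / 2 ^ s`.
open Classical in
lemma gridMeasure_badAt_le {n : ℕ} (hn : 0 < n) {δ : ℝ} (hδ : 0 < δ) (s : ℕ) :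
    (gridMeasure n).real {ω | (fun j => position ω 0 s j - (0 : Fin n → ℤ) j) ∈ badAt n δ s} ≤
      10 * n * ((2 : ℝ) ^ (-gammaExp n δ)) ^ s := by
  rw [gridMeasure_position_mem _ _ _ fun a a' h ha => badAt_periodic h ha]
  set M : ℝ := (2 ^ s) ^ (1 - gammaExp n δ) with hM
  have hM1 : 1 ≤ M := Real.one_le_rpow (one_le_pow₀ one_le_two)
    (sub_nonneg.2 (gammaExp_le_one hδ))
  set S : Finset (Fin (2 ^ s)) := (Finset.univ.filter fun t => ((t : ℕ) : ℝ) < 2 * M + 2) ∪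
    (Finset.univ.filter fun t => ((t.rev : ℕ) : ℝ) < 2 * M + 2) with hS
  have hcardS : (S.card : ℝ) ≤ 10 * M := by
    have h1 := card_filter_fin_lt_le (N := 2 ^ s) (x := 2 * M + 2) (by positivity)
    have h2 : (Finset.univ.filter fun t : Fin (2 ^ s) => ((t.rev : ℕ) : ℝ) < 2 * M + 2).card =
        (Finset.univ.filter fun t : Fin (2 ^ s) => ((t : ℕ) : ℝ) < 2 * M + 2).card := by
      refine Finset.card_bij (fun t _ => t.rev) (by simp) (fun a _ b _ h => Fin.rev_injective h)
        (fun b hb => ⟨b.rev, ?_, Fin.rev_rev b⟩)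
      simpa only [Finset.mem_filter, Finset.mem_univ, true_and, Fin.rev_rev] using hb
    have h3 : (S.card : ℝ) ≤
        ((Finset.univ.filter fun t : Fin (2 ^ s) => ((t : ℕ) : ℝ) < 2 * M + 2).card : ℝ) +
        ((Finset.univ.filter fun t : Fin (2 ^ s) => ((t.rev : ℕ) : ℝ) < 2 * M + 2).card : ℝ) := by
      exact_mod_cast Finset.card_union_le _ _
    rw [h2] at h3
    linarith
  have hsub : (Finset.univ.filter fun a : Fin n → Fin (2 ^ s) =>
      (fun j => ((a j : ℕ) : ℤ)) ∈ badAt n δ s) ⊆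
      Finset.univ.biUnion fun j : Fin n =>
        Fintype.piFinset fun i => if i = j then S else Finset.univ := by
    intro a ha
    simp only [Finset.mem_filter, Finset.mem_univ, true_and] at ha
    obtain ⟨j, hj⟩ := exists_near_of_mem_badAt hn ha
    simp only [Finset.mem_biUnion, Finset.mem_univ, true_and, Fintype.mem_piFinset]
    refine ⟨j, fun i => ?_⟩
    split_ifs with h
    · subst h
      simpa [hS] using hj
    · simp
  have hcard : ((Finset.univ.filter fun a : Fin n → Fin (2 ^ s) =>
      (fun j => ((a j : ℕ) : ℤ)) ∈ badAt n δ s).card : ℝ) ≤ n * (10 * M * (2 ^ s) ^ (n - 1)) := by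
    have h1 := (Finset.card_le_card hsub).trans Finset.card_biUnion_le
    have h2 : ∀ j : Fin n, (Fintype.piFinset fun i => if i = j then S else Finset.univ).card =
        S.card * (2 ^ s) ^ (n - 1) := by
      intro j
      rw [Fintype.card_piFinset, ← Finset.mul_prod_erase _ _ (Finset.mem_univ j)]
      rw [Finset.prod_congr rfl fun i hi => by rw [if_neg (Finset.ne_of_mem_erase hi)]]
      simp
    simp only [h2, Finset.sum_const, Finset.card_univ, Fintype.card_fin, smul_eq_mul] at h1
    calc _ ≤ ((n * (S.card * (2 ^ s) ^ (n - 1)) : ℕ) : ℝ) := by exact_mod_cast h1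
      _ = n * (S.card * (2 ^ s) ^ (n - 1)) := by push_cast; ring
      _ ≤ _ := by gcongr
  have h2s : (0 : ℝ) < 2 ^ s := by positivity
  calc _ ≤ (n * (10 * M * (2 ^ s) ^ (n - 1))) * (((2 : ℝ) ^ s) ^ n)⁻¹ := by gcongr
    _ = 10 * n * (M / 2 ^ s) := by
      obtain ⟨m, rfl⟩ : ∃ m, n = m + 1 := ⟨n - 1, by omega⟩
      simp only [Nat.add_sub_cancel, pow_succ]
      field_simp
    _ = _ := by
      congr 1
      rw [hM, Real.rpow_sub h2s, Real.rpow_one, div_right_comm, div_self h2s.ne', one_div,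
        ← Real.rpow_neg h2s.le, ← Real.rpow_natCast, ← Real.rpow_natCast,
        ← Real.rpow_mul zero_le_two, ← Real.rpow_mul zero_le_two, mul_comm]

/-- The probabilities of badness at relative scales `s ≥ r` are bounded by the tail of a geometric
series, which is less than `1` for large `r`. -/
lemma exists_piGood_pos {n : ℕ} (hn : 0 < n) {δ : ℝ} (hδ : 0 < δ) :
    ∃ r₀ : ℕ, ∀ r : ℕ, r₀ ≤ r → 0 < piGood n δ r := by
  have hq : (2 : ℝ) ^ (-gammaExp n δ) < 1 :=
    Real.rpow_lt_one_of_one_lt_of_neg one_lt_two (neg_lt_zero.2 (gammaExp_pos hδ))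
  have hsum : Summable fun s : ℕ => 10 * n * ((2 : ℝ) ^ (-gammaExp n δ)) ^ s :=
    (summable_geometric_of_lt_one (by positivity) hq).mul_left _
  have htail := tendsto_sum_nat_add fun s : ℕ => 10 * n * ((2 : ℝ) ^ (-gammaExp n δ)) ^ s
  obtain ⟨r₀, hr₀⟩ := Filter.eventually_atTop.1 (htail.eventually_lt_const one_pos)
  refine ⟨r₀, fun r hr => ?_⟩
  have hcompl : {ω : GridParam n | IsGood δ r ω (0, 0)}ᶜ ⊆
      ⋃ i : ℕ, {ω | (fun j => position ω 0 (i + r) j - (0 : Fin n → ℤ) j) ∈ badAt n δ (i + r)} := by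
    intro ω hω
    simp only [IsGood, isBad_iff, Set.mem_compl_iff, Set.mem_ofPred_eq, not_not] at hω
    obtain ⟨s, hs, h⟩ := hω
    refine Set.mem_iUnion.2 ⟨s - r, ?_⟩
    rw [Nat.sub_add_cancel hs]
    exact h
  have h1 : (gridMeasure n) {ω : GridParam n | IsGood δ r ω (0, 0)}ᶜ < 1 := by
    refine lt_of_le_of_lt (measure_mono hcompl) (lt_of_le_of_lt (measure_iUnion_le _) ?_)
    calc _ ≤ ∑' i : ℕ, ENNReal.ofReal (10 * n * ((2 : ℝ) ^ (-gammaExp n δ)) ^ (i + r)) := by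
          refine ENNReal.tsum_le_tsum fun i => ?_
          rw [← ofReal_measureReal]
          exact ENNReal.ofReal_le_ofReal (gridMeasure_badAt_le hn hδ _)
      _ = ENNReal.ofReal (∑' i : ℕ, 10 * n * ((2 : ℝ) ^ (-gammaExp n δ)) ^ (i + r)) :=
          (ENNReal.ofReal_tsum_of_nonneg (fun i => by positivity)
            ((summable_nat_add_iff r).2 hsum)).symm
      _ < 1 := ENNReal.ofReal_lt_one.2 (hr₀ r hr)
  rw [prob_compl_eq_one_sub (measurableSet_isGood δ r (0, 0))] at h1
  unfold piGood goodProb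
  refine ENNReal.toReal_pos (fun h0 => ?_) (measure_ne_top _ _)
  rw [h0] at h1
  simp at h1

/-! ### Independence of goodness and position -/

/-- Functions of disjoint sets of coordinates are independent. -/
lemma integral_mul_of_disjoint {n : ℕ} {S T : Set ℤ} (hST : Disjoint S T)
    {X Y : GridParam n → ℂ} (hX : Measurable X) (hY : Measurable Y)
    (hXS : ∀ ω ω' : GridParam n, (∀ i ∈ S, ω i = ω' i) → X ω = X ω')
    (hYT : ∀ ω ω' : GridParam n, (∀ i ∈ T, ω i = ω' i) → Y ω = Y ω') :
    ∫ ω, X ω * Y ω ∂gridMeasure n = (∫ ω, X ω ∂gridMeasure n) * ∫ ω, Y ω ∂gridMeasure n := by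
  classical
  have hind : ProbabilityTheory.iIndep
      (fun i : ℤ => MeasurableSpace.comap (fun ω : GridParam n => ω i) inferInstance)
      (gridMeasure n) :=
    ProbabilityTheory.iIndepFun_infinitePi (X := fun (_ : ℤ) (v : Fin n → Fin 2) => v)
      (fun _ => measurable_id)
  have hle : ∀ i : ℤ, MeasurableSpace.comap (fun ω : GridParam n => ω i) inferInstance ≤
      (inferInstance : MeasurableSpace (GridParam n)) := fun i => (measurable_pi_apply i).comap_le
  have hdisj := ProbabilityTheory.indep_iSup_of_disjoint hle hind hST
  have key : ∀ (S : Set ℤ) (X : GridParam n → ℂ), Measurable X →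
      (∀ ω ω' : GridParam n, (∀ i ∈ S, ω i = ω' i) → X ω = X ω') →
      MeasurableSpace.comap X inferInstance ≤
        ⨆ i ∈ S, MeasurableSpace.comap (fun ω : GridParam n => ω i) inferInstance := by
    intro S X hX hXS
    -- Erasing the coordinates outside `S` does not change `X`, and the erasing map is measurable
    -- for the σ-algebra generated by the coordinates in `S`.
    set ρ : GridParam n → GridParam n := fun ω i => if i ∈ S then ω i else 0 with hρ
    have h1 : X = X ∘ ρ := by
      ext ω
      exact hXS _ _ fun i hi => by simp [hρ, hi]
    have h2 : @Measurable _ _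
        (⨆ i ∈ S, MeasurableSpace.comap (fun ω : GridParam n => ω i) inferInstance) _ ρ := by
      refine (@measurable_pi_iff _ _ _ (_) _ _).2 fun i => ?_
      by_cases hi : i ∈ S
      · simp only [hρ, hi, if_true]
        exact (comap_measurable _).mono (le_iSup₂_of_le i hi le_rfl) le_rfl
      · simp only [hρ, hi, if_false]
        exact measurable_const
    rw [h1]
    exact (hX.comp h2).comap_le
  have hXY : ProbabilityTheory.IndepFun X Y (gridMeasure n) := by
    rw [ProbabilityTheory.IndepFun_iff_Indep]
    exact ProbabilityTheory.indep_of_indep_of_le_left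
      (ProbabilityTheory.indep_of_indep_of_le_right hdisj (key T Y hY hYT)) (key S X hX hXS)
  exact hXY.integral_fun_mul_eq_mul_integral hX.aestronglyMeasurable hY.aestronglyMeasurable

lemma position_congr {n : ℕ} {ω ω' : GridParam n} {p : ℤ} (h : ∀ i, i ≤ p → ω i = ω' i) (s : ℕ) :
    position ω p s = position ω' p s := by
  ext j
  unfold position
  exact Finset.sum_congr rfl fun i _ => by rw [h _ (by omega)]

lemma chiGood_congr {n : ℕ} {δ : ℝ} {r : ℕ} {ω ω' : GridParam n} {p : ℤ} {k : Fin n → ℤ}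
    (h : ∀ i, i ≤ p → ω i = ω' i) : chiGood δ r ω (p, k) = chiGood δ r ω' (p, k) := by
  have h1 : IsGood δ r ω (p, k) ↔ IsGood δ r ω' (p, k) := by
    simp only [IsGood, isBad_iff, position_congr h]
  by_cases h2 : IsGood δ r ω (p, k)
  · simp [chiGood, h2, h1.1 h2]
  · simp [chiGood, h2, mt h1.2 h2]

lemma chiGood_eq_indicator {n : ℕ} (δ : ℝ) (r : ℕ) (I : CubeLabel n) :
    (fun ω => chiGood δ r ω I) = {ω | IsGood δ r ω I}.indicator fun _ => (1 : ℂ) := by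
  ext ω
  by_cases h : IsGood δ r ω I
  · rw [Set.indicator_of_mem (by exact h)]
    simp [chiGood, h]
  · rw [Set.indicator_of_notMem (by exact h)]
    simp [chiGood, h]

lemma measurable_chiGood {n : ℕ} (δ : ℝ) (r : ℕ) (I : CubeLabel n) :
    Measurable fun ω => chiGood δ r ω I := by
  rw [chiGood_eq_indicator]
  exact measurable_const.indicator (measurableSet_isGood δ r I)

lemma norm_chiGood_le {n : ℕ} (δ : ℝ) (r : ℕ) (ω : GridParam n) (I : CubeLabel n) :
    ‖chiGood δ r ω I‖ ≤ 1 := by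
  unfold chiGood
  split_ifs <;> simp

lemma integral_chiGood {n : ℕ} (δ : ℝ) (r : ℕ) (I : CubeLabel n) :
    ∫ ω, chiGood δ r ω I ∂gridMeasure n = piGood n δ r := by
  rw [chiGood_eq_indicator, integral_indicator_const _ (measurableSet_isGood δ r I),
    ← goodProb_eq δ r I]
  simp [goodProb]

/-- Goodness of a cube is independent of everything that depends on finer scales only. -/
lemma integral_chiGood_mul {n : ℕ} (δ : ℝ) (r : ℕ) (p : ℤ) (k : Fin n → ℤ)
    {Z : GridParam n → ℂ} (hZ : Measurable Z)
    (hdep : ∀ ω ω' : GridParam n, (∀ i, p < i → ω i = ω' i) → Z ω = Z ω') :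
    ∫ ω, chiGood δ r ω (p, k) * Z ω ∂gridMeasure n =
      piGood n δ r * ∫ ω, Z ω ∂gridMeasure n := by
  rw [← integral_chiGood δ r (p, k)]
  refine integral_mul_of_disjoint (S := Set.Iic p) (T := Set.Ioi p) ?_
    (measurable_chiGood δ r _) hZ (fun ω ω' h => chiGood_congr h) hdep
  exact Set.disjoint_left.2 fun i (hi : i ≤ p) (hi' : p < i) => not_lt.2 hi hi'

/-! ### Averaging of a bilinear form over random grids, one parameter -/

/-- A decomposition `x = ∑_p ∑_k u ω p k` along the cubes of the random grid, with finitely many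
nonzero terms at each scale, where the terms at scale `p` depend on the finer scales only. -/
structure IsGridDecomp {n : ℕ} {X : Type*} [NormedAddCommGroup X] [NormedSpace ℂ X]
    (K : ℤ → Finset (Fin n → ℤ)) (a : ℤ → ℝ)
    (u : GridParam n → ℤ → (Fin n → ℤ) → X) (x : X) : Prop where
  meas : ∀ p k, StronglyMeasurable fun ω => u ω p k
  dep : ∀ p k ω ω', (∀ i, p < i → ω i = ω' i) → u ω p k = u ω' p k
  bound : ∀ ω p (ε : (Fin n → ℤ) → ℂ), (∀ k, ‖ε k‖ ≤ 1) → ‖∑ k ∈ K p, ε k • u ω p k‖ ≤ a p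
  summable : Summable a
  hasSum : ∀ ω, HasSum (fun p => ∑ k ∈ K p, u ω p k) x

section OneParam

variable {n : ℕ} {X Y : Type*} [NormedAddCommGroup X] [NormedSpace ℂ X]
  [NormedAddCommGroup Y] [NormedSpace ℂ Y]
  {K L : ℤ → Finset (Fin n → ℤ)} {a c : ℤ → ℝ}
  {u : GridParam n → ℤ → (Fin n → ℤ) → X} {v : GridParam n → ℤ → (Fin n → ℤ) → Y} {x : X} {y : Y}

lemma IsGridDecomp.nonneg (hu : IsGridDecomp K a u x) (p : ℤ) : 0 ≤ a p :=
  (norm_nonneg _).trans (hu.bound (fun _ _ => 0) p (fun _ => 0) (by simp))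

lemma stronglyMeasurable_bilin (B : X →L[ℂ] Y →L[ℂ] ℂ) {U : GridParam n → X} {V : GridParam n → Y}
    (hU : StronglyMeasurable U) (hV : StronglyMeasurable V) :
    StronglyMeasurable fun ω => B (U ω) (V ω) :=
  B.continuous₂.comp_stronglyMeasurable (hU.prodMk hV)

lemma norm_bilin_le (B : X →L[ℂ] Y →L[ℂ] ℂ) {U : X} {V : Y} {s t : ℝ} (hU : ‖U‖ ≤ s)
    (hV : ‖V‖ ≤ t) : ‖B U V‖ ≤ ‖B‖ * (s * t) := by
  have hs : 0 ≤ s := (norm_nonneg _).trans hU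
  calc _ ≤ ‖B‖ * ‖U‖ * ‖V‖ := B.le_opNorm₂ U V
    _ ≤ ‖B‖ * s * t := by gcongr
    _ = _ := by ring

/-- The sum over scales has the same value `y` on every grid, so after summation the second factor
is deterministic. This is what later restores independence. -/
lemma hasSum_integral_bilin (B : X →L[ℂ] Y →L[ℂ] ℂ) {U : GridParam n → X}
    {V : GridParam n → ℤ → Y} (hU : StronglyMeasurable U)
    (hV : ∀ p, StronglyMeasurable fun ω => V ω p) {s : ℝ} {t : ℤ → ℝ} (hUs : ∀ ω, ‖U ω‖ ≤ s)
    (hVt : ∀ ω p, ‖V ω p‖ ≤ t p) (ht : Summable t) (hy : ∀ ω, HasSum (V ω) y) :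
    HasSum (fun p => ∫ ω, B (U ω) (V ω p) ∂gridMeasure n) (∫ ω, B (U ω) y ∂gridMeasure n) := by
  have hint : ∀ p, Integrable (fun ω => B (U ω) (V ω p)) (gridMeasure n) := fun p =>
    Integrable.of_bound (stronglyMeasurable_bilin B hU (hV p)).aestronglyMeasurable
      (‖B‖ * (s * t p)) (ae_of_all _ fun ω => norm_bilin_le B (hUs ω) (hVt ω p))
  have h := hasSum_integral_of_summable_integral_norm hint ?_
  · have h1 : ∀ ω, ∑' p, B (U ω) (V ω p) = B (U ω) y := fun ω => ((hy ω).mapL (B (U ω))).tsum_eq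
    simpa only [h1] using h
  · refine Summable.of_nonneg_of_le (fun p => integral_nonneg fun _ => norm_nonneg _) (fun p => ?_)
      ((ht.mul_left s).mul_left ‖B‖)
    calc _ ≤ ∫ _, ‖B‖ * (s * t p) ∂gridMeasure n :=
          integral_mono (hint p).norm (integrable_const _)
            fun ω => norm_bilin_le B (hUs ω) (hVt ω p)
      _ = _ := by simp

lemma bilin_weighted_sum {ι ι' : Type*} (B : X →L[ℂ] Y →L[ℂ] ℂ) (s : Finset ι) (t : Finset ι')
    (ε : ι → ℂ) (η : ι' → ℂ) (U : ι → X) (V : ι' → Y) :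
    B (∑ k ∈ s, ε k • U k) (∑ l ∈ t, η l • V l) =
      ∑ k ∈ s, ∑ l ∈ t, ε k * η l * B (U k) (V l) := by
  simp only [map_sum, map_smul, _root_.sum_apply, _root_.smul_apply,
    smul_eq_mul, Finset.mul_sum]
  rw [Finset.sum_comm]
  exact Finset.sum_congr rfl fun _ _ => Finset.sum_congr rfl fun _ _ => by ring

/-- Apart from goodness, everything depends on digits above `p`. The vector `V` may be
deterministic, or a sum over the cubes of a scale at least as fine as `p`. -/
lemma integral_good_sum_mul (δ : ℝ) (r : ℕ) (B : X →L[ℂ] Y →L[ℂ] ℂ) {p : ℤ}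
    {U : GridParam n → (Fin n → ℤ) → X} {V : GridParam n → Y} (s : Finset (Fin n → ℤ))
    (hU : ∀ k, StronglyMeasurable fun ω => U ω k) (hV : StronglyMeasurable V)
    (hUdep : ∀ k ω ω', (∀ i, p < i → ω i = ω' i) → U ω k = U ω' k)
    (hVdep : ∀ ω ω' : GridParam n, (∀ i, p < i → ω i = ω' i) → V ω = V ω')
    {c d : ℝ} (hUc : ∀ k ∈ s, ∀ ω, ‖U ω k‖ ≤ c) (hVd : ∀ ω, ‖V ω‖ ≤ d) :
    ∫ ω, B (∑ k ∈ s, chiGood δ r ω (p, k) • U ω k) (V ω) ∂gridMeasure n =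
      piGood n δ r * ∫ ω, B (∑ k ∈ s, U ω k) (V ω) ∂gridMeasure n := by
  have hint : ∀ k ∈ s, Integrable (fun ω => B (U ω k) (V ω)) (gridMeasure n) := fun k hk =>
    Integrable.of_bound (stronglyMeasurable_bilin B (hU k) hV).aestronglyMeasurable
      (‖B‖ * (c * d)) (ae_of_all _ fun ω => norm_bilin_le B (hUc k hk ω) (hVd ω))
  simp only [map_sum, map_smul, _root_.sum_apply, _root_.smul_apply,
    smul_eq_mul]
  rw [integral_finsetSum _ hint, integral_finsetSum _ fun k hk => ?_, Finset.mul_sum]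
  · refine Finset.sum_congr rfl fun k _ => integral_chiGood_mul δ r p k
      (stronglyMeasurable_bilin B (hU k) hV).measurable fun ω ω' h => ?_
    rw [hUdep k ω ω' h, hVdep ω ω' h]
  · exact (hint k hk).bdd_mul (measurable_chiGood δ r (p, k)).aestronglyMeasurable
      (ae_of_all _ fun ω => norm_chiGood_le δ r ω (p, k))

lemma stronglyMeasurable_good_sum (δ : ℝ) (r : ℕ) (hu : IsGridDecomp K a u x) (p : ℤ) :
    StronglyMeasurable fun ω => ∑ k ∈ K p, chiGood δ r ω (p, k) • u ω p k :=
  Finset.stronglyMeasurable_fun_sum _ fun k _ =>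
    (measurable_chiGood δ r (p, k)).stronglyMeasurable.smul (hu.meas p k)

lemma IsGridDecomp.stronglyMeasurable_sum (hu : IsGridDecomp K a u x) (p : ℤ) :
    StronglyMeasurable fun ω => ∑ k ∈ K p, u ω p k :=
  Finset.stronglyMeasurable_fun_sum _ fun k _ => hu.meas p k

lemma IsGridDecomp.norm_sum_le (hu : IsGridDecomp K a u x) (ω : GridParam n) (p : ℤ) :
    ‖∑ k ∈ K p, u ω p k‖ ≤ a p := by
  simpa using hu.bound ω p (fun _ => 1) (by simp)

lemma IsGridDecomp.norm_le (hu : IsGridDecomp K a u x) (ω : GridParam n) {p : ℤ}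
    {k : Fin n → ℤ} (hk : k ∈ K p) : ‖u ω p k‖ ≤ a p := by
  classical
  have h := hu.bound ω p (fun l => if l = k then 1 else 0) fun l => by split_ifs <;> simp
  simpa [ite_smul, Finset.sum_ite_eq', hk] using h

/-- For a fixed scale of the first cubes, goodness of the first cube can be averaged out. -/
lemma hasSum_integral_good_left (δ : ℝ) (r : ℕ) (B : X →L[ℂ] Y →L[ℂ] ℂ)
    (hu : IsGridDecomp K a u x) (hv : IsGridDecomp L c v y) (p : ℤ) :
    HasSum (fun q => ∫ ω, B (∑ k ∈ K p, chiGood δ r ω (p, k) • u ω p k) (∑ l ∈ L q, v ω q l)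
      ∂gridMeasure n) (piGood n δ r * ∫ ω, B (∑ k ∈ K p, u ω p k) y ∂gridMeasure n) := by
  -- For coarse `q` the individual terms are not independent of the goodness of the finer cubes.
  -- Goodness factors out only after summing over `q`, which replaces the second argument by `y`.
  rw [← integral_good_sum_mul δ r B (K p) (hu.meas p) stronglyMeasurable_const
    (fun k => hu.dep p k) (fun _ _ _ => rfl) (fun k hk ω => hu.norm_le ω hk) (fun _ => le_rfl)]
  exact hasSum_integral_bilin B (stronglyMeasurable_good_sum δ r hu p)
    hv.stronglyMeasurable_sum (fun ω => hu.bound ω p _ fun k => norm_chiGood_le δ r ω (p, k))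
    hv.norm_sum_le hv.summable hv.hasSum

lemma summable_of_bilin_bound (B : X →L[ℂ] Y →L[ℂ] ℂ)
    (hu : IsGridDecomp K a u x) (hv : IsGridDecomp L c v y) :
    Summable fun P : ℤ × ℤ => ‖B‖ * (a P.1 * c P.2) :=
  (hu.summable.mul_of_nonneg hv.summable hu.nonneg hv.nonneg).mul_left _

lemma norm_integral_bilin_le (B : X →L[ℂ] Y →L[ℂ] ℂ) {U : GridParam n → X} {V : GridParam n → Y}
    {s t : ℝ} (hU : ∀ ω, ‖U ω‖ ≤ s) (hV : ∀ ω, ‖V ω‖ ≤ t) :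
    ‖∫ ω, B (U ω) (V ω) ∂gridMeasure n‖ ≤ ‖B‖ * (s * t) := by
  refine (norm_integral_le_of_norm_le_const
    (ae_of_all _ fun ω => norm_bilin_le B (hU ω) (hV ω))).trans ?_
  simp

/-- The total over all scales when goodness of the first cube is imposed. -/
lemma hasSum_good_left (δ : ℝ) (r : ℕ) (B : X →L[ℂ] Y →L[ℂ] ℂ)
    (hu : IsGridDecomp K a u x) (hv : IsGridDecomp L c v y) :
    HasSum (fun P : ℤ × ℤ => ∫ ω, B (∑ k ∈ K P.1, chiGood δ r ω (P.1, k) • u ω P.1 k)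
      (∑ l ∈ L P.2, v ω P.2 l) ∂gridMeasure n) (piGood n δ r * B x y) := by
  have hs : Summable (fun P : ℤ × ℤ => ∫ ω, B (∑ k ∈ K P.1, chiGood δ r ω (P.1, k) • u ω P.1 k)
      (∑ l ∈ L P.2, v ω P.2 l) ∂gridMeasure n) :=
    Summable.of_norm_bounded (summable_of_bilin_bound B hu hv) fun P =>
      norm_integral_bilin_le B (fun ω => hu.bound ω P.1 _ fun k => norm_chiGood_le δ r ω (P.1, k))
        (fun ω => hv.norm_sum_le ω P.2)
  have h1 := hs.hasSum.prod_fiberwise fun p => hasSum_integral_good_left δ r B hu hv p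
  have h2 : HasSum (fun p => ∫ ω, B (∑ k ∈ K p, u ω p k) y ∂gridMeasure n) (B x y) := by
    have h := hasSum_integral_bilin (n := n) B.flip (U := fun _ => y) stronglyMeasurable_const
      hu.stronglyMeasurable_sum (fun _ => le_rfl) hu.norm_sum_le hu.summable hu.hasSum
    simpa using h
  rw [← h1.unique (h2.mul_left _)]
  exact hs.hasSum

lemma hasSum_integral_all (B : X →L[ℂ] Y →L[ℂ] ℂ)
    (hu : IsGridDecomp K a u x) (hv : IsGridDecomp L c v y) :
    HasSum (fun P : ℤ × ℤ => ∫ ω, B (∑ k ∈ K P.1, u ω P.1 k)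
      (∑ l ∈ L P.2, v ω P.2 l) ∂gridMeasure n) (B x y) := by
  have hs : Summable (fun P : ℤ × ℤ => ∫ ω, B (∑ k ∈ K P.1, u ω P.1 k)
      (∑ l ∈ L P.2, v ω P.2 l) ∂gridMeasure n) :=
    Summable.of_norm_bounded (summable_of_bilin_bound B hu hv) fun P =>
      norm_integral_bilin_le B (fun ω => hu.norm_sum_le ω P.1) (fun ω => hv.norm_sum_le ω P.2)
  have h0 : ∀ p, HasSum (fun q => ∫ ω, B (∑ k ∈ K p, u ω p k) (∑ l ∈ L q, v ω q l)
      ∂gridMeasure n) (∫ ω, B (∑ k ∈ K p, u ω p k) y ∂gridMeasure n) := fun p =>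
    hasSum_integral_bilin B (hu.stronglyMeasurable_sum p)
      hv.stronglyMeasurable_sum (fun ω => hu.norm_sum_le ω p)
      hv.norm_sum_le hv.summable hv.hasSum
  have h1 := hs.hasSum.prod_fiberwise h0
  have h2 : HasSum (fun p => ∫ ω, B (∑ k ∈ K p, u ω p k) y ∂gridMeasure n) (B x y) := by
    have h := hasSum_integral_bilin (n := n) B.flip (U := fun _ => y) stronglyMeasurable_const
      hu.stronglyMeasurable_sum (fun _ => le_rfl) hu.norm_sum_le hu.summable hu.hasSum
    simpa using h
  rw [← h1.unique h2]
  exact hs.hasSum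

/-- The sum over the cubes of two given scales, where the smaller cube has to be good. -/
def goodPairSum (δ : ℝ) (r : ℕ) (B : X →L[ℂ] Y →L[ℂ] ℂ) (K L : ℤ → Finset (Fin n → ℤ))
    (u : GridParam n → ℤ → (Fin n → ℤ) → X) (v : GridParam n → ℤ → (Fin n → ℤ) → Y)
    (ω : GridParam n) (P : ℤ × ℤ) : ℂ :=
  ∑ k ∈ K P.1, ∑ l ∈ L P.2,
    chiGood δ r ω (small (P.1, k) (P.2, l)) * B (u ω P.1 k) (v ω P.2 l)

lemma goodPairSum_of_le (δ : ℝ) (r : ℕ) (B : X →L[ℂ] Y →L[ℂ] ℂ) (ω : GridParam n) {P : ℤ × ℤ}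
    (h : P.2 ≤ P.1) : goodPairSum δ r B K L u v ω P =
      B (∑ k ∈ K P.1, chiGood δ r ω (P.1, k) • u ω P.1 k) (∑ l ∈ L P.2, v ω P.2 l) := by
  have := bilin_weighted_sum B (K P.1) (L P.2) (fun k => chiGood δ r ω (P.1, k)) (fun _ => 1)
    (u ω P.1) (v ω P.2)
  simp only [one_smul, mul_one] at this
  simp only [this, goodPairSum, small, h, if_true]

lemma goodPairSum_of_lt (δ : ℝ) (r : ℕ) (B : X →L[ℂ] Y →L[ℂ] ℂ) (ω : GridParam n) {P : ℤ × ℤ}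
    (h : P.1 < P.2) : goodPairSum δ r B K L u v ω P =
      B (∑ k ∈ K P.1, u ω P.1 k) (∑ l ∈ L P.2, chiGood δ r ω (P.2, l) • v ω P.2 l) := by
  have := bilin_weighted_sum B (K P.1) (L P.2) (fun _ => 1) (fun l => chiGood δ r ω (P.2, l))
    (u ω P.1) (v ω P.2)
  simp only [one_smul, one_mul] at this
  simp only [this, goodPairSum, small, not_le.2 h, if_false]

lemma norm_goodPairSum_le (δ : ℝ) (r : ℕ) (B : X →L[ℂ] Y →L[ℂ] ℂ)
    (hu : IsGridDecomp K a u x) (hv : IsGridDecomp L c v y) (ω : GridParam n) (P : ℤ × ℤ) :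
    ‖goodPairSum δ r B K L u v ω P‖ ≤ ‖B‖ * (a P.1 * c P.2) := by
  rcases le_or_gt P.2 P.1 with h | h
  · rw [goodPairSum_of_le δ r B ω h]
    exact norm_bilin_le B (hu.bound ω P.1 _ fun k => norm_chiGood_le δ r ω (P.1, k))
      (hv.norm_sum_le ω P.2)
  · rw [goodPairSum_of_lt δ r B ω h]
    exact norm_bilin_le B (hu.norm_sum_le ω P.1)
      (hv.bound ω P.2 _ fun k => norm_chiGood_le δ r ω (P.2, k))

lemma stronglyMeasurable_goodPairSum (δ : ℝ) (r : ℕ) (B : X →L[ℂ] Y →L[ℂ] ℂ)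
    (hu : IsGridDecomp K a u x) (hv : IsGridDecomp L c v y) (P : ℤ × ℤ) :
    StronglyMeasurable fun ω => goodPairSum δ r B K L u v ω P :=
  Finset.stronglyMeasurable_fun_sum _ fun k _ => Finset.stronglyMeasurable_fun_sum _ fun l _ =>
    (measurable_chiGood δ r _).stronglyMeasurable.mul
      (stronglyMeasurable_bilin B (hu.meas P.1 k) (hv.meas P.2 l))

/-- **Averaging formula in one parameter**: restricting the smaller cube to be good multiplies
the average of the bilinear form by the probability of being good. -/
theorem hasSum_integral_goodPairSum (δ : ℝ) (r : ℕ) (B : X →L[ℂ] Y →L[ℂ] ℂ)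
    (hu : IsGridDecomp K a u x) (hv : IsGridDecomp L c v y) :
    HasSum (fun P : ℤ × ℤ => ∫ ω, goodPairSum δ r B K L u v ω P ∂gridMeasure n)
      (piGood n δ r * B x y) := by
  have h1 := hasSum_good_left δ r B hu hv
  have h2 := (Equiv.prodComm ℤ ℤ).hasSum_iff.2 (hasSum_good_left δ r B.flip hv hu)
  have h3 := (hasSum_integral_all B hu hv).mul_left (piGood n δ r : ℂ)
  -- Inclusion and exclusion: the three series sum to `π B x y` each, hence their combination does
  -- too.
  have h4 := (h1.add h2).sub h3
  rw [ContinuousLinearMap.flip_apply, add_sub_cancel_right] at h4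
  refine Eq.mp (congrArg (fun F => HasSum F _) (funext fun P => Eq.symm ?_)) h4
  simp only [Function.comp_apply, Equiv.prodComm_apply, Prod.fst_swap, Prod.snd_swap,
    ContinuousLinearMap.flip_apply]
  -- All other factors depend only on digits finer than the scale of the larger cube, so goodness of
  -- that cube factors out and its term cancels against the third one.
  rcases le_or_gt P.2 P.1 with h | h
  · simp only [goodPairSum_of_le δ r B _ h]
    have h5 := integral_good_sum_mul δ r B.flip (p := P.2) (L P.2) (hv.meas P.2)
      (hu.stronglyMeasurable_sum P.1) (fun k => hv.dep P.2 k)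
      (fun ω ω' hω => Finset.sum_congr rfl fun k _ =>
        hu.dep P.1 k ω ω' fun i hi => hω i (lt_of_le_of_lt h hi))
      (fun k hk ω => hv.norm_le ω hk) (fun ω => hu.norm_sum_le ω P.1)
    simp only [ContinuousLinearMap.flip_apply] at h5
    rw [h5, add_sub_cancel_right]
  · simp only [goodPairSum_of_lt δ r B _ h]
    have h5 := integral_good_sum_mul δ r B (p := P.1) (K P.1) (hu.meas P.1)
      (hv.stronglyMeasurable_sum P.2) (fun k => hu.dep P.1 k)
      (fun ω ω' hω => Finset.sum_congr rfl fun k _ =>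
        hv.dep P.2 k ω ω' fun i hi => hω i (lt_trans h hi))
      (fun k hk ω => hu.norm_le ω hk) (fun ω => hv.norm_sum_le ω P.2)
    rw [h5, add_sub_cancel_left]

theorem integral_tsum_goodPairSum (δ : ℝ) (r : ℕ) (B : X →L[ℂ] Y →L[ℂ] ℂ)
    (hu : IsGridDecomp K a u x) (hv : IsGridDecomp L c v y) :
    ∫ ω, ∑' P : ℤ × ℤ, goodPairSum δ r B K L u v ω P ∂gridMeasure n =
      piGood n δ r * B x y := by
  have hint : ∀ P, Integrable (fun ω => goodPairSum δ r B K L u v ω P) (gridMeasure n) := fun P =>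
    Integrable.of_bound (stronglyMeasurable_goodPairSum δ r B hu hv P).aestronglyMeasurable _
      (ae_of_all _ fun ω => norm_goodPairSum_le δ r B hu hv ω P)
  have hs := hasSum_integral_of_summable_integral_norm hint <|
    Summable.of_nonneg_of_le (fun P => integral_nonneg fun _ => norm_nonneg _) (fun P => by
      calc _ ≤ ∫ _, ‖B‖ * (a P.1 * c P.2) ∂gridMeasure n :=
            integral_mono (hint P).norm (integrable_const _)
              fun ω => norm_goodPairSum_le δ r B hu hv ω P
        _ = _ := by simp) (summable_of_bilin_bound B hu hv)
  exact hs.unique (hasSum_integral_goodPairSum δ r B hu hv)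

end OneParam

/-! ### Cubes: measurability, volume, size -/

lemma measurableSet_cube {n : ℕ} (a : E n) (s : ℝ) : MeasurableSet (cube a s) := by
  have h : cube a s = ⋂ j, ({x : E n | a j ≤ x j} ∩ {x | x j < a j + s}) := by
    ext x
    simp only [cube, Set.mem_ofPred_eq, Set.mem_iInter, Set.mem_inter_iff]
  rw [h]
  have hc : ∀ j, Measurable fun x : E n => x j := fun j => by fun_prop
  exact MeasurableSet.iInter fun j => (measurableSet_le measurable_const (hc j)).inter
    (measurableSet_lt (hc j) measurable_const)

lemma volume_cube {n : ℕ} (a : E n) (s : ℝ) : volume (cube a s) = ENNReal.ofReal s ^ n := by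
  have h : cube a s = WithLp.ofLp ⁻¹' (Set.univ.pi fun j => Set.Ico (a j) (a j + s)) := by
    ext x
    simp [cube, Set.mem_pi]
  rw [h, (PiLp.volume_preserving_ofLp (Fin n)).measure_preimage
    (MeasurableSet.univ_pi fun _ => measurableSet_Ico).nullMeasurableSet, Real.volume_pi_Ico]
  simp

lemma volume_real_cube {n : ℕ} (a : E n) {s : ℝ} (hs : 0 ≤ s) : volume.real (cube a s) = s ^ n := by
  rw [measureReal_def, volume_cube, ENNReal.toReal_pow, ENNReal.toReal_ofReal hs]

lemma volume_cube_lt_top {n : ℕ} (a : E n) (s : ℝ) : volume (cube a s) < ∞ := by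
  rw [volume_cube]
  exact ENNReal.pow_lt_top ENNReal.ofReal_lt_top

lemma measurableSet_gridCube {n : ℕ} (ω : GridParam n) (I : CubeLabel n) :
    MeasurableSet (gridCube ω I) := by
  rw [gridCube_eq_cube]
  exact measurableSet_cube _ _

lemma volume_gridCube_lt_top {n : ℕ} (ω : GridParam n) (I : CubeLabel n) :
    volume (gridCube ω I) < ∞ := by
  rw [gridCube_eq_cube]
  exact volume_cube_lt_top _ _

lemma volume_real_gridCube {n : ℕ} (ω : GridParam n) (I : CubeLabel n) :
    volume.real (gridCube ω I) = side I ^ n := by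
  rw [gridCube_eq_cube]
  exact volume_real_cube _ (side_pos I).le

lemma norm_le_of_coord_le {n : ℕ} {x : E n} {t : ℝ} (ht : 0 ≤ t) (h : ∀ j, |x j| ≤ t) :
    ‖x‖ ≤ n * t := by
  rw [EuclideanSpace.norm_eq]
  refine Real.sqrt_le_iff.2 ⟨by positivity, ?_⟩
  calc ∑ i, ‖x i‖ ^ 2 ≤ ∑ _i : Fin n, t ^ 2 :=
        Finset.sum_le_sum fun i _ => pow_le_pow_left₀ (norm_nonneg _) (h i) 2
    _ = n * t ^ 2 := by simp
    _ ≤ (n * t) ^ 2 := by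
      rw [mul_pow]
      refine mul_le_mul_of_nonneg_right ?_ (by positivity)
      exact_mod_cast Nat.le_self_pow two_ne_zero n

lemma norm_sub_le_of_mem_gridCube {n : ℕ} {ω : GridParam n} {I : CubeLabel n} {x y : E n}
    (hx : x ∈ gridCube ω I) (hy : y ∈ gridCube ω I) : ‖x - y‖ ≤ n * side I := by
  rw [gridCube_eq_cube] at hx hy
  refine norm_le_of_coord_le (side_pos I).le fun j => ?_
  have h1 := hx j
  have h2 := hy j
  rw [PiLp.sub_apply, abs_le]
  constructor <;> linarith

/-! ### Bounded functions with averages bounded away from zero -/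

/-- Functions bounded by `β`, whose averages over cubes are bounded from below by `κ`. -/
structure IsAccretive {n : ℕ} (b : E n → ℂ) (β κ : ℝ) : Prop where
  meas : AEStronglyMeasurable b volume
  bound : ∀ᵐ x, ‖b x‖ ≤ β
  lower : ∀ (a : E n) (s : ℝ), 0 < s → κ * s ^ n ≤ ‖∫ x in cube a s, b x‖
  pos_left : 0 < β
  pos : 0 < κ

lemma exists_ae_bound {n : ℕ} {b : E n → ℂ} (hb : MemLp b ∞ volume) :
    ∃ β : ℝ, 0 < β ∧ ∀ᵐ x, ‖b x‖ ≤ β := by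
  refine ⟨max (eLpNorm b ∞ volume).toReal 1, by positivity, ?_⟩
  have h : ∀ᵐ x, ‖b x‖ₑ ≤ eLpNorm b ∞ volume := by
    rw [eLpNorm_exponent_top]
    exact ae_le_eLpNormEssSup
  filter_upwards [h] with x hx
  refine le_trans ?_ (le_max_left _ _)
  rw [← toReal_enorm]
  exact ENNReal.toReal_mono hb.2.ne hx

lemma norm_integral_cube_le {n : ℕ} {b : E n → ℂ} {β : ℝ} (hb : ∀ᵐ x, ‖b x‖ ≤ β) (a : E n) {s : ℝ}
    (hs : 0 ≤ s) : ‖∫ x in cube a s, b x‖ ≤ β * s ^ n := by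
  rw [← volume_real_cube a hs]
  exact norm_setIntegral_le_of_norm_le_const_ae' (volume_cube_lt_top a s)
    (hb.mono fun x hx _ => hx)

/-- The integral over a rectangle factors. With one side fixed as the unit cube, the corresponding
factor is at most its sup bound `β`, and the other factor inherits the lower bound `C / β`. -/
lemma exists_isAccretive {n m : ℕ} {b₁ : E n → ℂ} {b₂ : E m → ℂ} (hb₁ : MemLp b₁ ∞ volume)
    (hb₂ : MemLp b₂ ∞ volume) (hb : IsPseudoAccretive (tensor b₁ b₂)) :
    (∃ β κ, IsAccretive b₁ β κ) ∧ ∃ β κ, IsAccretive b₂ β κ := by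
  obtain ⟨-, C, hC, h⟩ := hb
  obtain ⟨β₁, hβ₁, h₁⟩ := exists_ae_bound hb₁
  obtain ⟨β₂, hβ₂, h₂⟩ := exists_ae_bound hb₂
  have key : ∀ (a : E n) (s : ℝ) (a' : E m) (s' : ℝ), 0 < s → 0 < s' →
      C * (s ^ n * s' ^ m) < ‖∫ x in cube a s, b₁ x‖ * ‖∫ x in cube a' s', b₂ x‖ := by
    intro a s a' s' hs hs'
    have h3 := h a s a' s' hs hs'
    have h4 : ∫ x in cube a s ×ˢ cube a' s', tensor b₁ b₂ x =
        (∫ x in cube a s, b₁ x) * ∫ x in cube a' s', b₂ x :=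
      setIntegral_prod_mul b₁ b₂ (cube a s) (cube a' s')
    rw [h4, norm_mul, Measure.volume_eq_prod, Measure.prod_prod, volume_cube, volume_cube,
      ENNReal.toReal_mul, ENNReal.toReal_pow, ENNReal.toReal_pow, ENNReal.toReal_ofReal hs.le,
      ENNReal.toReal_ofReal hs'.le, lt_div_iff₀ (by positivity)] at h3
    exact h3
  refine ⟨⟨β₁, C / β₂, hb₁.1, h₁, fun a s hs => ?_, hβ₁, by positivity⟩,
    ⟨β₂, C / β₁, hb₂.1, h₂, fun a s hs => ?_, hβ₂, by positivity⟩⟩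
  · have h3 := key a s 0 1 hs one_pos
    have h4 := norm_integral_cube_le h₂ 0 zero_le_one
    rw [one_pow, mul_one] at h3 h4
    rw [div_mul_eq_mul_div, div_le_iff₀ hβ₂]
    exact h3.le.trans (mul_le_mul_of_nonneg_left h4 (norm_nonneg _))
  · have h3 := key 0 1 a s one_pos hs
    have h4 := norm_integral_cube_le h₁ 0 zero_le_one
    rw [one_pow, one_mul] at h3
    rw [one_pow, mul_one] at h4
    rw [div_mul_eq_mul_div, div_le_iff₀ hβ₁, mul_comm ‖_‖]
    exact h3.le.trans (mul_le_mul_of_nonneg_right h4 (norm_nonneg _))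

section OneVariable

variable {n : ℕ} {b : E n → ℂ} {β κ : ℝ}

lemma IsAccretive.lower_gridCube (hb : IsAccretive b β κ) (ω : GridParam n) (I : CubeLabel n) :
    κ * side I ^ n ≤ ‖∫ x in gridCube ω I, b x‖ := by
  rw [gridCube_eq_cube]
  exact hb.lower _ _ (side_pos I)

lemma IsAccretive.integral_ne_zero (hb : IsAccretive b β κ) (ω : GridParam n) (I : CubeLabel n) :
    ∫ x in gridCube ω I, b x ≠ 0 := by
  have h1 := hb.lower_gridCube ω I
  have h2 : 0 < κ * side I ^ n := mul_pos hb.pos (pow_pos (side_pos I) n)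
  exact norm_pos_iff.1 (h2.trans_le h1)

/-! ### Adapted expectations and their differences in one variable -/

lemma expect_eq (b : E n → ℂ) (ω : GridParam n) (p : ℤ) (h : E n → ℂ) (x : E n) :
    expect b ω p h x = (∫ y in gridCube ω (p, idx ω p x), h y * b y) /
      ∫ y in gridCube ω (p, idx ω p x), b y := by
  unfold expect
  rw [tsum_eq_single (idx ω p x), Set.indicator_of_mem (mem_gridCube_idx ω p x)]
  intro k hk
  exact Set.indicator_of_notMem (fun hx => hk (mem_gridCube_iff.1 hx).symm) _

/-- `E_{p+1} h - E_p h`. -/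
def mdiff (b : E n → ℂ) (ω : GridParam n) (p : ℤ) (h : E n → ℂ) (x : E n) : ℂ :=
  expect b ω (p + 1) h x - expect b ω p h x

lemma delta_eq (b : E n → ℂ) (ω : GridParam n) (p : ℤ) (k : Fin n → ℤ) (h : E n → ℂ) (x : E n) :
    delta b ω (p, k) h x = if idx ω p x = k then mdiff b ω p h x else 0 := by
  unfold delta mdiff
  split_ifs with hx
  · rw [Set.indicator_of_mem (mem_gridCube_iff.2 hx)]
  · rw [Set.indicator_of_notMem (fun h => hx (mem_gridCube_iff.1 h))]

lemma mdiff_zero (b : E n → ℂ) (ω : GridParam n) (p : ℤ) (x : E n) :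
    mdiff b ω p (fun _ => 0) x = 0 := by
  simp [mdiff, expect_eq]

lemma idx_congr {ω ω' : GridParam n} {p : ℤ} (h : gridShift ω p = gridShift ω' p) :
    idx ω p = idx ω' p := by
  ext x j
  simp only [idx, h]

lemma gridCube_congr {ω ω' : GridParam n} {p : ℤ} (h : gridShift ω p = gridShift ω' p)
    (k : Fin n → ℤ) : gridCube ω (p, k) = gridCube ω' (p, k) := by
  simp only [gridCube, h]

/-- The grids of scales `p` and `p + 1` are positioned by digits of index above `p`. This is the
counterpart of `chiGood_congr` in the independence argument. -/
lemma mdiff_congr {ω ω' : GridParam n} {p : ℤ} (h : ∀ i, p < i → ω i = ω' i) :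
    mdiff b ω p = mdiff b ω' p := by
  have key : ∀ q, p ≤ q → expect b ω q = expect b ω' q := by
    intro q hq
    have h1 : gridShift ω q = gridShift ω' q := gridShift_congr fun i hi => h i (by omega)
    ext f x
    simp only [expect_eq, idx_congr h1, gridCube_congr h1]
  ext f x
  simp only [mdiff, key p le_rfl, key (p + 1) (by omega)]

/-- Functions bounded by `M`, with Lipschitz constant `M`, vanishing outside the ball of
radius `R`. -/
structure IsTame {n : ℕ} (M R : ℝ) (h : E n → ℂ) : Prop where
  bound : ∀ x, ‖h x‖ ≤ M
  lip : ∀ x y, ‖h x - h y‖ ≤ M * ‖x - y‖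
  supp : ∀ x, R < ‖x‖ → h x = 0

variable {M R : ℝ} {h : E n → ℂ}

lemma IsTame.nonneg (hh : IsTame M R h) : 0 ≤ M := (norm_nonneg _).trans (hh.bound 0)

lemma IsTame.continuous (hh : IsTame M R h) : Continuous h := by
  have : LipschitzWith ⟨M, hh.nonneg⟩ h := LipschitzWith.of_dist_le_mul fun x y => by
    rw [dist_eq_norm, dist_eq_norm]
    exact hh.lip x y
  exact this.continuous

lemma IsAccretive.integrableOn (hb : IsAccretive b β κ) (ω : GridParam n) (I : CubeLabel n) :
    IntegrableOn b (gridCube ω I) :=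
  IntegrableOn.of_bound (volume_gridCube_lt_top ω I) hb.meas.restrict β
    (ae_restrict_of_ae hb.bound)

lemma IsAccretive.integrableOn_mul (hb : IsAccretive b β κ) (hh : Continuous h)
    (hM : ∀ x, ‖h x‖ ≤ M) (ω : GridParam n) (I : CubeLabel n) :
    IntegrableOn (fun y => h y * b y) (gridCube ω I) :=
  (hb.integrableOn ω I).bdd_mul hh.aestronglyMeasurable (ae_of_all _ hM)

lemma expect_sub (hb : IsAccretive b β κ) {M' R' : ℝ} {h' : E n → ℂ} (hh : IsTame M R h)
    (hh' : IsTame M' R' h') (ω : GridParam n) (p : ℤ) (x : E n) :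
    expect b ω p (fun z => h z - h' z) x = expect b ω p h x - expect b ω p h' x := by
  simp only [expect_eq, sub_mul]
  rw [integral_sub (hb.integrableOn_mul hh.continuous hh.bound ω _)
    (hb.integrableOn_mul hh'.continuous hh'.bound ω _), sub_div]

lemma mdiff_sub (hb : IsAccretive b β κ) {M' R' : ℝ} {h' : E n → ℂ} (hh : IsTame M R h)
    (hh' : IsTame M' R' h') (ω : GridParam n) (p : ℤ) (x : E n) :
    mdiff b ω p (fun z => h z - h' z) x = mdiff b ω p h x - mdiff b ω p h' x := by
  simp only [mdiff, expect_sub hb hh hh']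
  ring

/-- The adapted expectation reproduces constants, so the error is a weighted average of `h y - h x`
over one cube. The diameter is estimated crudely by `n * 2 ^ (-p)`, and division by the integral of
`b` costs `β / κ`. -/
lemma norm_expect_sub_le (hb : IsAccretive b β κ) (hh : IsTame M R h) (ω : GridParam n) (p : ℤ)
    (x : E n) : ‖expect b ω p h x - h x‖ ≤ M * (β / κ * n * 2 ^ (-p)) := by
  set I : CubeLabel n := (p, idx ω p x) with hI
  have hx : x ∈ gridCube ω I := mem_gridCube_idx ω p x
  have hM := hh.nonneg
  have hs := side_pos I
  have hβ := hb.pos_left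
  have hκ := hb.pos
  have h1 : expect b ω p h x - h x = (∫ y in gridCube ω I, (h y - h x) * b y) /
      ∫ y in gridCube ω I, b y := by
    rw [expect_eq]
    simp only [sub_mul]
    rw [integral_sub (hb.integrableOn_mul hh.continuous hh.bound ω _)
      ((hb.integrableOn ω _).const_mul _), integral_const_mul, sub_div,
      mul_div_cancel_right₀ _ (hb.integral_ne_zero ω I)]
  have h2 : ‖∫ y in gridCube ω I, (h y - h x) * b y‖ ≤ M * (n * side I) * β * side I ^ n := by
    rw [← volume_real_gridCube ω I]
    refine norm_setIntegral_le_of_norm_le_const_ae' (volume_gridCube_lt_top ω I)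
      (hb.bound.mono fun y hy hyI => ?_)
    rw [norm_mul]
    refine mul_le_mul ?_ hy (norm_nonneg _) (by positivity)
    exact (hh.lip y x).trans (mul_le_mul_of_nonneg_left (norm_sub_le_of_mem_gridCube hyI hx) hM)
  rw [h1, norm_div]
  calc _ ≤ M * (n * side I) * β * side I ^ n / (κ * side I ^ n) :=
        div_le_div₀ (by positivity) h2 (by positivity) (hb.lower_gridCube ω I)
    _ = M * (β / κ * n * side I) := by field_simp
    _ = _ := rfl

/-- Meant for large cubes: the numerator sees only the ball supporting `h`, while the denominator
grows like the volume of the cube. -/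
lemma norm_expect_le (hb : IsAccretive b β κ) (hh : IsTame M R h) (ω : GridParam n) (p : ℤ)
    (x : E n) : ‖expect b ω p h x‖ ≤
      M * (β / κ * volume.real (Metric.closedBall (0 : E n) R) * (2 ^ p) ^ n) := by
  set I : CubeLabel n := (p, idx ω p x) with hI
  have hM := hh.nonneg
  have hs := side_pos I
  have hβ := hb.pos_left
  have hκ := hb.pos
  have h2 : ‖∫ y in gridCube ω I, h y * b y‖ ≤
      M * β * volume.real (Metric.closedBall (0 : E n) R) := by
    have h3 : ∫ y in gridCube ω I, h y * b y =
        ∫ y in gridCube ω I ∩ Metric.closedBall 0 R, h y * b y := by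
      refine setIntegral_eq_of_subset_of_forall_sdiff_eq_zero (μ := volume)
        (f := fun y => h y * b y) (measurableSet_gridCube ω I)
        Set.inter_subset_left fun y hy => ?_
      rw [hh.supp y (not_le.1 fun hle => hy.2 ⟨hy.1, by simpa using hle⟩), zero_mul]
    rw [h3]
    refine (norm_setIntegral_le_of_norm_le_const_ae'
      (lt_of_le_of_lt (measure_mono Set.inter_subset_left) (volume_gridCube_lt_top ω I))
      (C := M * β) (hb.bound.mono fun y hy _ => ?_)).trans ?_
    · rw [norm_mul]
      exact mul_le_mul (hh.bound y) hy (norm_nonneg _) hM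
    · refine mul_le_mul_of_nonneg_left ?_ (by positivity)
      exact measureReal_mono Set.inter_subset_right measure_closedBall_lt_top.ne
  rw [expect_eq, norm_div]
  calc _ ≤ M * β * volume.real (Metric.closedBall (0 : E n) R) / (κ * side I ^ n) :=
        div_le_div₀ (by positivity) h2 (by positivity) (hb.lower_gridCube ω I)
    _ = M * (β / κ * volume.real (Metric.closedBall (0 : E n) R) * ((side I)⁻¹) ^ n) := by
      rw [inv_pow]; field_simp
    _ = _ := by rw [side, zpow_neg, inv_inv]

lemma norm_le_of_expect_ne_zero (hsupp : ∀ x, R < ‖x‖ → h x = 0) {ω : GridParam n} {p : ℤ}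
    {x : E n} (hx : expect b ω p h x ≠ 0) : ‖x‖ ≤ R + n * 2 ^ (-p) := by
  by_contra hcon
  refine hx ?_
  rw [expect_eq, setIntegral_eq_zero_of_forall_eq_zero, zero_div]
  intro y hy
  have h1 := norm_sub_le_of_mem_gridCube (mem_gridCube_idx ω p x) hy
  have h2 : ‖x‖ ≤ ‖x - y‖ + ‖y‖ := by simpa using norm_add_le (x - y) y
  simp only [side] at h1
  rw [hsupp y (by linarith), zero_mul]

lemma norm_le_of_mdiff_ne_zero (hsupp : ∀ x, R < ‖x‖ → h x = 0) {ω : GridParam n} {p : ℤ}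
    {x : E n} (hx : mdiff b ω p h x ≠ 0) : ‖x‖ ≤ R + n * 2 ^ (-p) := by
  by_cases h0 : expect b ω p h x = 0
  · have h1 : expect b ω (p + 1) h x ≠ 0 := by simpa [mdiff, h0] using hx
    refine (norm_le_of_expect_ne_zero hsupp h1).trans ?_
    gcongr
    · exact one_le_two
    · omega
  · exact norm_le_of_expect_ne_zero hsupp h0

/-- The positions of the cubes of scale `p` that can meet the ball of radius `R + n 2^{-p}`. -/
def posSet (n : ℕ) (R : ℝ) (p : ℤ) : Finset (Fin n → ℤ) :=
  Fintype.piFinset fun _ => Finset.Icc (-(⌈2 ^ p * R + n⌉ + 2)) (⌈2 ^ p * R + n⌉ + 2)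

/-- The finite set has to serve all grids at once. In units of the side length the shift is at most
`1`, and the margin `2` in `posSet` absorbs it together with the rounding. -/
lemma idx_mem_posSet {ω : GridParam n} {p : ℤ} {x : E n} (hx : ‖x‖ ≤ R + n * 2 ^ (-p)) :
    idx ω p x ∈ posSet n R p := by
  refine Fintype.mem_piFinset.2 fun j => Finset.mem_Icc.2 ?_
  have h0 : (0 : ℝ) < 2 ^ p := by positivity
  have hinv : (2 : ℝ) ^ p * 2 ^ (-p) = 1 := by rw [← zpow_add₀ two_ne_zero]; simp
  have h1 : |x j| ≤ R + n * 2 ^ (-p) := (PiLp.norm_apply_le x j).trans hx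
  have h2 : 2 ^ p * |x j| ≤ 2 ^ p * R + n := by
    calc _ ≤ 2 ^ p * (R + n * 2 ^ (-p)) := mul_le_mul_of_nonneg_left h1 h0.le
      _ = 2 ^ p * R + n * (2 ^ p * 2 ^ (-p)) := by ring
      _ = _ := by rw [hinv, mul_one]
  have h3 : 2 ^ p * gridShift ω p j ≤ 1 := by
    rw [← hinv]
    exact mul_le_mul_of_nonneg_left (gridShift_le ω p j) h0.le
  have h4 : 0 ≤ 2 ^ p * gridShift ω p j := mul_nonneg h0.le (gridShift_nonneg ω p j)
  have h5 := Int.le_ceil ((2 : ℝ) ^ p * R + n)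
  have h6 := mul_le_mul_of_nonneg_left (neg_abs_le (x j)) h0.le
  have h7 := mul_le_mul_of_nonneg_left (le_abs_self (x j)) h0.le
  simp only [idx]
  constructor
  · refine Int.le_floor.2 ?_
    push_cast
    linarith
  · refine Int.floor_le_iff.2 ?_
    push_cast
    linarith

/-! ### Decay of the martingale differences -/

/-- The decay rate of martingale differences of tame functions at scale `p`. -/
def rate (n : ℕ) (p : ℤ) : ℝ := if 0 ≤ p then 2 ^ (-p) else (2 ^ p) ^ n

/-- A radius outside which martingale differences at scale `p` vanish. -/
def radius (n : ℕ) (R : ℝ) (p : ℤ) : ℝ := (R + n) * if 0 ≤ p then 1 else 2 ^ (-p)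

lemma rate_nonneg (n : ℕ) (p : ℤ) : 0 ≤ rate n p := by unfold rate; positivity

/-- Dominates the martingale differences of tame functions at scale `p`. -/
def profile (n : ℕ) (C R : ℝ) (p : ℤ) : E n → ℝ :=
  (Metric.closedBall 0 (radius n R p)).indicator fun _ => C * rate n p

lemma profile_nonneg {n : ℕ} {C : ℝ} (hC : 0 ≤ C) (R : ℝ) (p : ℤ) (x : E n) :
    0 ≤ profile n C R p x :=
  Set.indicator_nonneg (fun _ _ => mul_nonneg hC (rate_nonneg n p)) x

/-- The constant in the decay estimate for the martingale differences. -/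
def decayConst (n : ℕ) (β κ R : ℝ) : ℝ :=
  β / κ * (2 * n + volume.real (Metric.closedBall (0 : E n) R) * (2 ^ n + 1))

lemma IsAccretive.decayConst_nonneg (hb : IsAccretive b β κ) (R : ℝ) :
    0 ≤ decayConst n β κ R := by
  have := hb.pos_left
  have := hb.pos
  unfold decayConst
  positivity

/-- For `p ≥ 0` both expectations are compared with `h`; for `p < 0` each is bounded by the mass of
`h`, the one at scale `p + 1` contributing the factor `2 ^ n`. Linearity of the bound in `M` is
essential, since it allows the estimate to be applied again in the other variable. -/
lemma norm_mdiff_le (hb : IsAccretive b β κ) (hR : 0 ≤ R) (hh : IsTame M R h) (ω : GridParam n)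
    (p : ℤ) (x : E n) :
    ‖mdiff b ω p h x‖ ≤ M * profile n (decayConst n β κ R) R p x := by
  have hβ := hb.pos_left
  have hκ := hb.pos
  have hM := hh.nonneg
  have hV : 0 ≤ volume.real (Metric.closedBall (0 : E n) R) := measureReal_nonneg
  by_cases h0 : mdiff b ω p h x = 0
  · rw [h0, norm_zero]
    exact mul_nonneg hM (profile_nonneg (hb.decayConst_nonneg R) R p x)
  have h1 := norm_le_of_mdiff_ne_zero hh.supp h0
  rw [profile, Set.indicator_of_mem]
  · by_cases hp : 0 ≤ p
    · have h2 := norm_expect_sub_le hb hh ω p x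
      have h3 := norm_expect_sub_le hb hh ω (p + 1) x
      have h4 : (2 : ℝ) ^ (-(p + 1)) ≤ 2 ^ (-p) := by
        gcongr
        · exact one_le_two
        · omega
      have h5 : M * (β / κ * n * 2 ^ (-(p + 1))) ≤ M * (β / κ * n * 2 ^ (-p)) := by gcongr
      have h6 : mdiff b ω p h x = (expect b ω (p + 1) h x - h x) - (expect b ω p h x - h x) := by
        simp [mdiff]
      rw [h6, rate, if_pos hp, decayConst]
      calc _ ≤ M * (β / κ * n * 2 ^ (-p)) + M * (β / κ * n * 2 ^ (-p)) :=
            (norm_sub_le _ _).trans (add_le_add (h3.trans h5) h2)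
        _ = M * (β / κ * (2 * n + 0) * 2 ^ (-p)) := by ring
        _ ≤ _ := by gcongr; positivity
    · have h2 := norm_expect_le hb hh ω p x
      have h3 := norm_expect_le hb hh ω (p + 1) x
      rw [rate, if_neg hp, decayConst]
      calc _ ≤ _ := (norm_sub_le _ _).trans (add_le_add h3 h2)
        _ = M * (β / κ * (0 + volume.real (Metric.closedBall (0 : E n) R) * (2 ^ n + 1)) *
            (2 ^ p) ^ n) := by
          rw [zpow_add₀ two_ne_zero, zpow_one, mul_pow]; ring
        _ ≤ _ := by gcongr; positivity
  · rw [mem_closedBall_zero_iff, radius]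
    refine h1.trans ?_
    by_cases hp : 0 ≤ p
    · rw [if_pos hp, mul_one]
      have : (2 : ℝ) ^ (-p) ≤ 1 := zpow_le_one_of_nonpos₀ one_le_two (by omega)
      have := mul_le_mul_of_nonneg_left this (Nat.cast_nonneg (α := ℝ) n)
      linarith
    · rw [if_neg hp, add_mul]
      have : (1 : ℝ) ≤ 2 ^ (-p) := one_le_zpow₀ one_le_two (by omega)
      have := mul_le_mul_of_nonneg_left this hR
      linarith

lemma memLp_profile (n : ℕ) (C R : ℝ) (p : ℤ) : MemLp (profile n C R p) 2 volume :=
  memLp_indicator_const 2 Metric.isClosed_closedBall.measurableSet _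
    (Or.inr measure_closedBall_lt_top.ne)

lemma summable_geometric_natAbs {q : ℝ} (h0 : 0 ≤ q) (h1 : q < 1) :
    Summable fun p : ℤ => q ^ p.natAbs := by
  rw [summable_int_iff_summable_nat_and_neg]
  simp only [Int.natAbs_natCast, Int.natAbs_neg]
  exact ⟨summable_geometric_of_lt_one h0 h1, summable_geometric_of_lt_one h0 h1⟩

/-- The squared norm is the squared rate times a volume. Up to constants this is `2^{-2k}` for `p =
k ≥ 0`, and `2^{-2kn} * 2^{kn} = 2^{-kn}` for `p = -k < 0`. Both are at most `2^{-|p|}`, the second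
because `n > 0`. -/
lemma summable_eLpNorm_profile (hn : 0 < n) {C : ℝ} (hC : 0 ≤ C) (hR : 0 ≤ R) :
    Summable fun p => (eLpNorm (profile n C R p) 2 volume).toReal := by
  set V := (volume (Metric.ball (0 : E n) 1)).toReal with hV
  have hq : √(1 / 2 : ℝ) < 1 := by
    rw [Real.sqrt_lt' one_pos]; norm_num
  refine Summable.of_nonneg_of_le (fun _ => ENNReal.toReal_nonneg) (fun p => ?_)
    ((summable_geometric_natAbs (Real.sqrt_nonneg _) hq).mul_left (C * √((R + n) ^ n * V)))
  have hrad : 0 ≤ radius n R p := by unfold radius; positivity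
  have hrate := rate_nonneg n p
  have hcomp : rate n p ^ 2 * (if 0 ≤ p then 1 else 2 ^ (-p) : ℝ) ^ n ≤ (1 / 2) ^ p.natAbs := by
    unfold rate
    split_ifs with hp
    · obtain ⟨k, rfl⟩ := Int.eq_ofNat_of_zero_le hp
      have : (2 : ℝ) ^ (-(k : ℤ)) = (1 / 2) ^ k := by
        rw [zpow_neg, zpow_natCast, one_div, inv_pow]
      rw [this, one_pow, mul_one, Int.natAbs_natCast]
      refine pow_le_of_le_one (by positivity) (pow_le_one₀ (by norm_num) (by norm_num)) two_ne_zero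
    · obtain ⟨k, hk⟩ := Int.eq_ofNat_of_zero_le (a := -p) (by omega)
      obtain rfl : p = -k := by omega
      have h1 : (2 : ℝ) ^ (-(k : ℤ)) = (1 / 2) ^ k := by
        rw [zpow_neg, zpow_natCast, one_div, inv_pow]
      rw [neg_neg, h1, zpow_natCast, Int.natAbs_neg, Int.natAbs_natCast, sq, mul_assoc,
        ← mul_pow, ← mul_pow]
      have h2 : (1 / 2 : ℝ) ^ k * 2 ^ k = 1 := by rw [← mul_pow]; norm_num
      rw [h2, mul_one]
      exact pow_le_of_le_one (by positivity) (pow_le_one₀ (by norm_num) (by norm_num)) hn.ne'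
  rw [profile, eLpNorm_indicator_const Metric.isClosed_closedBall.measurableSet two_ne_zero
    ENNReal.ofNat_ne_top, Measure.addHaar_closedBall _ _ hrad, finrank_euclideanSpace_fin,
    ENNReal.toReal_mul, ← ENNReal.toReal_rpow, ENNReal.toReal_mul,
    ENNReal.toReal_ofReal (by positivity), ← hV, toReal_enorm,
    Real.norm_of_nonneg (mul_nonneg hC hrate), ENNReal.toReal_ofNat, ← Real.sqrt_eq_rpow, mul_assoc,
    mul_assoc]
  refine mul_le_mul_of_nonneg_left ?_ hC
  rw [← Real.sqrt_sq hrate, ← Real.sqrt_mul (sq_nonneg _)]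
  have h2 : √(1 / 2 : ℝ) ^ p.natAbs = √((1 / 2) ^ p.natAbs) :=
    (Real.sqrt_eq_iff_mul_self_eq (by positivity) (by positivity)).2 (by
      rw [← mul_pow, Real.mul_self_sqrt (by norm_num)]) |>.symm
  rw [h2, ← Real.sqrt_mul (by positivity)]
  refine Real.sqrt_le_sqrt ?_
  rw [radius, mul_pow]
  calc _ = (rate n p ^ 2 * (if 0 ≤ p then 1 else 2 ^ (-p) : ℝ) ^ n) * ((R + n) ^ n * V) := by ring
    _ ≤ (1 / 2) ^ p.natAbs * ((R + n) ^ n * V) := by gcongr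
    _ = _ := by ring

/-! ### Pointwise convergence of the telescoping sums -/

lemma sum_mdiff (b : E n → ℂ) (ω : GridParam n) (h : E n → ℂ) (x : E n) (N : ℕ) :
    ∑ p ∈ Finset.Ico (-N : ℤ) N, mdiff b ω p h x = expect b ω N h x - expect b ω (-N) h x := by
  induction N with
  | zero => simp
  | succ N ih =>
    have h1 : Finset.Ico (-((N + 1 : ℕ) : ℤ)) ((N + 1 : ℕ) : ℤ) =
        insert (-((N + 1 : ℕ) : ℤ)) (insert (N : ℤ) (Finset.Ico (-N : ℤ) N)) := by
      ext i
      simp only [Finset.mem_Ico, Finset.mem_insert]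
      push_cast
      omega
    rw [h1, Finset.sum_insert, Finset.sum_insert, ih]
    · have h2 : -((N + 1 : ℕ) : ℤ) + 1 = -N := by push_cast; ring
      simp only [mdiff, h2]
      push_cast
      ring
    · simp
    · simp only [Finset.mem_Ico, Finset.mem_insert]
      push_cast
      omega

-- The sum telescopes. The fine end tends to `h x` by the Lipschitz bound, and the coarse end tends
-- to `0` because the support is bounded and `n > 0`.
open Filter Topology in
lemma tendsto_sum_mdiff (hn : 0 < n) (hb : IsAccretive b β κ) (hh : IsTame M R h)
    (ω : GridParam n) (x : E n) :
    Tendsto (fun N : ℕ => ∑ p ∈ Finset.Ico (-N : ℤ) N, mdiff b ω p h x) atTop (𝓝 (h x)) := by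
  simp only [sum_mdiff]
  have hpow : Tendsto (fun N : ℕ => (2 : ℝ) ^ (-(N : ℤ))) atTop (𝓝 0) := by
    simp only [zpow_neg, zpow_natCast, ← inv_pow]
    exact tendsto_pow_atTop_nhds_zero_of_lt_one (by norm_num) (by norm_num)
  have h1 : Tendsto (fun N : ℕ => expect b ω N h x) atTop (𝓝 (h x)) := by
    rw [tendsto_iff_norm_sub_tendsto_zero]
    refine squeeze_zero (fun _ => norm_nonneg _) (fun N => norm_expect_sub_le hb hh ω N x) ?_
    simpa using (hpow.const_mul (β / κ * n)).const_mul M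
  have h2 : Tendsto (fun N : ℕ => expect b ω (-N) h x) atTop (𝓝 0) := by
    rw [tendsto_zero_iff_norm_tendsto_zero]
    refine squeeze_zero (fun _ => norm_nonneg _) (fun N => norm_expect_le hb hh ω (-N) x) ?_
    have h3 := hpow.pow n
    rw [zero_pow hn.ne'] at h3
    simpa using (h3.const_mul (β / κ * volume.real (Metric.closedBall (0 : E n) R))).const_mul M
  simpa using h1.sub h2

end OneVariable

section Regularity

open Filter Topology

variable {n : ℕ} {b : E n → ℂ} {β κ : ℝ}

/-! ### Continuity in the grid -/

/-- `x` is not on the boundary of a cube of scale `p`. -/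
def IsGeneric (ω : GridParam n) (p : ℤ) (x : E n) : Prop :=
  ∀ (j : Fin n) (m : ℤ), 2 ^ p * (x j - gridShift ω p j) ≠ m

lemma ae_isGeneric (ω : GridParam n) (p : ℤ) : ∀ᵐ x, IsGeneric ω p x := by
  unfold IsGeneric
  refine ae_all_iff.2 fun j => ae_all_iff.2 fun m => ?_
  have h0 : (2 : ℝ) ^ p ≠ 0 := by positivity
  have h1 : {x : E n | ¬ 2 ^ p * (x j - gridShift ω p j) ≠ m} =
      WithLp.ofLp ⁻¹' {y : Fin n → ℝ | y j = (m : ℝ) / 2 ^ p + gridShift ω p j} := by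
    ext x
    simp only [Set.mem_ofPred_eq, Set.mem_preimage, not_not]
    rw [← sub_eq_iff_eq_add, eq_div_iff h0, mul_comm]
  rw [ae_iff, h1, (PiLp.volume_preserving_ofLp (Fin n)).measure_preimage, volume_pi]
  · exact Measure.pi_hyperplane _ j _
  · exact (measurableSet_eq_fun (measurable_pi_apply j) measurable_const).nullMeasurableSet

lemma eventually_floor_eq {t : ℝ} (h : ∀ m : ℤ, t ≠ m) : ∀ᶠ s in 𝓝 t, ⌊s⌋ = ⌊t⌋ := by
  have h1 : Set.Ioo (⌊t⌋ : ℝ) (⌊t⌋ + 1) ∈ 𝓝 t :=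
    Ioo_mem_nhds (lt_of_le_of_ne (Int.floor_le t) (h _).symm) (Int.lt_floor_add_one t)
  filter_upwards [h1] with s hs
  exact Int.floor_eq_iff.2 ⟨hs.1.le, hs.2⟩

/-- Away from the integers the floor function is locally constant, so the label of the cube
containing `x` is stable under small changes of the grid. -/
lemma IsGeneric.eventually_idx_eq {ω : GridParam n} {p : ℤ} {x : E n} (h : IsGeneric ω p x) :
    ∀ᶠ ω' in 𝓝 ω, idx ω' p x = idx ω p x := by
  have h1 : ∀ j, ∀ᶠ ω' in 𝓝 ω, idx ω' p x j = idx ω p x j := by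
    intro j
    have hc : Continuous fun ω' : GridParam n => (2 : ℝ) ^ p * (x j - gridShift ω' p j) := by
      have h2 : Continuous fun ω' : GridParam n => gridShift ω' p j :=
        (continuous_apply j).comp ((PiLp.continuous_ofLp 2 _).comp (continuous_gridShift p))
      exact continuous_const.mul (continuous_const.sub h2)
    exact (hc.tendsto ω).eventually (eventually_floor_eq (h j))
  filter_upwards [eventually_all.2 h1] with ω' hω'
  exact funext hω'

/-- A bound for the norm on the cube with label `I`, for all grids. -/
lemma exists_gridCube_subset (I : CubeLabel n) :
    ∃ r : ℝ, ∀ ω : GridParam n, gridCube ω I ⊆ Metric.closedBall 0 r := by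
  set t : ℝ := ∑ j, |side I * (I.2 j : ℝ)| + 2 * side I with ht
  have hs := side_pos I
  have ht0 : 0 ≤ t := by positivity
  refine ⟨n * t, fun ω x hx => ?_⟩
  rw [mem_closedBall_zero_iff]
  refine norm_le_of_coord_le ht0 fun j => ?_
  rw [gridCube_eq_cube] at hx
  have h1 := hx j
  have h2 := gridShift_nonneg ω I.1 j
  have h3 : gridShift ω I.1 j ≤ side I := gridShift_le ω I.1 j
  have h4 : |side I * (I.2 j : ℝ)| ≤ ∑ j, |side I * (I.2 j : ℝ)| :=
    Finset.single_le_sum (f := fun j => |side I * (I.2 j : ℝ)|) (fun _ _ => abs_nonneg _)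
      (Finset.mem_univ j)
  have h5 := neg_abs_le (side I * (I.2 j : ℝ))
  have h6 := le_abs_self (side I * (I.2 j : ℝ))
  simp only at h1
  rw [abs_le]
  constructor <;> linarith

/-- The indicators of the moving cubes converge off the boundary of the limit cube, a null set. All
cubes with the given label lie in one ball, which provides the dominating function. -/
lemma tendsto_setIntegral_gridCube {ι : Type*} {l : Filter ι} [l.IsCountablyGenerated]
    {ω : ι → GridParam n} {ω₀ : GridParam n} (hω : Tendsto ω l (𝓝 ω₀)) (I : CubeLabel n)
    {g : ι → E n → ℂ} {g₀ : E n → ℂ} {G : ℝ} (hg : ∀ a, AEStronglyMeasurable (g a) volume)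
    (hG : ∀ a, ∀ᵐ x, ‖g a x‖ ≤ G) (hlim : ∀ x, Tendsto (fun a => g a x) l (𝓝 (g₀ x))) :
    Tendsto (fun a => ∫ x in gridCube (ω a) I, g a x) l (𝓝 (∫ x in gridCube ω₀ I, g₀ x)) := by
  obtain ⟨r, hr⟩ := exists_gridCube_subset I
  simp only [← integral_indicator (measurableSet_gridCube _ I)]
  refine tendsto_integral_filter_of_dominated_convergence
    ((Metric.closedBall (0 : E n) r).indicator fun _ => G) ?_ ?_ ?_ ?_
  · exact Eventually.of_forall fun a => (hg a).indicator (measurableSet_gridCube _ I)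
  · refine Eventually.of_forall fun a => (hG a).mono fun x hx => ?_
    by_cases hxI : x ∈ gridCube (ω a) I
    · rw [Set.indicator_of_mem hxI, Set.indicator_of_mem (hr _ hxI)]
      exact hx
    · rw [Set.indicator_of_notMem hxI, norm_zero]
      exact Set.indicator_nonneg (fun _ _ => (norm_nonneg _).trans hx) x
  · exact (integrable_indicator_iff Metric.isClosed_closedBall.measurableSet).2
      (integrableOn_const measure_closedBall_lt_top.ne)
  · filter_upwards [ae_isGeneric ω₀ I.1] with x hx
    have h1 : ∀ᶠ a in l, (x ∈ gridCube (ω a) I ↔ x ∈ gridCube ω₀ I) := by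
      filter_upwards [hω.eventually hx.eventually_idx_eq] with a ha
      obtain ⟨p, k⟩ := I
      rw [mem_gridCube_iff, mem_gridCube_iff, ha]
    by_cases hxI : x ∈ gridCube ω₀ I
    · rw [Set.indicator_of_mem hxI]
      refine (hlim x).congr' ?_
      filter_upwards [h1] with a ha
      rw [Set.indicator_of_mem (ha.2 hxI)]
    · rw [Set.indicator_of_notMem hxI]
      refine tendsto_const_nhds.congr' ?_
      filter_upwards [h1] with a ha
      rw [Set.indicator_of_notMem (fun h => hxI (ha.1 h))]

/-- The function is allowed to vary along with the grid: in two variables the expectation is applied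
to a difference that moves with the other grid. -/
lemma tendsto_expect (hb : IsAccretive b β κ) {ι : Type*} {l : Filter ι} [l.IsCountablyGenerated]
    {ω : ι → GridParam n} {ω₀ : GridParam n} (hω : Tendsto ω l (𝓝 ω₀)) (p : ℤ)
    {h : ι → E n → ℂ} {h₀ : E n → ℂ} {M : ℝ} (hc : ∀ a, Continuous (h a))
    (hM : ∀ a x, ‖h a x‖ ≤ M) (hlim : ∀ x, Tendsto (fun a => h a x) l (𝓝 (h₀ x)))
    {x : E n} (hx : IsGeneric ω₀ p x) :
    Tendsto (fun a => expect b (ω a) p (h a) x) l (𝓝 (expect b ω₀ p h₀ x)) := by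
  have h1 : (fun a => expect b (ω a) p (h a) x) =ᶠ[l] fun a =>
      (∫ y in gridCube (ω a) (p, idx ω₀ p x), h a y * b y) /
        ∫ y in gridCube (ω a) (p, idx ω₀ p x), b y := by
    filter_upwards [hω.eventually hx.eventually_idx_eq] with a ha
    rw [expect_eq, ha]
  rw [expect_eq]
  refine Tendsto.congr' h1.symm (Tendsto.div ?_ ?_ (hb.integral_ne_zero ω₀ _))
  · refine tendsto_setIntegral_gridCube hω _ (G := M * β)
      (fun a => (hc a).aestronglyMeasurable.mul hb.meas)
      (fun a => hb.bound.mono fun y hy => ?_) (fun y => (hlim y).mul_const _)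
    rw [norm_mul]
    exact mul_le_mul (hM a y) hy (norm_nonneg _) ((norm_nonneg _).trans (hM a y))
  · exact tendsto_setIntegral_gridCube hω _ (fun _ => hb.meas) (fun _ => hb.bound)
      (fun y => tendsto_const_nhds)

lemma tendsto_mdiff (hb : IsAccretive b β κ) {ι : Type*} {l : Filter ι} [l.IsCountablyGenerated]
    {ω : ι → GridParam n} {ω₀ : GridParam n} (hω : Tendsto ω l (𝓝 ω₀)) (p : ℤ)
    {h : ι → E n → ℂ} {h₀ : E n → ℂ} {M : ℝ} (hc : ∀ a, Continuous (h a))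
    (hM : ∀ a x, ‖h a x‖ ≤ M) (hlim : ∀ x, Tendsto (fun a => h a x) l (𝓝 (h₀ x)))
    {x : E n} (hx : IsGeneric ω₀ p x) (hx' : IsGeneric ω₀ (p + 1) x) :
    Tendsto (fun a => mdiff b (ω a) p (h a) x) l (𝓝 (mdiff b ω₀ p h₀ x)) :=
  (tendsto_expect hb hω (p + 1) hc hM hlim hx').sub (tendsto_expect hb hω p hc hM hlim hx)

/-! ### Joint measurability -/

lemma measurable_idx (ω : GridParam n) (p : ℤ) : Measurable (idx ω p) := by
  refine measurable_pi_lambda _ fun j => Int.measurable_floor.comp ?_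
  fun_prop

lemma measurable_idx_comp {Z : Type*} [MeasurableSpace Z] (ω : GridParam n) (p : ℤ)
    {c : (Fin n → ℤ) → Z → ℂ} (hc : ∀ k, Measurable (c k)) :
    Measurable fun z : E n × Z => c (idx ω p z.1) z.2 := by
  have h1 : Measurable fun w : (Fin n → ℤ) × Z => c w.1 w.2 :=
    measurable_from_prod_countable_right hc
  exact h1.comp (((measurable_idx ω p).comp measurable_fst).prodMk measurable_snd)

lemma measurable_expect (hb : IsAccretive b β κ) {Z : Type*} [MeasurableSpace Z]
    {F : E n → Z → ℂ} (hF : Measurable (Function.uncurry F)) (ω : GridParam n) (p : ℤ) :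
    Measurable fun z : E n × Z => expect b ω p (fun t => F t z.2) z.1 := by
  simp only [expect_eq]
  have h0 : ∀ k, Measurable fun w : Z => ∫ y in gridCube ω (p, k), F y w * b y := by
    intro k
    -- Since `b` is only almost everywhere measurable, a measurable representative is needed for
    -- measurability of the parametrised integral.
    have h2 : (fun w : Z => ∫ y in gridCube ω (p, k), F y w * b y) =
        fun w => ∫ y in gridCube ω (p, k), F y w * hb.meas.mk b y := by
      ext w
      refine integral_congr_ae ?_
      filter_upwards [ae_restrict_of_ae hb.meas.ae_eq_mk] with y hy
      rw [hy]
    rw [h2]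
    refine (StronglyMeasurable.integral_prod_left (f := fun y w => F y w * hb.meas.mk b y)
      ?_).measurable
    exact (hF.mul (hb.meas.stronglyMeasurable_mk.measurable.comp measurable_fst)).stronglyMeasurable
  exact measurable_idx_comp ω p (c := fun k w => (∫ y in gridCube ω (p, k), F y w * b y) /
    ∫ y in gridCube ω (p, k), b y) fun k => (h0 k).div_const _

lemma measurable_mdiff (hb : IsAccretive b β κ) {Z : Type*} [MeasurableSpace Z]
    {F : E n → Z → ℂ} (hF : Measurable (Function.uncurry F)) (ω : GridParam n) (p : ℤ) :
    Measurable fun z : E n × Z => mdiff b ω p (fun t => F t z.2) z.1 :=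
  (measurable_expect hb hF ω (p + 1)).sub (measurable_expect hb hF ω p)

end Regularity

section SquareIntegrable

open Filter Topology

variable {n m : ℕ}

/-! ### Square integrable functions of two variables -/

lemma toL2_of_memLp {F : E n × E m → ℂ} (hF : MemLp F 2 volume) : toL2 F = hF.toLp F := by
  simp [toL2, hF]

lemma coeFn_toL2 {F : E n × E m → ℂ} (hF : MemLp F 2 volume) :
    (toL2 F : E n × E m → ℂ) =ᵐ[volume] F := by
  rw [toL2_of_memLp hF]
  exact hF.coeFn_toLp

lemma norm_toL2 {F : E n × E m → ℂ} (hF : MemLp F 2 volume) :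
    ‖toL2 F‖ = (eLpNorm F 2 volume).toReal := by
  rw [toL2_of_memLp hF, Lp.norm_toLp]

lemma toL2_sum_smul {ι : Type*} (s : Finset ι) (c : ι → ℂ) {F : ι → E n × E m → ℂ}
    (hF : ∀ i ∈ s, MemLp (F i) 2 volume) :
    toL2 (fun z => ∑ i ∈ s, c i * F i z) = ∑ i ∈ s, c i • toL2 (F i) := by
  classical
  have hmem : ∀ t ⊆ s, MemLp (fun z => ∑ i ∈ t, c i * F i z) 2 volume := fun t ht =>
    memLp_finsetSum t fun i hi => (hF i (ht hi)).const_mul (c i)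
  have key : ∀ t ⊆ s, toL2 (fun z => ∑ i ∈ t, c i * F i z) = ∑ i ∈ t, c i • toL2 (F i) := by
    intro t
    induction t using Finset.induction_on with
    | empty =>
      intro _
      have h0 : MemLp (0 : E n × E m → ℂ) 2 volume := MemLp.zero
      simp only [Finset.sum_empty]
      change toL2 (0 : E n × E m → ℂ) = 0
      rw [toL2_of_memLp h0, MemLp.toLp_zero]
    | insert i t hi ih =>
      intro hts
      rw [Finset.insert_subset_iff] at hts
      have h1 := hmem (insert i t) (Finset.insert_subset hts.1 hts.2)
      have h2 := (hF i hts.1).const_mul (c i)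
      have h3 := hmem t hts.2
      rw [Finset.sum_insert hi, ← ih hts.2, toL2_of_memLp h1, toL2_of_memLp h3,
        toL2_of_memLp (hF i hts.1), ← MemLp.toLp_const_smul, ← MemLp.toLp_add]
      congr 1
      ext z
      simp [Finset.sum_insert hi]
  exact key s subset_rfl

lemma eLpNorm_tensor_eq {W₁ : E n → ℝ} {W₂ : E m → ℝ} (h₁ : AEStronglyMeasurable W₁ volume)
    (h₂ : AEStronglyMeasurable W₂ volume) :
    eLpNorm (fun z : E n × E m => W₁ z.1 * W₂ z.2) 2 volume =
      eLpNorm W₁ 2 volume * eLpNorm W₂ 2 volume := by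
  simp only [eLpNorm_eq_lintegral_rpow_enorm_toReal two_ne_zero ENNReal.ofNat_ne_top, enorm_mul]
  rw [← ENNReal.mul_rpow_of_nonneg _ _ (by positivity), Measure.volume_eq_prod,
    ← lintegral_prod_mul (h₁.enorm.pow_const _) (h₂.enorm.pow_const _)]
  congr 2
  ext z
  rw [ENNReal.mul_rpow_of_nonneg _ _ (by positivity)]

lemma memLp_of_le_tensor {W₁ : E n → ℝ} {W₂ : E m → ℝ} (h₁ : MemLp W₁ 2 volume)
    (h₂ : MemLp W₂ 2 volume) {F : E n × E m → ℂ} (hF : AEStronglyMeasurable F volume) {c : ℝ}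
    (hc : 0 ≤ c) (hle : ∀ᵐ z : E n × E m, ‖F z‖ ≤ c * ‖W₁ z.1 * W₂ z.2‖) :
    MemLp F 2 volume ∧
      ‖toL2 F‖ ≤ c * ((eLpNorm W₁ 2 volume).toReal * (eLpNorm W₂ 2 volume).toReal) := by
  have h3 := eLpNorm_le_mul_eLpNorm_of_ae_le_mul hle 2
  rw [eLpNorm_tensor_eq h₁.1 h₂.1] at h3
  have h4 : ENNReal.ofReal c * (eLpNorm W₁ 2 volume * eLpNorm W₂ 2 volume) < ∞ :=
    ENNReal.mul_lt_top ENNReal.ofReal_lt_top (ENNReal.mul_lt_top h₁.2 h₂.2)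
  have h5 : MemLp F 2 volume := ⟨hF, h3.trans_lt h4⟩
  refine ⟨h5, ?_⟩
  rw [norm_toL2 h5]
  calc _ ≤ _ := ENNReal.toReal_mono h4.ne h3
    _ = _ := by rw [ENNReal.toReal_mul, ENNReal.toReal_mul, ENNReal.toReal_ofReal hc]

/-- Dominated convergence in `L²`. -/
lemma continuous_toL2 {A : Type*} [TopologicalSpace A] [FirstCountableTopology A]
    {F : A → E n × E m → ℂ} {H : E n × E m → ℝ} (hF : ∀ w, MemLp (F w) 2 volume)
    (hH : MemLp H 2 volume) (hle : ∀ w, ∀ᵐ z, ‖F w z‖ ≤ ‖H z‖)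
    (hlim : ∀ w₀, ∀ᵐ z, Tendsto (fun w => F w z) (𝓝 w₀) (𝓝 (F w₀ z))) :
    Continuous fun w => toL2 (F w) := by
  refine continuous_iff_continuousAt.2 fun w₀ => ?_
  unfold ContinuousAt
  simp only [toL2_of_memLp (hF _)]
  rw [Lp.tendsto_Lp_iff_tendsto_eLpNorm'']
  simp only [eLpNorm_eq_lintegral_rpow_enorm_toReal two_ne_zero ENNReal.ofNat_ne_top,
    ENNReal.toReal_ofNat]
  have h0 : Tendsto (fun w => ∫⁻ z, ‖(F w - F w₀) z‖ₑ ^ (2 : ℝ)) (𝓝 w₀) (𝓝 0) := by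
    have h1 : Tendsto (fun w => ∫⁻ z, ‖(F w - F w₀) z‖ₑ ^ (2 : ℝ)) (𝓝 w₀)
        (𝓝 (∫⁻ _ : E n × E m, (0 : ℝ≥0∞))) := by
      refine tendsto_lintegral_filter_of_dominated_convergence'
        (fun z => (‖H z‖ₑ + ‖H z‖ₑ) ^ (2 : ℝ)) ?_ ?_ ?_ ?_
      · exact Eventually.of_forall fun w =>
          (((hF w).1.sub (hF w₀).1).enorm).pow_const _
      · refine Eventually.of_forall fun w => ?_
        filter_upwards [hle w, hle w₀] with z hz hz'
        refine ENNReal.rpow_le_rpow ?_ (by norm_num)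
        refine (enorm_sub_le).trans (add_le_add ?_ ?_)
        · exact enorm_le_iff_norm_le.2 hz
        · exact enorm_le_iff_norm_le.2 hz'
      · have h2 : MemLp (fun z => ‖H z‖ + ‖H z‖) 2 volume := hH.norm.add hH.norm
        have h3 := (lintegral_rpow_enorm_lt_top_of_eLpNorm_lt_top two_ne_zero
          ENNReal.ofNat_ne_top h2.2).ne
        convert h3 using 3 with z
        rw [ENNReal.toReal_ofNat, Real.enorm_of_nonneg (r := ‖H z‖ + ‖H z‖) (by positivity),
          ENNReal.ofReal_add (norm_nonneg _) (norm_nonneg _), ofReal_norm]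
      · filter_upwards [hlim w₀] with z hz
        have h2 := ((hz.sub_const (F w₀ z)).enorm).ennrpow_const (2 : ℝ)
        simpa using h2
    simpa using h1
  have h4 := h0.ennrpow_const (1 / 2 : ℝ)
  simpa using h4

/-- A summable series in `L²` whose partial sums converge pointwise. -/
lemma hasSum_toL2 {F : ℤ → E n × E m → ℂ} {F₀ : E n × E m → ℂ} (hF : ∀ p, MemLp (F p) 2 volume)
    (hs : Summable fun p => toL2 (F p))
    (hlim : ∀ z, Tendsto (fun N : ℕ => ∑ p ∈ Finset.Ico (-N : ℤ) N, F p z) atTop (𝓝 (F₀ z))) :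
    MemLp F₀ 2 volume ∧ HasSum (fun p => toL2 (F p)) (toL2 F₀) := by
  obtain ⟨S, hS⟩ := hs
  have hfin : Tendsto (fun N : ℕ => Finset.Ico (-N : ℤ) N) atTop atTop := by
    refine tendsto_atTop_finset_of_monotone (fun a b hab => ?_) fun p => ?_
    · exact Finset.Ico_subset_Ico (by omega) (by omega)
    · exact ⟨p.natAbs + 1, by simp only [Finset.mem_Ico]; omega⟩
  have h1 := hS.comp hfin
  -- Convergence in `L²` yields an almost everywhere convergent subsequence. Its limit has to be
  -- `F₀`, which identifies `S` and shows that `F₀` is square integrable.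
  obtain ⟨ns, hns, hae⟩ := (tendstoInMeasure_of_tendsto_Lp h1).exists_seq_tendsto_ae
  have h2 : ∀ N : ℕ, ((∑ p ∈ Finset.Ico (-N : ℤ) N, toL2 (F p) : L2 n m) : E n × E m → ℂ)
      =ᵐ[volume] fun z => ∑ p ∈ Finset.Ico (-N : ℤ) N, F p z := by
    intro N
    have h3 := toL2_sum_smul (Finset.Ico (-N : ℤ) N) (fun _ => (1 : ℂ)) (F := F) fun p _ => hF p
    simp only [one_mul, one_smul] at h3
    rw [← h3]
    exact coeFn_toL2 (memLp_finsetSum _ fun p _ => hF p)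
  have h4 : (S : E n × E m → ℂ) =ᵐ[volume] F₀ := by
    filter_upwards [hae, ae_all_iff.2 h2] with z hz hz2
    refine tendsto_nhds_unique hz ?_
    refine ((hlim z).comp hns.tendsto_atTop).congr fun i => ?_
    exact (hz2 (ns i)).symm
  have h5 : MemLp F₀ 2 volume := (memLp_congr_ae h4).1 (Lp.memLp S)
  refine ⟨h5, ?_⟩
  have h6 : toL2 F₀ = S := by
    refine Lp.ext ?_
    exact (coeFn_toL2 h5).trans h4.symm
  rw [h6]
  exact hS

end SquareIntegrable

section TwoVariables

open Filter Topology

variable {n m : ℕ}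

/-! ### Double martingale differences -/

/-- Functions of two variables that are tame in the second variable, and whose increments in the
first variable are tame in the second variable. -/
structure IsTame₂ (M R : ℝ) (f : E n × E m → ℂ) : Prop where
  right : ∀ x, IsTame M R fun y => f (x, y)
  diff : ∀ x x', IsTame (M * ‖x - x'‖) R fun y => f (x, y) - f (x', y)
  supp : ∀ x y, R < ‖x‖ → f (x, y) = 0
  meas : Measurable f
  nonneg : 0 ≤ R

/-- The delicate condition is that mixed second differences are bounded by `M ‖x - x'‖ ‖y - y'‖`. It
follows from the mean value inequality in `y` for `f (x, ·) - f (x', ·)`, since the derivative of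
`f` is Lipschitz. -/
lemma exists_isTame₂ {f : E n × E m → ℂ} (hf : ContDiff ℝ ((⊤ : ℕ∞) : WithTop ℕ∞) f)
    (hfc : HasCompactSupport f) : ∃ M R, IsTame₂ M R f := by
  obtain ⟨M₀, hM₀⟩ := hfc.exists_bound_of_continuous hf.continuous
  obtain ⟨L₀, hL₀⟩ := hf.lipschitzWith_of_hasCompactSupport hfc (by simp)
  have hf' : ContDiff ℝ 1 (fderiv ℝ f) := hf.fderiv_right (WithTop.coe_le_coe.2 le_top)
  obtain ⟨L₁, hL₁⟩ := hf'.lipschitzWith_of_hasCompactSupport (hfc.fderiv ℝ) one_ne_zero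
  obtain ⟨R, hR⟩ := hfc.isCompact.isBounded.subset_closedBall 0
  set M : ℝ := max M₀ (max L₀ L₁) with hM
  have hM0 : M₀ ≤ M := le_max_left _ _
  have hML₀ : (L₀ : ℝ) ≤ M := (le_max_left _ _).trans (le_max_right _ _)
  have hML₁ : (L₁ : ℝ) ≤ M := (le_max_right _ _).trans (le_max_right _ _)
  have hMnn : 0 ≤ M := (NNReal.coe_nonneg L₀).trans hML₀
  have hzero : ∀ z, max R 0 < ‖z‖ → f z = 0 := by
    intro z hz
    by_contra hne
    have h1 := hR (subset_tsupport f (Function.mem_support.2 hne))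
    rw [mem_closedBall_zero_iff] at h1
    exact absurd ((h1.trans (le_max_left _ _)).trans_lt hz) (lt_irrefl _)
  have hlip : ∀ z z', ‖f z - f z'‖ ≤ M * ‖z - z'‖ := fun z z' =>
    (hL₀.norm_sub_le z z').trans (mul_le_mul_of_nonneg_right hML₀ (norm_nonneg _))
  have hfst : ∀ (x x' : E n) (y : E m), ‖((x, y) : E n × E m) - (x', y)‖ = ‖x - x'‖ := by
    intro x x' y
    simp [Prod.norm_def]
  have hsnd : ∀ (x : E n) (y y' : E m), ‖((x, y) : E n × E m) - (x, y')‖ = ‖y - y'‖ := by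
    intro x y y'
    simp [Prod.norm_def]
  refine ⟨M, max R 0, fun x => ⟨fun y => (hM₀ _).trans hM0, fun y y' => ?_, fun y hy => ?_⟩,
    fun x x' => ⟨fun y => ?_, fun y y' => ?_, fun y hy => ?_⟩, fun x y hx => ?_,
    hf.continuous.measurable, le_max_right _ _⟩
  · rw [← hsnd x]
    exact hlip _ _
  · exact hzero _ (hy.trans_le (le_max_right _ _))
  · rw [← hfst x x' y]
    exact hlip _ _
  · have hd : ∀ t ∈ (Set.univ : Set (E m)), HasFDerivWithinAt (fun y => f (x, y) - f (x', y))
        ((fderiv ℝ f (x, t)).comp (ContinuousLinearMap.inr ℝ (E n) (E m)) -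
          (fderiv ℝ f (x', t)).comp (ContinuousLinearMap.inr ℝ (E n) (E m))) Set.univ t := by
      intro t _
      have hdiff := hf.differentiable (by simp)
      exact (((hdiff (x, t)).hasFDerivAt.comp t (hasFDerivAt_prodMk_right x t)).sub
        ((hdiff (x', t)).hasFDerivAt.comp t (hasFDerivAt_prodMk_right x' t))).hasFDerivWithinAt
    refine Convex.norm_image_sub_le_of_norm_hasFDerivWithin_le hd (fun t _ => ?_) convex_univ
      (Set.mem_univ y') (Set.mem_univ y)
    rw [← ContinuousLinearMap.sub_comp]
    calc _ ≤ ‖fderiv ℝ f (x, t) - fderiv ℝ f (x', t)‖ *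
          ‖ContinuousLinearMap.inr ℝ (E n) (E m)‖ := ContinuousLinearMap.opNorm_comp_le _ _
      _ ≤ ‖fderiv ℝ f (x, t) - fderiv ℝ f (x', t)‖ * 1 :=
          mul_le_mul_of_nonneg_left (ContinuousLinearMap.norm_inr_le_one ℝ (E n) (E m))
            (norm_nonneg _)
      _ ≤ L₁ * ‖((x, t) : E n × E m) - (x', t)‖ := by
          rw [mul_one]
          exact hL₁.norm_sub_le _ _
      _ ≤ M * ‖x - x'‖ := by
          rw [hfst]
          exact mul_le_mul_of_nonneg_right hML₁ (norm_nonneg _)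
  · rw [hzero (x, y) (hy.trans_le (le_max_right _ _)),
      hzero (x', y) (hy.trans_le (le_max_right _ _)), sub_zero]
  · exact hzero _ (hx.trans_le (le_max_left _ _))

variable {b₁ : E n → ℂ} {b₂ : E m → ℂ} {β₁ κ₁ β₂ κ₂ M R : ℝ} {f : E n × E m → ℂ}

/-- Differences of conditional expectations in the second variable. -/
def mdiff₂ (b₂ : E m → ℂ) (ω' : GridParam m) (q : ℤ) (f : E n × E m → ℂ) (z : E n × E m) : ℂ :=
  mdiff b₂ ω' q (fun t => f (z.1, t)) z.2

/-- Differences of conditional expectations in both variables. -/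
def mdiff₁₂ (b₁ : E n → ℂ) (b₂ : E m → ℂ) (ω : GridParam n) (ω' : GridParam m) (p q : ℤ)
    (f : E n × E m → ℂ) (z : E n × E m) : ℂ :=
  mdiff b₁ ω p (fun t => mdiff₂ b₂ ω' q f (t, z.2)) z.1

/-- The decay estimate is applied in `y` both to `f (x, ·)` and to its increments in `x`. Being
linear in the constant, it makes the result tame in `x` with the profile in `y` as a factor. -/
lemma IsTame₂.mdiff₂ (hf : IsTame₂ M R f) (hb₂ : IsAccretive b₂ β₂ κ₂) (ω' : GridParam m) (q : ℤ)
    (y : E m) : IsTame (M * profile m (decayConst m β₂ κ₂ R) R q y) R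
      fun x => mdiff₂ b₂ ω' q f (x, y) where
  bound x := norm_mdiff_le hb₂ hf.nonneg (hf.right x) ω' q y
  lip x x' := by
    have h := norm_mdiff_le hb₂ hf.nonneg (hf.diff x x') ω' q y
    rw [mdiff_sub hb₂ (hf.right x) (hf.right x')] at h
    refine h.trans (le_of_eq ?_)
    ring
  supp x hx := by
    have h : (fun t => f (x, t)) = fun _ => 0 := funext fun t => hf.supp x t hx
    simp only [BiParam.mdiff₂, h, mdiff_zero]

lemma IsTame₂.norm_mdiff₁₂_le (hf : IsTame₂ M R f) (hb₁ : IsAccretive b₁ β₁ κ₁)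
    (hb₂ : IsAccretive b₂ β₂ κ₂) (ω : GridParam n) (ω' : GridParam m) (p q : ℤ) (z : E n × E m) :
    ‖mdiff₁₂ b₁ b₂ ω ω' p q f z‖ ≤ M * (profile n (decayConst n β₁ κ₁ R) R p z.1 *
      profile m (decayConst m β₂ κ₂ R) R q z.2) := by
  refine (norm_mdiff_le hb₁ hf.nonneg (hf.mdiff₂ hb₂ ω' q z.2) ω p z.1).trans (le_of_eq ?_)
  ring

lemma IsTame₂.measurable_mdiff₂ (hf : IsTame₂ M R f) (hb₂ : IsAccretive b₂ β₂ κ₂)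
    (ω' : GridParam m) (q : ℤ) : Measurable (BiParam.mdiff₂ b₂ ω' q f) := by
  have h1 : Measurable (Function.uncurry fun (t : E m) (x : E n) => f (x, t)) :=
    hf.meas.comp measurable_swap
  have h2 := measurable_mdiff hb₂ h1 ω' q
  have h3 := h2.comp (measurable_swap (α := E n) (β := E m))
  exact h3

lemma IsTame₂.measurable_mdiff₁₂ (hf : IsTame₂ M R f) (hb₁ : IsAccretive b₁ β₁ κ₁)
    (hb₂ : IsAccretive b₂ β₂ κ₂) (ω : GridParam n) (ω' : GridParam m) (p q : ℤ) :
    Measurable (mdiff₁₂ b₁ b₂ ω ω' p q f) :=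
  measurable_mdiff hb₁ (F := fun t y => BiParam.mdiff₂ b₂ ω' q f (t, y))
    (hf.measurable_mdiff₂ hb₂ ω' q) ω p

lemma delta₂_eq (b₂ : E m → ℂ) (ω' : GridParam m) (q : ℤ) (l : Fin m → ℤ) (f : E n × E m → ℂ)
    (z : E n × E m) :
    delta₂ b₂ ω' (q, l) f z = if idx ω' q z.2 = l then mdiff₂ b₂ ω' q f z else 0 :=
  delta_eq _ _ _ _ _ _

lemma doubleDelta_eq (b₁ : E n → ℂ) (b₂ : E m → ℂ) (ω : GridParam n) (ω' : GridParam m) (p q : ℤ)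
    (k : Fin n → ℤ) (l : Fin m → ℤ) (f : E n × E m → ℂ) (z : E n × E m) :
    doubleDelta b₁ b₂ ω ω' (p, k) (q, l) f z =
      if idx ω p z.1 = k ∧ idx ω' q z.2 = l then mdiff₁₂ b₁ b₂ ω ω' p q f z else 0 := by
  have h : doubleDelta b₁ b₂ ω ω' (p, k) (q, l) f z =
      if idx ω p z.1 = k then mdiff b₁ ω p (fun t => delta₂ b₂ ω' (q, l) f (t, z.2)) z.1 else 0 :=
    delta_eq _ _ _ _ _ _
  rw [h]
  simp only [delta₂_eq]
  by_cases h1 : idx ω p z.1 = k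
  · by_cases h2 : idx ω' q z.2 = l
    · simp only [h1, h2, if_true, and_self, mdiff₁₂]
    · simp only [h1, h2, if_true, if_false, and_false, mdiff_zero]
  · simp only [h1, if_false, false_and]

lemma IsTame₂.idx_mem_left (hf : IsTame₂ M R f) (hb₂ : IsAccretive b₂ β₂ κ₂) {ω : GridParam n}
    {ω' : GridParam m} {p q : ℤ} {z : E n × E m} (h : mdiff₁₂ b₁ b₂ ω ω' p q f z ≠ 0) :
    idx ω p z.1 ∈ posSet n R p :=
  idx_mem_posSet (norm_le_of_mdiff_ne_zero (hf.mdiff₂ hb₂ ω' q z.2).supp h)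

lemma IsTame₂.mdiff₂_eq_zero (hf : IsTame₂ M R f) {ω' : GridParam m} {q : ℤ} {z : E n × E m}
    (h : idx ω' q z.2 ∉ posSet m R q) (x : E n) : BiParam.mdiff₂ b₂ ω' q f (x, z.2) = 0 := by
  by_contra hne
  exact h (idx_mem_posSet (norm_le_of_mdiff_ne_zero (hf.right x).supp hne))

lemma IsTame₂.idx_mem_right (hf : IsTame₂ M R f) {ω : GridParam n}
    {ω' : GridParam m} {p q : ℤ} {z : E n × E m} (h : mdiff₁₂ b₁ b₂ ω ω' p q f z ≠ 0) :
    idx ω' q z.2 ∈ posSet m R q := by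
  by_contra hne
  refine h ?_
  simp only [mdiff₁₂, hf.mdiff₂_eq_zero hne, mdiff_zero]

lemma IsTame₂.doubleDelta_eq_zero (hf : IsTame₂ M R f) (hb₂ : IsAccretive b₂ β₂ κ₂)
    {ω : GridParam n} {ω' : GridParam m} {p q : ℤ} {k : Fin n → ℤ} {l : Fin m → ℤ}
    (h : k ∉ posSet n R p ∨ l ∉ posSet m R q) :
    doubleDelta b₁ b₂ ω ω' (p, k) (q, l) f = fun _ => 0 := by
  ext z
  rw [doubleDelta_eq]
  split_ifs with h1
  · by_contra hne
    rcases h with h | h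
    · exact h (h1.1 ▸ hf.idx_mem_left hb₂ hne)
    · exact h (h1.2 ▸ hf.idx_mem_right hne)
  · rfl

/-- Weighted sums over the cubes of given scales. -/
lemma sum_doubleDelta (b₁ : E n → ℂ) (b₂ : E m → ℂ) (ω : GridParam n) (ω' : GridParam m) (p q : ℤ)
    (K : Finset (Fin n → ℤ)) (L : Finset (Fin m → ℤ)) (c : (Fin n → ℤ) × (Fin m → ℤ) → ℂ)
    (z : E n × E m) :
    ∑ i ∈ K ×ˢ L, c i * doubleDelta b₁ b₂ ω ω' (p, i.1) (q, i.2) f z =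
      if idx ω p z.1 ∈ K ∧ idx ω' q z.2 ∈ L then
        c (idx ω p z.1, idx ω' q z.2) * mdiff₁₂ b₁ b₂ ω ω' p q f z else 0 := by
  have h : ∀ i ∈ K ×ˢ L, c i * doubleDelta b₁ b₂ ω ω' (p, i.1) (q, i.2) f z =
      if i = (idx ω p z.1, idx ω' q z.2) then
        c (idx ω p z.1, idx ω' q z.2) * mdiff₁₂ b₁ b₂ ω ω' p q f z else 0 := by
    rintro ⟨k, l⟩ _
    rw [doubleDelta_eq]
    by_cases h1 : idx ω p z.1 = k ∧ idx ω' q z.2 = l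
    · simp only [h1, and_self, if_true]
    · rw [if_neg h1, if_neg, mul_zero]
      rintro h2
      simp only [Prod.mk.injEq] at h2
      exact h1 ⟨h2.1.symm, h2.2.symm⟩
  rw [Finset.sum_congr rfl h, Finset.sum_ite_eq']
  simp only [Finset.mem_product]

/-! ### Their classes in `L²` -/

/-- Bound for the norm in `L²` of the functions of `profile`. -/
def profileNorm (n : ℕ) (C R : ℝ) (p : ℤ) : ℝ := (eLpNorm (profile n C R p) 2 volume).toReal

lemma ae_norm_tensor_le (hb₁ : IsAccretive b₁ β₁ κ₁) (hb₂ : IsAccretive b₂ β₂ κ₂) :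
    ∀ᵐ z, ‖tensor b₁ b₂ z‖ ≤ β₁ * β₂ := by
  rw [Measure.volume_eq_prod]
  have h1 := (Measure.quasiMeasurePreserving_fst (μ := (volume : Measure (E n)))
    (ν := (volume : Measure (E m)))).ae hb₁.bound
  have h2 := (Measure.quasiMeasurePreserving_snd (μ := (volume : Measure (E n)))
    (ν := (volume : Measure (E m)))).ae hb₂.bound
  filter_upwards [h1, h2] with z hz1 hz2
  rw [tensor, norm_mul]
  exact mul_le_mul hz1 hz2 (norm_nonneg _) hb₁.pos_left.le

lemma aestronglyMeasurable_tensor (hb₁ : IsAccretive b₁ β₁ κ₁) (hb₂ : IsAccretive b₂ β₂ κ₂) :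
    AEStronglyMeasurable (tensor b₁ b₂) volume := by
  rw [Measure.volume_eq_prod]
  exact hb₁.meas.comp_fst.mul hb₂.meas.comp_snd

lemma IsTame₂.nonneg_left (hf : IsTame₂ M R f) : 0 ≤ M := (hf.right 0).nonneg

lemma IsTame₂.ae_norm_le (hf : IsTame₂ M R f) (hb₁ : IsAccretive b₁ β₁ κ₁)
    (hb₂ : IsAccretive b₂ β₂ κ₂) (ω : GridParam n) (ω' : GridParam m) (p q : ℤ)
    {F : E n × E m → ℂ} (hle : ∀ z, ‖F z‖ ≤ ‖mdiff₁₂ b₁ b₂ ω ω' p q f z‖) :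
    ∀ᵐ z : E n × E m, ‖tensor b₁ b₂ z * F z‖ ≤ β₁ * β₂ * M *
      ‖profile n (decayConst n β₁ κ₁ R) R p z.1 * profile m (decayConst m β₂ κ₂ R) R q z.2‖ := by
  filter_upwards [ae_norm_tensor_le hb₁ hb₂] with z hz
  have hβ := mul_pos hb₁.pos_left hb₂.pos_left
  rw [norm_mul, mul_assoc]
  refine mul_le_mul hz ?_ (norm_nonneg _) hβ.le
  refine ((hle z).trans (hf.norm_mdiff₁₂_le hb₁ hb₂ ω ω' p q z)).trans ?_
  exact mul_le_mul_of_nonneg_left (le_abs_self _) hf.nonneg_left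

/-- Functions dominated by double martingale differences. -/
lemma IsTame₂.memLp_of_le (hf : IsTame₂ M R f) (hb₁ : IsAccretive b₁ β₁ κ₁)
    (hb₂ : IsAccretive b₂ β₂ κ₂) (ω : GridParam n) (ω' : GridParam m) (p q : ℤ)
    {F : E n × E m → ℂ} (hF : Measurable F) (hle : ∀ z, ‖F z‖ ≤ ‖mdiff₁₂ b₁ b₂ ω ω' p q f z‖) :
    MemLp (fun z => tensor b₁ b₂ z * F z) 2 volume ∧
      ‖toL2 fun z => tensor b₁ b₂ z * F z‖ ≤ β₁ * β₂ * M *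
        (profileNorm n (decayConst n β₁ κ₁ R) R p * profileNorm m (decayConst m β₂ κ₂ R) R q) :=
  memLp_of_le_tensor (memLp_profile n _ R p) (memLp_profile m _ R q)
    ((aestronglyMeasurable_tensor hb₁ hb₂).mul hF.aestronglyMeasurable)
    (mul_nonneg (mul_pos hb₁.pos_left hb₂.pos_left).le hf.nonneg_left)
    (hf.ae_norm_le hb₁ hb₂ ω ω' p q hle)

lemma measurableSet_idx_eq (ω : GridParam n) (p : ℤ) (k : Fin n → ℤ) :
    MeasurableSet {z : E n × E m | idx ω p z.1 = k} :=
  ((measurable_idx ω p).comp measurable_fst) (measurableSet_singleton k)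

lemma measurableSet_idx_eq' (ω' : GridParam m) (q : ℤ) (l : Fin m → ℤ) :
    MeasurableSet {z : E n × E m | idx ω' q z.2 = l} :=
  ((measurable_idx ω' q).comp measurable_snd) (measurableSet_singleton l)

lemma IsTame₂.measurable_doubleDelta (hf : IsTame₂ M R f) (hb₁ : IsAccretive b₁ β₁ κ₁)
    (hb₂ : IsAccretive b₂ β₂ κ₂) (ω : GridParam n) (ω' : GridParam m) (p q : ℤ)
    (k : Fin n → ℤ) (l : Fin m → ℤ) :
    Measurable (doubleDelta b₁ b₂ ω ω' (p, k) (q, l) f) := by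
  have h : doubleDelta b₁ b₂ ω ω' (p, k) (q, l) f = fun z =>
      if idx ω p z.1 = k ∧ idx ω' q z.2 = l then mdiff₁₂ b₁ b₂ ω ω' p q f z else 0 :=
    funext fun z => doubleDelta_eq _ _ _ _ _ _ _ _ _ _
  rw [h]
  exact Measurable.ite ((measurableSet_idx_eq ω p k).inter (measurableSet_idx_eq' ω' q l))
    (hf.measurable_mdiff₁₂ hb₁ hb₂ ω ω' p q) measurable_const

lemma norm_doubleDelta_le (ω : GridParam n) (ω' : GridParam m) (p q : ℤ)
    (k : Fin n → ℤ) (l : Fin m → ℤ) (z : E n × E m) :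
    ‖doubleDelta b₁ b₂ ω ω' (p, k) (q, l) f z‖ ≤ ‖mdiff₁₂ b₁ b₂ ω ω' p q f z‖ := by
  rw [doubleDelta_eq]
  split_ifs
  · exact le_rfl
  · rw [norm_zero]
    exact norm_nonneg _

/-- The class of `b Δ_I Δ_J f` in `L²`. -/
def doubleTerm (b₁ : E n → ℂ) (b₂ : E m → ℂ) (f : E n × E m → ℂ) (ω : GridParam n)
    (ω' : GridParam m) (p : ℤ) (k : Fin n → ℤ) (q : ℤ) (l : Fin m → ℤ) : L2 n m :=
  toL2 fun z => tensor b₁ b₂ z * doubleDelta b₁ b₂ ω ω' (p, k) (q, l) f z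

/-- The class of `b Δ_J f` in `L²`. -/
def singleTerm (b₁ : E n → ℂ) (b₂ : E m → ℂ) (f : E n × E m → ℂ)
    (ω' : GridParam m) (q : ℤ) (l : Fin m → ℤ) : L2 n m :=
  toL2 fun z => tensor b₁ b₂ z * delta₂ b₂ ω' (q, l) f z

lemma IsTame₂.memLp_doubleDelta (hf : IsTame₂ M R f) (hb₁ : IsAccretive b₁ β₁ κ₁)
    (hb₂ : IsAccretive b₂ β₂ κ₂) (ω : GridParam n) (ω' : GridParam m) (p q : ℤ)
    (k : Fin n → ℤ) (l : Fin m → ℤ) :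
    MemLp (fun z => tensor b₁ b₂ z * doubleDelta b₁ b₂ ω ω' (p, k) (q, l) f z) 2 volume :=
  (hf.memLp_of_le hb₁ hb₂ ω ω' p q (hf.measurable_doubleDelta hb₁ hb₂ ω ω' p q k l)
    (norm_doubleDelta_le ω ω' p q k l)).1

lemma IsTame₂.memLp_doubleDelta' (hf : IsTame₂ M R f) (hb₁ : IsAccretive b₁ β₁ κ₁)
    (hb₂ : IsAccretive b₂ β₂ κ₂) (ω : GridParam n) (ω' : GridParam m) (p q : ℤ)
    (k : Fin n → ℤ) (l : Fin m → ℤ) :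
    MemLp (doubleDelta b₁ b₂ ω ω' (p, k) (q, l) f) 2 volume := by
  refine (memLp_of_le_tensor (memLp_profile n (decayConst n β₁ κ₁ R) R p)
    (memLp_profile m (decayConst m β₂ κ₂ R) R q)
    (hf.measurable_doubleDelta hb₁ hb₂ ω ω' p q k l).aestronglyMeasurable hf.nonneg_left
    (ae_of_all _ fun z => ?_)).1
  refine ((norm_doubleDelta_le ω ω' p q k l z).trans
    (hf.norm_mdiff₁₂_le hb₁ hb₂ ω ω' p q z)).trans ?_
  exact mul_le_mul_of_nonneg_left (le_abs_self _) hf.nonneg_left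

/-- The bound for weighted sums over the cubes of two given scales. -/
def scaleBound (n m : ℕ) (β₁ κ₁ β₂ κ₂ M R : ℝ) (p q : ℤ) : ℝ :=
  β₁ * β₂ * M *
    (profileNorm n (decayConst n β₁ κ₁ R) R p * profileNorm m (decayConst m β₂ κ₂ R) R q)

/-- At fixed scales the rectangles are disjoint, so the weights act as pointwise multiplication by a
function of modulus at most `1`. The bound does not depend on the number of cubes. -/
lemma IsTame₂.norm_sum_doubleTerm_le (hf : IsTame₂ M R f) (hb₁ : IsAccretive b₁ β₁ κ₁)
    (hb₂ : IsAccretive b₂ β₂ κ₂) (ω : GridParam n) (ω' : GridParam m) (p q : ℤ)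
    (K : Finset (Fin n → ℤ)) (L : Finset (Fin m → ℤ)) (c : (Fin n → ℤ) × (Fin m → ℤ) → ℂ)
    (hc : ∀ i, ‖c i‖ ≤ 1) :
    ‖∑ i ∈ K ×ˢ L, c i • doubleTerm b₁ b₂ f ω ω' p i.1 q i.2‖ ≤
      scaleBound n m β₁ κ₁ β₂ κ₂ M R p q := by
  have h1 := toL2_sum_smul (K ×ˢ L) c
    (F := fun i z => tensor b₁ b₂ z * doubleDelta b₁ b₂ ω ω' (p, i.1) (q, i.2) f z)
    fun i _ => hf.memLp_doubleDelta hb₁ hb₂ ω ω' p q i.1 i.2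
  have h2 : (fun z => ∑ i ∈ K ×ˢ L,
      c i * (tensor b₁ b₂ z * doubleDelta b₁ b₂ ω ω' (p, i.1) (q, i.2) f z)) =
      fun z => tensor b₁ b₂ z *
        ∑ i ∈ K ×ˢ L, c i * doubleDelta b₁ b₂ ω ω' (p, i.1) (q, i.2) f z := by
    ext z
    rw [Finset.mul_sum]
    exact Finset.sum_congr rfl fun i _ => by ring
  rw [h2] at h1
  unfold doubleTerm
  rw [← h1]
  refine (hf.memLp_of_le hb₁ hb₂ ω ω' p q ?_ fun z => ?_).2
  · exact Finset.measurable_fun_sum _ fun i _ =>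
      (hf.measurable_doubleDelta hb₁ hb₂ ω ω' p q i.1 i.2).const_mul _
  · rw [sum_doubleDelta]
    split_ifs
    · rw [norm_mul]
      exact mul_le_of_le_one_left (norm_nonneg _) (hc _)
    · rw [norm_zero]
      exact norm_nonneg _

lemma IsTame₂.doubleTerm_eq_zero (hf : IsTame₂ M R f) (hb₂ : IsAccretive b₂ β₂ κ₂)
    {ω : GridParam n} {ω' : GridParam m} {p q : ℤ} {k : Fin n → ℤ} {l : Fin m → ℤ}
    (h : k ∉ posSet n R p ∨ l ∉ posSet m R q) : doubleTerm b₁ b₂ f ω ω' p k q l = 0 := by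
  have h0 : MemLp (0 : E n × E m → ℂ) 2 volume := MemLp.zero
  simp only [doubleTerm, hf.doubleDelta_eq_zero hb₂ h, mul_zero]
  change toL2 (0 : E n × E m → ℂ) = 0
  rw [toL2_of_memLp h0, MemLp.toLp_zero]

/-- The dependence on the grids is continuous. -/
lemma IsTame₂.continuous_doubleTerm (hf : IsTame₂ M R f) (hb₁ : IsAccretive b₁ β₁ κ₁)
    (hb₂ : IsAccretive b₂ β₂ κ₂) (p q : ℤ) (k : Fin n → ℤ) (l : Fin m → ℤ) :
    Continuous fun w : GridParam n × GridParam m => doubleTerm b₁ b₂ f w.1 w.2 p k q l := by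
  have hH : MemLp (fun z : E n × E m => β₁ * β₂ * M *
      (profile n (decayConst n β₁ κ₁ R) R p z.1 * profile m (decayConst m β₂ κ₂ R) R q z.2))
      2 volume := by
    have h1 := memLp_profile n (decayConst n β₁ κ₁ R) R p
    have h2 := memLp_profile m (decayConst m β₂ κ₂ R) R q
    refine MemLp.const_mul ⟨?_, ?_⟩ _
    · rw [Measure.volume_eq_prod]
      exact h1.1.comp_fst.mul h2.1.comp_snd
    · rw [eLpNorm_tensor_eq h1.1 h2.1]
      exact ENNReal.mul_lt_top h1.2 h2.2
  refine continuous_toL2 (F := fun (w : GridParam n × GridParam m) z =>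
    tensor b₁ b₂ z * doubleDelta b₁ b₂ w.1 w.2 (p, k) (q, l) f z)
    (fun w => hf.memLp_doubleDelta hb₁ hb₂ w.1 w.2 p q k l) hH (fun w => ?_) fun w₀ => ?_
  · filter_upwards [hf.ae_norm_le hb₁ hb₂ w.1 w.2 p q (norm_doubleDelta_le w.1 w.2 p q k l)]
      with z hz
    refine hz.trans ?_
    rw [norm_mul (β₁ * β₂ * M)]
    exact mul_le_mul_of_nonneg_right (le_abs_self _) (norm_nonneg _)
  · rw [Measure.volume_eq_prod]
    have hfst := Measure.quasiMeasurePreserving_fst (μ := (volume : Measure (E n)))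
      (ν := (volume : Measure (E m)))
    have hsnd := Measure.quasiMeasurePreserving_snd (μ := (volume : Measure (E n)))
      (ν := (volume : Measure (E m)))
    filter_upwards [hfst.ae (ae_isGeneric w₀.1 p), hfst.ae (ae_isGeneric w₀.1 (p + 1)),
      hsnd.ae (ae_isGeneric w₀.2 q), hsnd.ae (ae_isGeneric w₀.2 (q + 1))] with z h1 h1' h2 h2'
    refine Tendsto.const_mul _ ?_
    have hw1 : Tendsto (fun w : GridParam n × GridParam m => w.1) (𝓝 w₀) (𝓝 w₀.1) :=
      continuous_fst.tendsto w₀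
    have hw2 : Tendsto (fun w : GridParam n × GridParam m => w.2) (𝓝 w₀) (𝓝 w₀.2) :=
      continuous_snd.tendsto w₀
    -- Only `z.2` has to be generic here, so the convergence holds for every `x`, as the outer
    -- difference requires.
    have h3 : ∀ x, Tendsto (fun w : GridParam n × GridParam m =>
        BiParam.mdiff₂ b₂ w.2 q f (x, z.2)) (𝓝 w₀) (𝓝 (BiParam.mdiff₂ b₂ w₀.2 q f (x, z.2))) :=
      fun x => tendsto_mdiff hb₂ hw2 q (h := fun _ t => f (x, t)) (M := M)
        (fun _ => (hf.right x).continuous) (fun _ => (hf.right x).bound)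
        (fun _ => tendsto_const_nhds) h2 h2'
    have h4 : Tendsto (fun w : GridParam n × GridParam m => mdiff₁₂ b₁ b₂ w.1 w.2 p q f z)
        (𝓝 w₀) (𝓝 (mdiff₁₂ b₁ b₂ w₀.1 w₀.2 p q f z)) :=
      tendsto_mdiff hb₁ hw1 p (h := fun w t => BiParam.mdiff₂ b₂ w.2 q f (t, z.2))
        (fun w => (hf.mdiff₂ hb₂ w.2 q z.2).continuous)
        (fun w => (hf.mdiff₂ hb₂ w.2 q z.2).bound) h3 h1 h1'
    simp only [doubleDelta_eq]
    have h5 : ∀ᶠ w in 𝓝 w₀, (idx w.1 p z.1 = k ∧ idx w.2 q z.2 = l) ↔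
        (idx w₀.1 p z.1 = k ∧ idx w₀.2 q z.2 = l) := by
      filter_upwards [hw1.eventually h1.eventually_idx_eq, hw2.eventually h2.eventually_idx_eq]
        with w hwa hwb
      rw [hwa, hwb]
    by_cases h6 : idx w₀.1 p z.1 = k ∧ idx w₀.2 q z.2 = l
    · rw [if_pos h6]
      refine h4.congr' ?_
      filter_upwards [h5] with w hw
      rw [if_pos (hw.2 h6)]
    · rw [if_neg h6]
      refine tendsto_const_nhds.congr' ?_
      filter_upwards [h5] with w hw
      rw [if_neg fun h => h6 (hw.1 h)]

end TwoVariables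

section Decompositions

open Filter Topology

variable {n m : ℕ} {b₁ : E n → ℂ} {b₂ : E m → ℂ} {β₁ κ₁ β₂ κ₂ M R : ℝ} {f : E n × E m → ℂ}

/-! ### Decompositions along the grids -/

lemma summable_profileNorm (hn : 0 < n) (hb₁ : IsAccretive b₁ β₁ κ₁) (hR : 0 ≤ R) :
    Summable fun p => profileNorm n (decayConst n β₁ κ₁ R) R p :=
  summable_eLpNorm_profile hn (hb₁.decayConst_nonneg R) hR

lemma IsTame₂.norm_sum_doubleTerm_le' (hf : IsTame₂ M R f) (hb₁ : IsAccretive b₁ β₁ κ₁)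
    (hb₂ : IsAccretive b₂ β₂ κ₂) (ω : GridParam n) (ω' : GridParam m) (p q : ℤ)
    (l : Fin m → ℤ) (K : Finset (Fin n → ℤ)) (ε : (Fin n → ℤ) → ℂ) (hε : ∀ k, ‖ε k‖ ≤ 1) :
    ‖∑ k ∈ K, ε k • doubleTerm b₁ b₂ f ω ω' p k q l‖ ≤
      scaleBound n m β₁ κ₁ β₂ κ₂ M R p q := by
  have h := hf.norm_sum_doubleTerm_le hb₁ hb₂ ω ω' p q K {l} (fun i => ε i.1) fun i => hε i.1
  simpa only [Finset.sum_product, Finset.sum_singleton] using h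

/-- Pointwise, the sums telescope in the first variable to the difference in the second variable
alone. Combined with summable norms, this gives the sum in `L²` through `hasSum_toL2`. -/
lemma IsTame₂.hasSum_doubleTerm (hn : 0 < n) (hf : IsTame₂ M R f) (hb₁ : IsAccretive b₁ β₁ κ₁)
    (hb₂ : IsAccretive b₂ β₂ κ₂) (ω : GridParam n) (ω' : GridParam m) (q : ℤ) (l : Fin m → ℤ) :
    MemLp (fun z => tensor b₁ b₂ z * delta₂ b₂ ω' (q, l) f z) 2 volume ∧
    HasSum (fun p => ∑ k ∈ posSet n R p, doubleTerm b₁ b₂ f ω ω' p k q l)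
      (singleTerm b₁ b₂ f ω' q l) := by
  have hmem := fun p => memLp_finsetSum (posSet n R p) fun k _ =>
    hf.memLp_doubleDelta hb₁ hb₂ ω ω' p q k l
  have hsum : ∀ p, toL2 (fun z => ∑ k ∈ posSet n R p,
      tensor b₁ b₂ z * doubleDelta b₁ b₂ ω ω' (p, k) (q, l) f z) =
      ∑ k ∈ posSet n R p, doubleTerm b₁ b₂ f ω ω' p k q l := by
    intro p
    have h := toL2_sum_smul (posSet n R p) (fun _ => (1 : ℂ))
      (F := fun k z => tensor b₁ b₂ z * doubleDelta b₁ b₂ ω ω' (p, k) (q, l) f z)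
      fun k _ => hf.memLp_doubleDelta hb₁ hb₂ ω ω' p q k l
    simpa only [one_mul, one_smul, doubleTerm] using h
  have hval : ∀ p z, ∑ k ∈ posSet n R p,
      tensor b₁ b₂ z * doubleDelta b₁ b₂ ω ω' (p, k) (q, l) f z =
      (tensor b₁ b₂ z * if idx ω' q z.2 = l then 1 else 0) * mdiff₁₂ b₁ b₂ ω ω' p q f z := by
    intro p z
    have h := sum_doubleDelta (f := f) b₁ b₂ ω ω' p q (posSet n R p) {l} (fun _ => 1) z
    simp only [Finset.sum_product, Finset.sum_singleton, one_mul, Finset.mem_singleton] at h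
    rw [← Finset.mul_sum, h, mul_assoc]
    congr 1
    by_cases h0 : mdiff₁₂ b₁ b₂ ω ω' p q f z = 0
    · simp [h0]
    · simp [hf.idx_mem_left hb₂ h0]
  have hs : Summable fun p => toL2 (fun z => ∑ k ∈ posSet n R p,
      tensor b₁ b₂ z * doubleDelta b₁ b₂ ω ω' (p, k) (q, l) f z) := by
    simp only [hsum]
    refine Summable.of_norm_bounded
      (g := fun p => scaleBound n m β₁ κ₁ β₂ κ₂ M R p q) ?_ fun p => ?_
    · exact ((summable_profileNorm hn hb₁ hf.nonneg).mul_right _).mul_left _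
    · simpa only [one_smul] using hf.norm_sum_doubleTerm_le' hb₁ hb₂ ω ω' p q l (posSet n R p)
        (fun _ => 1) (by simp)
  have h := hasSum_toL2 hmem hs (F₀ := fun z => tensor b₁ b₂ z * delta₂ b₂ ω' (q, l) f z)
    fun z => ?_
  · simpa only [hsum, singleTerm] using h
  · simp only [hval, ← Finset.mul_sum]
    have h1 := (tendsto_sum_mdiff hn hb₁ (hf.mdiff₂ hb₂ ω' q z.2) ω z.1).const_mul
      (tensor b₁ b₂ z * if idx ω' q z.2 = l then 1 else 0)
    have h2 : tensor b₁ b₂ z * delta₂ b₂ ω' (q, l) f z =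
        (tensor b₁ b₂ z * if idx ω' q z.2 = l then 1 else 0) *
          BiParam.mdiff₂ b₂ ω' q f (z.1, z.2) := by
      rw [delta₂_eq]
      split_ifs <;> simp
    rw [h2]
    exact h1

/-- With the second grid frozen, this prepares the one-parameter formula in the first variable; the
sum depends on the second grid only. -/
lemma IsTame₂.isGridDecomp_doubleTerm (hn : 0 < n) (hf : IsTame₂ M R f)
    (hb₁ : IsAccretive b₁ β₁ κ₁) (hb₂ : IsAccretive b₂ β₂ κ₂) (ω' : GridParam m) (q : ℤ)
    (l : Fin m → ℤ) :
    IsGridDecomp (posSet n R) (fun p => scaleBound n m β₁ κ₁ β₂ κ₂ M R p q)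
      (fun ω p k => doubleTerm b₁ b₂ f ω ω' p k q l) (singleTerm b₁ b₂ f ω' q l) where
  meas p k := ((hf.continuous_doubleTerm hb₁ hb₂ p q k l).comp
    (Continuous.prodMk_left ω')).stronglyMeasurable
  dep p k ω ω₂ h := by
    have h1 : idx ω p = idx ω₂ p := idx_congr (gridShift_congr h)
    simp only [doubleTerm, doubleDelta_eq, mdiff₁₂, mdiff_congr h, h1]
  bound ω p ε hε := hf.norm_sum_doubleTerm_le' hb₁ hb₂ ω ω' p q l (posSet n R p) ε hε
  summable := ((summable_profileNorm hn hb₁ hf.nonneg).mul_right _).mul_left _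
  hasSum ω := (hf.hasSum_doubleTerm hn hb₁ hb₂ ω ω' q l).2

lemma IsTame₂.norm_sum_singleTerm_le (hn : 0 < n) (hf : IsTame₂ M R f)
    (hb₁ : IsAccretive b₁ β₁ κ₁) (hb₂ : IsAccretive b₂ β₂ κ₂) (ω' : GridParam m) (q : ℤ)
    (L : Finset (Fin m → ℤ)) (ε : (Fin m → ℤ) → ℂ) (hε : ∀ l, ‖ε l‖ ≤ 1) :
    ‖∑ l ∈ L, ε l • singleTerm b₁ b₂ f ω' q l‖ ≤
      ∑' p, scaleBound n m β₁ κ₁ β₂ κ₂ M R p q := by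
  -- A single difference involves no grid in the first variable, so any such grid can be used to
  -- expand it; here all digits are `0`.
  have h1 : HasSum (fun p => ∑ l ∈ L, ε l • ∑ k ∈ posSet n R p,
      doubleTerm b₁ b₂ f (fun _ _ => 0) ω' p k q l) (∑ l ∈ L, ε l • singleTerm b₁ b₂ f ω' q l) :=
    hasSum_sum fun l _ => (hf.hasSum_doubleTerm hn hb₁ hb₂ (fun _ _ => 0) ω' q l).2.const_smul (ε l)
  have h2 : Summable fun p => scaleBound n m β₁ κ₁ β₂ κ₂ M R p q :=
    ((summable_profileNorm hn hb₁ hf.nonneg).mul_right _).mul_left _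
  refine h1.norm_le_of_bounded h2.hasSum fun p => ?_
  have h3 := hf.norm_sum_doubleTerm_le hb₁ hb₂ (fun _ _ => 0) ω' p q (posSet n R p) L
    (fun i => ε i.2) fun i => hε i.2
  rw [Finset.sum_product_right] at h3
  simpa only [Finset.smul_sum] using h3

lemma IsTame₂.hasSum_singleTerm (hn : 0 < n) (hm : 0 < m) (hf : IsTame₂ M R f)
    (hb₁ : IsAccretive b₁ β₁ κ₁) (hb₂ : IsAccretive b₂ β₂ κ₂) (ω' : GridParam m) :
    MemLp (fun z => tensor b₁ b₂ z * f z) 2 volume ∧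
    HasSum (fun q => ∑ l ∈ posSet m R q, singleTerm b₁ b₂ f ω' q l)
      (toL2 fun z => tensor b₁ b₂ z * f z) := by
  have hmem1 := fun q l => (hf.hasSum_doubleTerm hn hb₁ hb₂ (fun _ _ => 0) ω' q l).1
  have hmem := fun q => memLp_finsetSum (posSet m R q) fun l _ => hmem1 q l
  have hsum : ∀ q, toL2 (fun z => ∑ l ∈ posSet m R q,
      tensor b₁ b₂ z * delta₂ b₂ ω' (q, l) f z) =
      ∑ l ∈ posSet m R q, singleTerm b₁ b₂ f ω' q l := by
    intro q
    have h := toL2_sum_smul (posSet m R q) (fun _ => (1 : ℂ))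
      (F := fun l z => tensor b₁ b₂ z * delta₂ b₂ ω' (q, l) f z) fun l _ => hmem1 q l
    simpa only [one_mul, one_smul, singleTerm] using h
  have hval : ∀ q z, ∑ l ∈ posSet m R q, tensor b₁ b₂ z * delta₂ b₂ ω' (q, l) f z =
      tensor b₁ b₂ z * BiParam.mdiff₂ b₂ ω' q f z := by
    intro q z
    rw [← Finset.mul_sum]
    congr 1
    simp only [delta₂_eq, Finset.sum_ite_eq]
    split_ifs with h
    · rfl
    · exact (hf.mdiff₂_eq_zero h z.1).symm
  have hs : Summable fun q => toL2 (fun z => ∑ l ∈ posSet m R q,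
      tensor b₁ b₂ z * delta₂ b₂ ω' (q, l) f z) := by
    simp only [hsum]
    refine Summable.of_norm_bounded
      (g := fun q => ∑' p, scaleBound n m β₁ κ₁ β₂ κ₂ M R p q) ?_ fun q => ?_
    · simp only [scaleBound, tsum_mul_left, tsum_mul_right]
      exact ((summable_profileNorm hm hb₂ hf.nonneg).mul_left _).mul_left _
    · simpa only [one_smul] using hf.norm_sum_singleTerm_le hn hb₁ hb₂ ω' q (posSet m R q)
        (fun _ => 1) (by simp)
  have h := hasSum_toL2 hmem hs (F₀ := fun z => tensor b₁ b₂ z * f z) fun z => ?_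
  · simpa only [hsum] using h
  · simp only [hval, ← Finset.mul_sum]
    exact (tendsto_sum_mdiff hm hb₂ (hf.right z.1) ω' z.2).const_mul (tensor b₁ b₂ z)

lemma IsTame₂.isGridDecomp_singleTerm (hn : 0 < n) (hm : 0 < m) (hf : IsTame₂ M R f)
    (hb₁ : IsAccretive b₁ β₁ κ₁) (hb₂ : IsAccretive b₂ β₂ κ₂) :
    IsGridDecomp (posSet m R) (fun q => ∑' p, scaleBound n m β₁ κ₁ β₂ κ₂ M R p q)
      (singleTerm b₁ b₂ f) (toL2 fun z => tensor b₁ b₂ z * f z) where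
  meas q l := by
    -- The same auxiliary expansion exhibits the term as a limit of finite sums that are continuous
    -- in the second grid.
    refine stronglyMeasurable_of_tendsto (ι := Finset ℤ) atTop
      (f := fun s ω' => ∑ p ∈ s, ∑ k ∈ posSet n R p, doubleTerm b₁ b₂ f (fun _ _ => 0) ω' p k q l)
      (fun s => ?_) ?_
    · exact Finset.stronglyMeasurable_fun_sum _ fun p _ =>
        Finset.stronglyMeasurable_fun_sum _ fun k _ =>
          ((hf.continuous_doubleTerm hb₁ hb₂ p q k l).comp
            (Continuous.prodMk_right (fun _ _ => 0))).stronglyMeasurable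
    · refine tendsto_pi_nhds.2 fun ω' => ?_
      exact (hf.hasSum_doubleTerm hn hb₁ hb₂ (fun _ _ => 0) ω' q l).2
  dep q l ω' ω₂ h := by
    have h1 : idx ω' q = idx ω₂ q := idx_congr (gridShift_congr h)
    simp only [singleTerm, delta₂_eq, BiParam.mdiff₂, mdiff_congr h, h1]
  bound ω' q ε hε := hf.norm_sum_singleTerm_le hn hb₁ hb₂ ω' q (posSet m R q) ε hε
  summable := by
    simp only [scaleBound, tsum_mul_left, tsum_mul_right]
    exact ((summable_profileNorm hm hb₂ hf.nonneg).mul_left _).mul_left _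
  hasSum ω' := (hf.hasSum_singleTerm hn hm hb₁ hb₂ ω').2

/-! ### The bilinear form -/

/-- The bilinear form `(u, v) ↦ ∫ (T u) v` on `L²`. -/
def pairing (T : L2 n m →L[ℂ] L2 n m) : L2 n m →L[ℂ] L2 n m →L[ℂ] ℂ :=
  ((ContinuousLinearMap.mul ℂ ℂ).lpPairing volume 2 2).comp T

lemma form_eq_pairing (T : L2 n m →L[ℂ] L2 n m) {b b' F G : E n × E m → ℂ}
    (hG : MemLp (fun z => b' z * G z) 2 volume) :
    form T b b' F G = pairing T (toL2 fun z => b z * F z) (toL2 fun z => b' z * G z) := by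
  unfold pairing form
  rw [ContinuousLinearMap.comp_apply, ContinuousLinearMap.lpPairing_eq_integral]
  refine integral_congr_ae ?_
  filter_upwards [coeFn_toL2 hG] with z hz
  rw [hz, ContinuousLinearMap.mul_apply']
  ring

end Decompositions

section Averaging

open Filter Topology

variable {n m : ℕ} {b₁ b₁' : E n → ℂ} {b₂ b₂' : E m → ℂ} {f g : E n × E m → ℂ}
  {β₁ κ₁ β₂ κ₂ β₁' κ₁' β₂' κ₂' M R M' R' : ℝ}

/-! ### The sum over the cubes of four scales -/

/-- The positions of the cubes of given scales that contribute to the sum. -/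
def positionSet (n m : ℕ) (R R' : ℝ) (P : Scales) : Finset (Positions n m) :=
  posSet n R P.1 ×ˢ posSet n R' P.2.1 ×ˢ posSet m R P.2.2.1 ×ˢ posSet m R' P.2.2.2

lemma summand_eq (δ : ℝ) (r : ℕ) (T : L2 n m →L[ℂ] L2 n m) (hg : IsTame₂ M' R' g)
    (hb₁' : IsAccretive b₁' β₁' κ₁') (hb₂' : IsAccretive b₂' β₂' κ₂')
    (ω : GridParam n) (ω' : GridParam m) (P : Scales) (Q : Positions n m) :
    summand δ r T b₁ b₁' b₂ b₂' f g ω ω' P Q =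
      chiGood δ r ω (small (P.1, Q.1) (P.2.1, Q.2.1)) *
        chiGood δ r ω' (small (P.2.2.1, Q.2.2.1) (P.2.2.2, Q.2.2.2)) *
        pairing T (doubleTerm b₁ b₂ f ω ω' P.1 Q.1 P.2.2.1 Q.2.2.1)
          (doubleTerm b₁' b₂' g ω ω' P.2.1 Q.2.1 P.2.2.2 Q.2.2.2) := by
  unfold summand
  simp only
  rw [form_eq_pairing T (hg.memLp_doubleDelta hb₁' hb₂' ω ω' _ _ _ _)]
  rfl

lemma support_summand_subset (δ : ℝ) (r : ℕ) (T : L2 n m →L[ℂ] L2 n m)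
    (hf : IsTame₂ M R f) (hg : IsTame₂ M' R' g) (hb₂ : IsAccretive b₂ β₂ κ₂)
    (hb₁' : IsAccretive b₁' β₁' κ₁') (hb₂' : IsAccretive b₂' β₂' κ₂')
    (ω : GridParam n) (ω' : GridParam m) (P : Scales) :
    Function.support (summand δ r T b₁ b₁' b₂ b₂' f g ω ω' P) ⊆ positionSet n m R R' P := by
  intro Q hQ
  rw [Function.mem_support, summand_eq δ r T hg hb₁' hb₂'] at hQ
  have h1 := right_ne_zero_of_mul hQ
  simp only [positionSet, Finset.coe_product, Set.mem_prod, Finset.mem_coe]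
  by_contra hcon
  refine h1 ?_
  by_cases h2 : Q.1 ∉ posSet n R P.1 ∨ Q.2.2.1 ∉ posSet m R P.2.2.1
  · rw [hf.doubleTerm_eq_zero hb₂ h2, map_zero, _root_.zero_apply]
  · have h3 : Q.2.1 ∉ posSet n R' P.2.1 ∨ Q.2.2.2 ∉ posSet m R' P.2.2.2 := by tauto
    rw [hg.doubleTerm_eq_zero hb₂' h3, map_zero]

lemma scaleSum_eq (δ : ℝ) (r : ℕ) (T : L2 n m →L[ℂ] L2 n m)
    (hf : IsTame₂ M R f) (hg : IsTame₂ M' R' g) (hb₂ : IsAccretive b₂ β₂ κ₂)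
    (hb₁' : IsAccretive b₁' β₁' κ₁') (hb₂' : IsAccretive b₂' β₂' κ₂')
    (ω : GridParam n) (ω' : GridParam m) (P : Scales) :
    scaleSum δ r T b₁ b₁' b₂ b₂' f g ω ω' P =
      ∑ k₁ ∈ posSet n R P.1, ∑ k₂ ∈ posSet n R' P.2.1,
        ∑ l₁ ∈ posSet m R P.2.2.1, ∑ l₂ ∈ posSet m R' P.2.2.2,
        chiGood δ r ω (small (P.1, k₁) (P.2.1, k₂)) *
        chiGood δ r ω' (small (P.2.2.1, l₁) (P.2.2.2, l₂)) *
        pairing T (doubleTerm b₁ b₂ f ω ω' P.1 k₁ P.2.2.1 l₁)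
          (doubleTerm b₁' b₂' g ω ω' P.2.1 k₂ P.2.2.2 l₂) := by
  unfold scaleSum
  rw [tsum_eq_sum (s := positionSet n m R R' P) fun Q hQ => ?_]
  · simp only [positionSet, Finset.sum_product, summand_eq δ r T hg hb₁' hb₂']
  · by_contra hne
    exact hQ (support_summand_subset δ r T hf hg hb₂ hb₁' hb₂' ω ω' P hne)

lemma sum_comm_four {ι ι' : Type*} (A B : Finset ι) (C D : Finset ι') (F : ι → ι → ι' → ι' → ℂ) :
    ∑ a ∈ A, ∑ b ∈ B, ∑ c ∈ C, ∑ d ∈ D, F a b c d =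
      ∑ c ∈ C, ∑ d ∈ D, ∑ a ∈ A, ∑ b ∈ B, F a b c d := by
  calc _ = ∑ x ∈ A ×ˢ B, ∑ y ∈ C ×ˢ D, F x.1 x.2 y.1 y.2 := by simp only [Finset.sum_product]
    _ = ∑ y ∈ C ×ˢ D, ∑ x ∈ A ×ˢ B, F x.1 x.2 y.1 y.2 := Finset.sum_comm
    _ = _ := by simp only [Finset.sum_product]

/-- The sum over four scales is a sum of one-parameter sums. -/
lemma scaleSum_eq_sum_goodPairSum (δ : ℝ) (r : ℕ) (T : L2 n m →L[ℂ] L2 n m)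
    (hf : IsTame₂ M R f) (hg : IsTame₂ M' R' g) (hb₂ : IsAccretive b₂ β₂ κ₂)
    (hb₁' : IsAccretive b₁' β₁' κ₁') (hb₂' : IsAccretive b₂' β₂' κ₂')
    (ω : GridParam n) (ω' : GridParam m) (p₁ p₂ q₁ q₂ : ℤ) :
    scaleSum δ r T b₁ b₁' b₂ b₂' f g ω ω' (p₁, p₂, q₁, q₂) =
      ∑ l₁ ∈ posSet m R q₁, ∑ l₂ ∈ posSet m R' q₂, chiGood δ r ω' (small (q₁, l₁) (q₂, l₂)) *
        goodPairSum δ r (pairing T) (posSet n R) (posSet n R')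
          (fun ω p k => doubleTerm b₁ b₂ f ω ω' p k q₁ l₁)
          (fun ω p k => doubleTerm b₁' b₂' g ω ω' p k q₂ l₂) ω (p₁, p₂) := by
  rw [scaleSum_eq δ r T hf hg hb₂ hb₁' hb₂']
  simp only [goodPairSum, Finset.mul_sum]
  rw [sum_comm_four]
  refine Finset.sum_congr rfl fun _ _ => Finset.sum_congr rfl fun _ _ =>
    Finset.sum_congr rfl fun _ _ => Finset.sum_congr rfl fun _ _ => ?_
  ring

/-- The weight of the first cube in the condition that the smaller cube is good. -/
def weightLeft (δ : ℝ) (r : ℕ) (ω : GridParam n) (p₁ p₂ : ℤ) (k : Fin n → ℤ) : ℂ :=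
  if p₂ ≤ p₁ then chiGood δ r ω (p₁, k) else 1

/-- The weight of the second cube in the condition that the smaller cube is good. -/
def weightRight (δ : ℝ) (r : ℕ) (ω : GridParam n) (p₁ p₂ : ℤ) (k : Fin n → ℤ) : ℂ :=
  if p₂ ≤ p₁ then 1 else chiGood δ r ω (p₂, k)

/-- Which cube is smaller depends on the scales alone, so the condition is a weight on one of the
two cubes. This turns the fourfold sum into the pairing of two weighted sums, to which the bounds by
disjointness apply. -/
lemma chiGood_small (δ : ℝ) (r : ℕ) (ω : GridParam n) (p₁ p₂ : ℤ) (k₁ k₂ : Fin n → ℤ) :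
    chiGood δ r ω (small (p₁, k₁) (p₂, k₂)) =
      weightLeft δ r ω p₁ p₂ k₁ * weightRight δ r ω p₁ p₂ k₂ := by
  unfold small weightLeft weightRight
  split_ifs <;> simp

lemma norm_weightLeft_le (δ : ℝ) (r : ℕ) (ω : GridParam n) (p₁ p₂ : ℤ) (k : Fin n → ℤ) :
    ‖weightLeft δ r ω p₁ p₂ k‖ ≤ 1 := by
  unfold weightLeft
  split_ifs
  · exact norm_chiGood_le _ _ _ _
  · simp

lemma norm_weightRight_le (δ : ℝ) (r : ℕ) (ω : GridParam n) (p₁ p₂ : ℤ) (k : Fin n → ℤ) :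
    ‖weightRight δ r ω p₁ p₂ k‖ ≤ 1 := by
  unfold weightRight
  split_ifs
  · simp
  · exact norm_chiGood_le _ _ _ _

lemma norm_scaleSum_le (δ : ℝ) (r : ℕ) (T : L2 n m →L[ℂ] L2 n m)
    (hf : IsTame₂ M R f) (hg : IsTame₂ M' R' g)
    (hb₁ : IsAccretive b₁ β₁ κ₁) (hb₂ : IsAccretive b₂ β₂ κ₂)
    (hb₁' : IsAccretive b₁' β₁' κ₁') (hb₂' : IsAccretive b₂' β₂' κ₂')
    (ω : GridParam n) (ω' : GridParam m) (P : Scales) :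
    ‖scaleSum δ r T b₁ b₁' b₂ b₂' f g ω ω' P‖ ≤ ‖pairing T‖ *
      (scaleBound n m β₁ κ₁ β₂ κ₂ M R P.1 P.2.2.1 *
        scaleBound n m β₁' κ₁' β₂' κ₂' M' R' P.2.1 P.2.2.2) := by
  have h1 : scaleSum δ r T b₁ b₁' b₂ b₂' f g ω ω' P = pairing T
      (∑ i ∈ posSet n R P.1 ×ˢ posSet m R P.2.2.1,
        (weightLeft δ r ω P.1 P.2.1 i.1 * weightLeft δ r ω' P.2.2.1 P.2.2.2 i.2) •
          doubleTerm b₁ b₂ f ω ω' P.1 i.1 P.2.2.1 i.2)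
      (∑ i ∈ posSet n R' P.2.1 ×ˢ posSet m R' P.2.2.2,
        (weightRight δ r ω P.1 P.2.1 i.1 * weightRight δ r ω' P.2.2.1 P.2.2.2 i.2) •
          doubleTerm b₁' b₂' g ω ω' P.2.1 i.1 P.2.2.2 i.2) := by
    rw [bilin_weighted_sum, scaleSum_eq δ r T hf hg hb₂ hb₁' hb₂']
    simp only [Finset.sum_product]
    refine Finset.sum_congr rfl fun k₁ _ => ?_
    simp only [chiGood_small]
    rw [Finset.sum_comm]
    refine Finset.sum_congr rfl fun l₁ _ => Finset.sum_congr rfl fun k₂ _ =>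
      Finset.sum_congr rfl fun l₂ _ => ?_
    ring
  rw [h1]
  refine norm_bilin_le _ ?_ ?_
  · refine hf.norm_sum_doubleTerm_le hb₁ hb₂ ω ω' _ _ _ _ _ fun i => ?_
    rw [norm_mul]
    exact mul_le_one₀ (norm_weightLeft_le _ _ _ _ _ _) (norm_nonneg _)
      (norm_weightLeft_le _ _ _ _ _ _)
  · refine hg.norm_sum_doubleTerm_le hb₁' hb₂' ω ω' _ _ _ _ _ fun i => ?_
    rw [norm_mul]
    exact mul_le_one₀ (norm_weightRight_le _ _ _ _ _ _) (norm_nonneg _)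
      (norm_weightRight_le _ _ _ _ _ _)

/-- The bound for the sum over four scales. -/
def scalesBound (C : ℝ) (a a' c c' : ℤ → ℝ) (P : Scales) : ℝ :=
  C * (a P.1 * (c P.2.1 * (a' P.2.2.1 * c' P.2.2.2)))

lemma summable_scalesBound (C : ℝ) {a a' c c' : ℤ → ℝ} (ha : Summable a) (ha' : Summable a')
    (hc : Summable c) (hc' : Summable c') (h0 : 0 ≤ a) (h0' : 0 ≤ a') (h1 : 0 ≤ c) (h1' : 0 ≤ c') :
    Summable (scalesBound C a a' c c') :=
  (ha.mul_of_nonneg (hc.mul_of_nonneg (ha'.mul_of_nonneg hc' h0' h1') h1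
    fun _ => mul_nonneg (h0' _) (h1' _)) h0
      fun _ => mul_nonneg (h1 _) (mul_nonneg (h0' _) (h1' _))).mul_left C

lemma profileNorm_nonneg (n : ℕ) (C R : ℝ) : 0 ≤ profileNorm n C R := fun _ =>
  ENNReal.toReal_nonneg

/-- A summable bound for the sums over four scales, uniform in the grids. -/
lemma exists_scaleSum_bound (hn : 0 < n) (hm : 0 < m) (δ : ℝ) (r : ℕ) (T : L2 n m →L[ℂ] L2 n m)
    (hf : IsTame₂ M R f) (hg : IsTame₂ M' R' g)
    (hb₁ : IsAccretive b₁ β₁ κ₁) (hb₂ : IsAccretive b₂ β₂ κ₂)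
    (hb₁' : IsAccretive b₁' β₁' κ₁') (hb₂' : IsAccretive b₂' β₂' κ₂') :
    ∃ c : Scales → ℝ, Summable c ∧
      ∀ ω ω' P, ‖scaleSum δ r T b₁ b₁' b₂ b₂' f g ω ω' P‖ ≤ c P := by
  refine ⟨_, summable_scalesBound (‖pairing T‖ * (β₁ * β₂ * M) * (β₁' * β₂' * M'))
    (summable_profileNorm hn hb₁ hf.nonneg) (summable_profileNorm hm hb₂ hf.nonneg)
    (summable_profileNorm hn hb₁' hg.nonneg) (summable_profileNorm hm hb₂' hg.nonneg)
    (profileNorm_nonneg _ _ _) (profileNorm_nonneg _ _ _) (profileNorm_nonneg _ _ _)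
    (profileNorm_nonneg _ _ _), fun ω ω' P => ?_⟩
  refine (norm_scaleSum_le δ r T hf hg hb₁ hb₂ hb₁' hb₂' ω ω' P).trans (le_of_eq ?_)
  unfold scaleBound scalesBound
  ring

lemma stronglyMeasurable_scaleSum (δ : ℝ) (r : ℕ) (T : L2 n m →L[ℂ] L2 n m)
    (hf : IsTame₂ M R f) (hg : IsTame₂ M' R' g)
    (hb₁ : IsAccretive b₁ β₁ κ₁) (hb₂ : IsAccretive b₂ β₂ κ₂)
    (hb₁' : IsAccretive b₁' β₁' κ₁') (hb₂' : IsAccretive b₂' β₂' κ₂') (P : Scales) :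
    StronglyMeasurable fun w : GridParam n × GridParam m =>
      scaleSum δ r T b₁ b₁' b₂ b₂' f g w.1 w.2 P := by
  simp only [scaleSum_eq δ r T hf hg hb₂ hb₁' hb₂']
  refine Finset.stronglyMeasurable_fun_sum _ fun k₁ _ =>
    Finset.stronglyMeasurable_fun_sum _ fun k₂ _ =>
    Finset.stronglyMeasurable_fun_sum _ fun l₁ _ =>
    Finset.stronglyMeasurable_fun_sum _ fun l₂ _ => ?_
  refine StronglyMeasurable.mul (StronglyMeasurable.mul ?_ ?_) ?_
  · exact ((measurable_chiGood δ r _).comp measurable_fst).stronglyMeasurable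
  · exact ((measurable_chiGood δ r _).comp measurable_snd).stronglyMeasurable
  · exact ((pairing T).continuous₂.comp ((hf.continuous_doubleTerm hb₁ hb₂ _ _ _ _).prodMk
      (hg.continuous_doubleTerm hb₁' hb₂' _ _ _ _))).stronglyMeasurable

lemma hasSum_goodSum (hn : 0 < n) (hm : 0 < m) (δ : ℝ) (r : ℕ) (T : L2 n m →L[ℂ] L2 n m)
    (hf : IsTame₂ M R f) (hg : IsTame₂ M' R' g)
    (hb₁ : IsAccretive b₁ β₁ κ₁) (hb₂ : IsAccretive b₂ β₂ κ₂)
    (hb₁' : IsAccretive b₁' β₁' κ₁') (hb₂' : IsAccretive b₂' β₂' κ₂')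
    (ω : GridParam n) (ω' : GridParam m) :
    HasSum (scaleSum δ r T b₁ b₁' b₂ b₂' f g ω ω') (goodSum δ r T b₁ b₁' b₂ b₂' f g ω ω') := by
  obtain ⟨c, hc, hle⟩ := exists_scaleSum_bound hn hm δ r T hf hg hb₁ hb₂ hb₁' hb₂'
  exact (Summable.of_norm_bounded hc (hle ω ω')).hasSum

lemma stronglyMeasurable_hasSum {Ω ι : Type*} [MeasurableSpace Ω] [Countable ι] {F : ι → Ω → ℂ}
    {G : Ω → ℂ} (hF : ∀ i, StronglyMeasurable (F i)) (h : ∀ w, HasSum (fun i => F i w) (G w)) :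
    StronglyMeasurable G :=
  stronglyMeasurable_of_tendsto (ι := Finset ι) atTop
    (f := fun s w => ∑ i ∈ s, F i w)
    (fun s => Finset.stronglyMeasurable_fun_sum s fun i _ => hF i) (tendsto_pi_nhds.2 h)

lemma stronglyMeasurable_goodSum (hn : 0 < n) (hm : 0 < m) (δ : ℝ) (r : ℕ)
    (T : L2 n m →L[ℂ] L2 n m) (hf : IsTame₂ M R f) (hg : IsTame₂ M' R' g)
    (hb₁ : IsAccretive b₁ β₁ κ₁) (hb₂ : IsAccretive b₂ β₂ κ₂)
    (hb₁' : IsAccretive b₁' β₁' κ₁') (hb₂' : IsAccretive b₂' β₂' κ₂') :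
    StronglyMeasurable fun w : GridParam n × GridParam m =>
      goodSum δ r T b₁ b₁' b₂ b₂' f g w.1 w.2 :=
  stronglyMeasurable_hasSum
    (fun P => stronglyMeasurable_scaleSum δ r T hf hg hb₁ hb₂ hb₁' hb₂' P)
    fun w => hasSum_goodSum hn hm δ r T hf hg hb₁ hb₂ hb₁' hb₂' w.1 w.2

lemma exists_norm_goodSum_le (hn : 0 < n) (hm : 0 < m) (δ : ℝ) (r : ℕ)
    (T : L2 n m →L[ℂ] L2 n m) (hf : IsTame₂ M R f) (hg : IsTame₂ M' R' g)
    (hb₁ : IsAccretive b₁ β₁ κ₁) (hb₂ : IsAccretive b₂ β₂ κ₂)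
    (hb₁' : IsAccretive b₁' β₁' κ₁') (hb₂' : IsAccretive b₂' β₂' κ₂') :
    ∃ C : ℝ, ∀ ω ω', ‖goodSum δ r T b₁ b₁' b₂ b₂' f g ω ω'‖ ≤ C := by
  obtain ⟨c, hc, hle⟩ := exists_scaleSum_bound hn hm δ r T hf hg hb₁ hb₂ hb₁' hb₂'
  exact ⟨∑' P, c P, fun ω ω' => (hasSum_goodSum hn hm δ r T hf hg hb₁ hb₂ hb₁' hb₂'
    ω ω').norm_le_of_bounded hc.hasSum (hle ω ω')⟩

lemma integrable_goodSum (hn : 0 < n) (hm : 0 < m) (δ : ℝ) (r : ℕ) (T : L2 n m →L[ℂ] L2 n m)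
    (hf : IsTame₂ M R f) (hg : IsTame₂ M' R' g)
    (hb₁ : IsAccretive b₁ β₁ κ₁) (hb₂ : IsAccretive b₂ β₂ κ₂)
    (hb₁' : IsAccretive b₁' β₁' κ₁') (hb₂' : IsAccretive b₂' β₂' κ₂') :
    Integrable (fun w : GridParam n × GridParam m => goodSum δ r T b₁ b₁' b₂ b₂' f g w.1 w.2)
      ((gridMeasure n).prod (gridMeasure m)) := by
  obtain ⟨C, hC⟩ := exists_norm_goodSum_le hn hm δ r T hf hg hb₁ hb₂ hb₁' hb₂'
  exact Integrable.of_bound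
    (stronglyMeasurable_goodSum hn hm δ r T hf hg hb₁ hb₂ hb₁' hb₂').aestronglyMeasurable C
    (ae_of_all _ fun w => hC w.1 w.2)

/-- Regrouping of four scales: the scales of the second variable come first. -/
def scalesEquiv : (ℤ × ℤ) × (ℤ × ℤ) ≃ Scales where
  toFun x := (x.2.1, x.2.2, x.1.1, x.1.2)
  invFun P := ((P.2.2.1, P.2.2.2), (P.1, P.2.1))
  left_inv _ := rfl
  right_inv _ := rfl

/-- The average over the grids of the first variable. -/
lemma integral_goodSum_left (hn : 0 < n) (hm : 0 < m) (δ : ℝ) (r : ℕ) (T : L2 n m →L[ℂ] L2 n m)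
    (hf : IsTame₂ M R f) (hg : IsTame₂ M' R' g)
    (hb₁ : IsAccretive b₁ β₁ κ₁) (hb₂ : IsAccretive b₂ β₂ κ₂)
    (hb₁' : IsAccretive b₁' β₁' κ₁') (hb₂' : IsAccretive b₂' β₂' κ₂') (ω' : GridParam m) :
    ∫ ω, goodSum δ r T b₁ b₁' b₂ b₂' f g ω ω' ∂gridMeasure n =
      piGood n δ r * ∑' q : ℤ × ℤ, goodPairSum δ r (pairing T) (posSet m R) (posSet m R')
        (singleTerm b₁ b₂ f) (singleTerm b₁' b₂' g) ω' q := by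
  obtain ⟨c, hc, hle⟩ := exists_scaleSum_bound hn hm δ r T hf hg hb₁ hb₂ hb₁' hb₂'
  have hint : ∀ P, Integrable (fun ω => scaleSum δ r T b₁ b₁' b₂ b₂' f g ω ω' P)
      (gridMeasure n) := fun P =>
    Integrable.of_bound
      ((stronglyMeasurable_scaleSum δ r T hf hg hb₁ hb₂ hb₁' hb₂' P).comp_measurable
      (measurable_id.prodMk measurable_const)).aestronglyMeasurable (c P)
      (ae_of_all _ fun ω => hle ω ω' P)
  have hs := hasSum_integral_of_summable_integral_norm hint <|
    Summable.of_nonneg_of_le (fun P => integral_nonneg fun _ => norm_nonneg _) (fun P => by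
      calc _ ≤ ∫ _, c P ∂gridMeasure n :=
            integral_mono (hint P).norm (integrable_const _) fun ω => hle ω ω' P
        _ = _ := by simp) hc
  -- The scales of the first variable are summed with those of the second held fixed. Goodness in
  -- the second variable is then a constant, and the one-parameter formula applies to every pair of
  -- cubes there.
  have hs2 := (scalesEquiv.hasSum_iff.2 hs).prod_fiberwise (g := fun q : ℤ × ℤ =>
    piGood n δ r * goodPairSum δ r (pairing T) (posSet m R) (posSet m R')
        (singleTerm b₁ b₂ f) (singleTerm b₁' b₂' g) ω' q) fun q => ?_
  · rw [← tsum_mul_left]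
    exact hs2.tsum_eq.symm
  · have hu := fun l => hf.isGridDecomp_doubleTerm hn hb₁ hb₂ ω' q.1 l
    have hv := fun l => hg.isGridDecomp_doubleTerm hn hb₁' hb₂' ω' q.2 l
    have h1 : HasSum (fun p : ℤ × ℤ => ∑ l₁ ∈ posSet m R q.1, ∑ l₂ ∈ posSet m R' q.2,
        chiGood δ r ω' (small (q.1, l₁) (q.2, l₂)) * ∫ ω,
          goodPairSum δ r (pairing T) (posSet n R) (posSet n R')
          (fun ω p k => doubleTerm b₁ b₂ f ω ω' p k q.1 l₁)
          (fun ω p k => doubleTerm b₁' b₂' g ω ω' p k q.2 l₂) ω p ∂gridMeasure n)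
        (∑ l₁ ∈ posSet m R q.1, ∑ l₂ ∈ posSet m R' q.2,
        chiGood δ r ω' (small (q.1, l₁) (q.2, l₂)) * (piGood n δ r *
          pairing T (singleTerm b₁ b₂ f ω' q.1 l₁) (singleTerm b₁' b₂' g ω' q.2 l₂))) :=
      hasSum_sum fun l₁ _ => hasSum_sum fun l₂ _ =>
        (hasSum_integral_goodPairSum δ r (pairing T) (hu l₁) (hv l₂)).mul_left _
    have h2 : ∑ l₁ ∈ posSet m R q.1, ∑ l₂ ∈ posSet m R' q.2,
        chiGood δ r ω' (small (q.1, l₁) (q.2, l₂)) * (piGood n δ r *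
          pairing T (singleTerm b₁ b₂ f ω' q.1 l₁) (singleTerm b₁' b₂' g ω' q.2 l₂)) =
        piGood n δ r * goodPairSum δ r (pairing T) (posSet m R) (posSet m R')
          (singleTerm b₁ b₂ f) (singleTerm b₁' b₂' g) ω' q := by
      simp only [goodPairSum, Finset.mul_sum]
      exact Finset.sum_congr rfl fun _ _ => Finset.sum_congr rfl fun _ _ => by ring
    rw [← h2]
    refine Eq.mp (congrArg (fun F => HasSum F _) (funext fun p => Eq.symm ?_)) h1
    have hint2 : ∀ l₁ l₂, Integrable (fun ω => chiGood δ r ω' (small (q.1, l₁) (q.2, l₂)) *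
        goodPairSum δ r (pairing T) (posSet n R) (posSet n R')
          (fun ω p k => doubleTerm b₁ b₂ f ω ω' p k q.1 l₁)
          (fun ω p k => doubleTerm b₁' b₂' g ω ω' p k q.2 l₂) ω p) (gridMeasure n) :=
      fun l₁ l₂ => (Integrable.of_bound (stronglyMeasurable_goodPairSum δ r (pairing T) (hu l₁)
        (hv l₂) p).aestronglyMeasurable _ (ae_of_all _ fun ω =>
          norm_goodPairSum_le δ r (pairing T) (hu l₁) (hv l₂) ω p)).const_mul _
    change ∫ ω, scaleSum δ r T b₁ b₁' b₂ b₂' f g ω ω' (p.1, p.2, q.1, q.2) ∂gridMeasure n = _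
    simp only [scaleSum_eq_sum_goodPairSum δ r T hf hg hb₂ hb₁' hb₂']
    rw [integral_finsetSum _ fun l₁ _ => integrable_finsetSum _ fun l₂ _ => hint2 l₁ l₂]
    refine Finset.sum_congr rfl fun l₁ _ => ?_
    rw [integral_finsetSum _ fun l₂ _ => hint2 l₁ l₂]
    exact Finset.sum_congr rfl fun l₂ _ => integral_const_mul _ _

/-- **Averaging formula in two parameters.** -/
theorem integral_integral_goodSum (hn : 0 < n) (hm : 0 < m) (δ : ℝ) (r : ℕ)
    (T : L2 n m →L[ℂ] L2 n m) (hf : IsTame₂ M R f) (hg : IsTame₂ M' R' g)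
    (hb₁ : IsAccretive b₁ β₁ κ₁) (hb₂ : IsAccretive b₂ β₂ κ₂)
    (hb₁' : IsAccretive b₁' β₁' κ₁') (hb₂' : IsAccretive b₂' β₂' κ₂') :
    ∫ ω, ∫ ω', goodSum δ r T b₁ b₁' b₂ b₂' f g ω ω' ∂gridMeasure m ∂gridMeasure n =
      piGood n δ r * (piGood m δ r * form T (tensor b₁ b₂) (tensor b₁' b₂') f g) := by
  -- After Fubini the first grid is averaged with the second one frozen. What remains is again a
  -- one-parameter sum, now over the differences in the second variable.
  rw [integral_integral_swap (integrable_goodSum hn hm δ r T hf hg hb₁ hb₂ hb₁' hb₂')]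
  simp only [integral_goodSum_left hn hm δ r T hf hg hb₁ hb₂ hb₁' hb₂']
  rw [integral_const_mul, integral_tsum_goodPairSum δ r (pairing T)
    (hf.isGridDecomp_singleTerm hn hm hb₁ hb₂) (hg.isGridDecomp_singleTerm hn hm hb₁' hb₂'),
    form_eq_pairing T (hg.hasSum_singleTerm hn hm hb₁' hb₂' (fun _ _ => 0)).1]

end Averaging

end BiParam

end

/-! ### The averaging formula for smooth functions of compact support -/

theorem proposition4p1 {n m : ℕ} (hn : 0 < n) (hm : 0 < m)
    (b₁ b₁' : BiParam.E n → ℂ) (b₂ b₂' : BiParam.E m → ℂ)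
    (hb₁ : MemLp b₁ ∞ volume) (hb₂ : MemLp b₂ ∞ volume)
    (hb₁' : MemLp b₁' ∞ volume) (hb₂' : MemLp b₂' ∞ volume)
    (hb : BiParam.IsPseudoAccretive (BiParam.tensor b₁ b₂))
    (hb' : BiParam.IsPseudoAccretive (BiParam.tensor b₁' b₂'))
    (T : BiParam.L2 n m →L[ℂ] BiParam.L2 n m)
    (δ : ℝ) (hδ : 0 < δ)
    (f g : BiParam.E n × BiParam.E m → ℂ)
    (hf : ContDiff ℝ ((⊤ : ℕ∞) : WithTop ℕ∞) f) (hfc : HasCompactSupport f)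
    (hg : ContDiff ℝ ((⊤ : ℕ∞) : WithTop ℕ∞) g) (hgc : HasCompactSupport g) :
    -- the probability of being good does not depend on the cube, and is positive for large `r`
    (∀ (r : ℕ) (I : BiParam.CubeLabel n), BiParam.goodProb δ r I = BiParam.piGood n δ r) ∧
    (∀ (r : ℕ) (J : BiParam.CubeLabel m), BiParam.goodProb δ r J = BiParam.piGood m δ r) ∧
    (∃ r₀ : ℕ, ∀ r : ℕ, r₀ ≤ r → 0 < BiParam.piGood n δ r ∧ 0 < BiParam.piGood m δ r) ∧
    -- all the functions that enter the bilinear forms are square integrable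
    (∀ (ω : BiParam.GridParam n) (ω' : BiParam.GridParam m)
      (I : BiParam.CubeLabel n) (J : BiParam.CubeLabel m),
      MemLp (fun y => BiParam.tensor b₁ b₂ y * BiParam.doubleDelta b₁ b₂ ω ω' I J f y)
        2 volume ∧
      MemLp (BiParam.doubleDelta b₁' b₂' ω ω' I J g) 2 volume) ∧
    -- the averaging formula
    (∀ r : ℕ, 0 < BiParam.piGood n δ r → 0 < BiParam.piGood m δ r →
      (∀ (ω : BiParam.GridParam n) (ω' : BiParam.GridParam m),
        (∀ P : BiParam.Scales,
          (Function.support (BiParam.summand δ r T b₁ b₁' b₂ b₂' f g ω ω' P)).Finite) ∧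
        Summable (BiParam.scaleSum δ r T b₁ b₁' b₂ b₂' f g ω ω')) ∧
      Integrable (fun w : BiParam.GridParam n × BiParam.GridParam m =>
          BiParam.goodSum δ r T b₁ b₁' b₂ b₂' f g w.1 w.2)
        ((BiParam.gridMeasure n).prod (BiParam.gridMeasure m)) ∧
      BiParam.form T (BiParam.tensor b₁ b₂) (BiParam.tensor b₁' b₂') f g =
        1 / ((BiParam.piGood n δ r : ℂ) * (BiParam.piGood m δ r : ℂ)) *
          ∫ ω, ∫ ω', BiParam.goodSum δ r T b₁ b₁' b₂ b₂' f g ω ω'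
            ∂(BiParam.gridMeasure m) ∂(BiParam.gridMeasure n)) := by
  obtain ⟨⟨β₁, κ₁, hc₁⟩, β₂, κ₂, hc₂⟩ := BiParam.exists_isAccretive hb₁ hb₂ hb
  obtain ⟨⟨β₁', κ₁', hc₁'⟩, β₂', κ₂', hc₂'⟩ := BiParam.exists_isAccretive hb₁' hb₂' hb'
  obtain ⟨M, R, hF⟩ := BiParam.exists_isTame₂ hf hfc
  obtain ⟨M', R', hG⟩ := BiParam.exists_isTame₂ hg hgc
  refine ⟨BiParam.goodProb_eq δ, BiParam.goodProb_eq δ, ?_, fun ω ω' I J => ⟨?_, ?_⟩,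
    fun r hr hr' => ⟨fun ω ω' => ⟨fun P => ?_, ?_⟩, ?_, ?_⟩⟩
  · obtain ⟨r₁, h₁⟩ := BiParam.exists_piGood_pos hn hδ
    obtain ⟨r₂, h₂⟩ := BiParam.exists_piGood_pos hm hδ
    exact ⟨max r₁ r₂, fun r hr => ⟨h₁ r ((le_max_left _ _).trans hr),
      h₂ r ((le_max_right _ _).trans hr)⟩⟩
  · exact hF.memLp_doubleDelta hc₁ hc₂ ω ω' I.1 J.1 I.2 J.2
  · exact hG.memLp_doubleDelta' hc₁' hc₂' ω ω' I.1 J.1 I.2 J.2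
  · exact (Finset.finite_toSet _).subset
      (BiParam.support_summand_subset δ r T hF hG hc₂ hc₁' hc₂' ω ω' P)
  · obtain ⟨c, hc, hle⟩ := BiParam.exists_scaleSum_bound hn hm δ r T hF hG hc₁ hc₂ hc₁' hc₂'
    exact Summable.of_norm_bounded hc fun P => hle ω ω' P
  · exact BiParam.integrable_goodSum hn hm δ r T hF hG hc₁ hc₂ hc₁' hc₂'
  · rw [BiParam.integral_integral_goodSum hn hm δ r T hF hG hc₁ hc₂ hc₁' hc₂']
    have h1 : (BiParam.piGood n δ r : ℂ) ≠ 0 := by exact_mod_cast hr.ne'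
    have h2 : (BiParam.piGood m δ r : ℂ) ≠ 0 := by exact_mod_cast hr'.ne'
    field_simp
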